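/- All graphs are finite, simple and undirected. A \emph{rainbow colouring} of a connected graph $G$ is a colouring of its edges such that any two vertices are joined by a path no two of whose edges have the same colour; $rc(G)$ is the least number of colours in a rainbow colouring of $G$. Let $n$, $m$, $d$, $r$ and $b$ denote the number of vertices, the number of edges, the diameter, the radius and the number of bridges of $G$; $G$ is \emph{bridgeless} if it is connected and $b=0$. Algorithms run on a unit-cost random access machine with words of $O(\log n)$ bits; the input is the list of the edges of $G$ in any order, and the output is a colour for each edge. A time bound $O(f)$ means at most $C(f+1)$ elementary operations, with a constant $C$ independent of $G$ (the summand $1$ matters only for the one-vertex graph). 1. There is an algorithm which, for every bridgeless graph $G$, finds in time $O(nm)$ a rainbow colouring of $G$ with at most $r(r+2)$ colours, and with at most $(r+2)\,rc(G)$ colours. 2. There is an algorithm which, for every bridgeless graph $G$, finds in time $O(dm)$ a rainbow colouring of $G$ with at most $d(d+2)$ colours, and with at most $(d+2)\,rc(G)$ colours. 3. Let $G$ be a connected graph, and let $G'$ be obtained from $G$ by contracting every bridge. Then $G'$ is bridgeless, its radius is at most $r$, its diameter is at most $d$, and $rc(G)\le rc(G')+b$. Moreover $rc(G)\le r(r+2)+b$.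 4. There is an algorithm which, for every connected graph $G$, finds in time $O(nm)$ a rainbow colouring of $G$ with at most $r(r+2)+b$ colours, and with at most $(r+3)\,rc(G)$ colours. 5. There is an algorithm which, for every connected graph $G$, finds in time $O(dm)$ a rainbow colouring of $G$ with at most $d(d+2)+b$ colours, and with at most $(d+3)\,rc(G)$ colours. -/

import Mathlib

namespace Rainbow

section Graphs

variable {V : Type*}

/-- A connected graph without bridges. -/
def Bridgeless (G : SimpleGraph V) : Prop :=
  G.Connected ∧ ∀ e ∈ G.edgeSet, ¬ G.IsBridge e

/-- The number of bridges of a (finite) graph. -/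
noncomputable def numBridges (G : SimpleGraph V) : ℕ :=
  {e | e ∈ G.edgeSet ∧ G.IsBridge e}.ncard

/-- `col` is a rainbow colouring of `G`: any two vertices are joined by a path of `G` no two of
whose edges have the same colour. Only the values of `col` at edges of `G` matter. -/
def IsRainbowColouring (G : SimpleGraph V) (col : Sym2 V → ℕ) : Prop :=
  ∀ u v : V, ∃ p : G.Walk u v, p.IsPath ∧ (p.edges.map col).Nodup

/-- The rainbow connection number: the least `k` such that some rainbow colouring of `G`
colours its edges with the `k` colours `0, …, k - 1`. -/
noncomputable def rc (G : SimpleGraph V) : ℕ :=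
  sInf {k | ∃ col : Sym2 V → ℕ, (∀ e ∈ G.edgeSet, col e < k) ∧ IsRainbowColouring G col}

/-- The spanning subgraph whose edges are the bridges of `G`. -/
def bridgeGraph (G : SimpleGraph V) : SimpleGraph V :=
  SimpleGraph.fromEdgeSet {e | e ∈ G.edgeSet ∧ G.IsBridge e}

/-- The graph obtained from `G` by contracting every bridge: its vertices are the classes of
vertices joined to each other by bridges, and two distinct classes are adjacent when an edge of `G`
joins them. -/
def contractBridges (G : SimpleGraph V) : SimpleGraph (bridgeGraph G).ConnectedComponent where
  Adj a b := a ≠ b ∧ ∃ u v, (bridgeGraph G).connectedComponentMk u = a ∧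
    (bridgeGraph G).connectedComponentMk v = b ∧ G.Adj u v
  symm := ⟨fun _ _ ⟨h, u, v, hu, hv, huv⟩ => ⟨h.symm, v, u, hv, hu, huv.symm⟩⟩
  loopless := ⟨fun _ h => h.1 rfl⟩

end Graphs

/-! Random access machine with unit cost: programs, their semantics and their running time. -/

/-- A memory state: integer registers and random access arrays, both named by numbers
(a program mentions only finitely many of them). -/
structure State where
  reg : ℕ → ℕ
  mem : ℕ → ℕ → ℕ

/-- Arithmetic expressions: `read a i` is the content of cell `i` of the array `a`. -/
inductive Expr where
  | lit (c : ℕ)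
  | var (x : ℕ)
  | read (a : ℕ) (i : Expr)
  | add (e f : Expr)
  | sub (e f : Expr)

/-- The value of an expression (subtraction is truncated at `0`). -/
def Expr.eval (σ : State) : Expr → ℕ
  | .lit c => c
  | .var x => σ.reg x
  | .read a i => σ.mem a (i.eval σ)
  | .add e f => e.eval σ + f.eval σ
  | .sub e f => e.eval σ - f.eval σ

/-- No number greater than `W` occurs in the evaluation of the expression. -/
def Expr.Fits (W : ℕ) (σ : State) : Expr → Prop
  | .lit c => c ≤ W
  | .var x => σ.reg x ≤ W
  | .read a i => i.Fits W σ ∧ σ.mem a (i.eval σ) ≤ W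
  | .add e f => e.Fits W σ ∧ f.Fits W σ ∧ e.eval σ + f.eval σ ≤ W
  | .sub e f => e.Fits W σ ∧ f.Fits W σ

/-- The number of elementary operations in the evaluation of an expression. -/
def Expr.cost : Expr → ℕ
  | .lit _ => 1
  | .var _ => 1
  | .read _ i => i.cost + 1
  | .add e f => e.cost + f.cost + 1
  | .sub e f => e.cost + f.cost + 1

/-- Tests. -/
inductive Test where
  | lt (e f : Expr)
  | eq (e f : Expr)
  | not (b : Test)
  | and (b c : Test)

/-- The test succeeds. -/
def Test.Holds (σ : State) : Test → Prop
  | .lt e f => e.eval σ < f.eval σ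
  | .eq e f => e.eval σ = f.eval σ
  | .not b => ¬ b.Holds σ
  | .and b c => b.Holds σ ∧ c.Holds σ

/-- No number greater than `W` occurs in the evaluation of the test. -/
def Test.Fits (W : ℕ) (σ : State) : Test → Prop
  | .lt e f => e.Fits W σ ∧ f.Fits W σ
  | .eq e f => e.Fits W σ ∧ f.Fits W σ
  | .not b => b.Fits W σ
  | .and b c => b.Fits W σ ∧ c.Fits W σ

/-- The number of elementary operations in the evaluation of a test. -/
def Test.cost : Test → ℕ
  | .lt e f => e.cost + f.cost + 1
  | .eq e f => e.cost + f.cost + 1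
  | .not b => b.cost + 1
  | .and b c => b.cost + c.cost + 1

/-- Programs. -/
inductive Prog where
  | skip
  | assign (x : ℕ) (e : Expr)
  | write (a : ℕ) (i e : Expr)
  | seq (p q : Prog)
  | ite (b : Test) (p q : Prog)
  | loop (b : Test) (p : Prog)

/-- Put a value into a register. -/
def State.setReg (σ : State) (x v : ℕ) : State :=
  { σ with reg := Function.update σ.reg x v }

/-- Put a value into a cell of an array. -/
def State.setMem (σ : State) (a i v : ℕ) : State :=
  { σ with mem := Function.update σ.mem a (Function.update (σ.mem a) i v) }

/-- `Exec W p σ t τ`: on a machine whose words hold the numbers `0, …, W`, the program `p` started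
in the state `σ` halts in the state `τ` after exactly `t` elementary operations. A program in which
a number greater than `W` occurs crashes: it has no execution. `loop b p` repeats `p` while the test
`b` succeeds. -/
inductive Exec (W : ℕ) : Prog → State → ℕ → State → Prop where
  | skip (σ : State) : Exec W .skip σ 1 σ
  | assign (x : ℕ) (e : Expr) (σ : State) (he : e.Fits W σ) :
      Exec W (.assign x e) σ (e.cost + 1) (σ.setReg x (e.eval σ))
  | write (a : ℕ) (i e : Expr) (σ : State) (hi : i.Fits W σ) (he : e.Fits W σ) :
      Exec W (.write a i e) σ (i.cost + e.cost + 1) (σ.setMem a (i.eval σ) (e.eval σ))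
  | seq {p q : Prog} {σ τ υ : State} {s t : ℕ} (hp : Exec W p σ s τ) (hq : Exec W q τ t υ) :
      Exec W (.seq p q) σ (s + t) υ
  | iteTrue {b : Test} {p q : Prog} {σ τ : State} {t : ℕ} (hf : b.Fits W σ) (hb : b.Holds σ)
      (hp : Exec W p σ t τ) : Exec W (.ite b p q) σ (b.cost + t) τ
  | iteFalse {b : Test} {p q : Prog} {σ τ : State} {t : ℕ} (hf : b.Fits W σ) (hb : ¬ b.Holds σ)
      (hq : Exec W q σ t τ) : Exec W (.ite b p q) σ (b.cost + t) τ
  | loopTrue {b : Test} {p : Prog} {σ τ υ : State} {s t : ℕ} (hf : b.Fits W σ) (hb : b.Holds σ)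
      (hp : Exec W p σ s τ) (hl : Exec W (.loop b p) τ t υ) :
      Exec W (.loop b p) σ (b.cost + s + t) υ
  | loopFalse {b : Test} {p : Prog} {σ : State} (hf : b.Fits W σ) (hb : ¬ b.Holds σ) :
      Exec W (.loop b p) σ b.cost σ

/-! Input and output of a colouring algorithm. -/

/-- `e` lists every edge of `G` exactly once, as a pair of end vertices, in any order and
with any orientation. -/
def IsEdgeList {n m : ℕ} (G : SimpleGraph (Fin n)) (e : Fin m → Fin n × Fin n) : Prop :=
  Function.Injective (fun i => s((e i).1, (e i).2)) ∧
    Set.range (fun i => s((e i).1, (e i).2)) = G.edgeSet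

/-- The initial state: registers `0` and `1` hold the numbers of vertices and of edges, cell `i` of
arrays `0` and `1` holds the two ends of the `i`-th edge; everything else is `0`. -/
def inputState {n m : ℕ} (e : Fin m → Fin n × Fin n) : State where
  reg x := if x = 0 then n else if x = 1 then m else 0
  mem a i := if h : i < m then
      if a = 0 then ((e ⟨i, h⟩).1 : ℕ) else if a = 1 then ((e ⟨i, h⟩).2 : ℕ) else 0
    else 0

/-- With words for the numbers `0, …, W`, the program `p`, given the edge list `e` of `G`, halts
after at most `T` elementary operations, and then cell `i` of array `2` holds the colour of the
`i`-th edge in a rainbow colouring of `G` that uses exactly `k` colours. -/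
def RainbowColours (p : Prog) (W T : ℕ) {n m : ℕ} (G : SimpleGraph (Fin n))
    (e : Fin m → Fin n × Fin n) (k : ℕ) : Prop :=
  ∃ t ≤ T, ∃ τ : State, Exec W p (inputState e) t τ ∧
    ∃ col : Sym2 (Fin n) → ℕ, (∀ i : Fin m, col s((e i).1, (e i).2) = τ.mem 2 i) ∧
      IsRainbowColouring G col ∧ (col '' G.edgeSet).ncard = k

end Rainbow

namespace Rainbow

/-! ### Verification of programs -/

/-! One procedure serves every algorithmic claim. Take a breadth-first tree of height `h` and grow a
set `D`, closed under parents, from the root until it is everything. Whenever `k` phases remain, `D`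
contains all vertices of depth at most `h - k`, so each branch of the tree hanging from `D` has
fewer than `k` edges below its top vertex. A scan of the non-tree edges gives types 1 and 2 to the
branches: an edge between two different branches that meets an untyped one becomes an ear, and types
are chosen so that its ends have different types; `D` counts as a branch of type 2. A branch that
stays untyped is left by no non-tree edge, so the tree edge above it is a bridge (`IsTyping.isCut`).

A tree edge at level `j` of a branch of type `t` gets the colour `base + 2 * j + t`, an ear gets
`base`, and a bridge gets the number of its lower vertex, a colour below `n`. The new `D` consists
of the old one, the branch roots, the ends of ears, and all their ancestors. Vertices of different
types climb to `D` with disjoint colours. Of two vertices of the same type, the one of smaller level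
climbs, while the other descends to its ear, crosses it and climbs on the far side: it uses only
larger levels of its own type, then `base`, then the opposite type (`IsRecolouring.rainbow_up`,
`IsTyping.rainbow_around`, `IsPartial.step`). A phase costs `2 * k + 1` new colours, and these add
up to `h * (h + 2)`, besides one colour for each bridge.

From an arbitrary root, `h` is at most the diameter; from a root of least height among all
breadth-first trees, `h` is at most the radius (`centre_runs`). A phase and a search take time
linear in `n + m`, and connectedness gives `n ≤ m + 1`. The running times are proved for actual
programs with a small calculus: invariants for loops (`Runs.loop`), weakest preconditions for the
rest (`Runs.of_wp`), and a bound on all stored numbers that keeps them within the words.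

The approximation factors hold because a rainbow path has no more edges than there are colours, so
radius and diameter are at most `rc` (`ediam_le_rc`), and because bridges receive distinct colours
in every rainbow colouring (`numBridges_le_rc`).

Contraction of the bridges is treated apart. The contracted graph has no parallel edges
(`eq_of_map_cls`), so walks that avoid an edge project to walks that avoid its image. A rainbow
colouring upstairs is obtained by pulling back one downstairs and giving each bridge a private
colour (`rc_le_contractBridges`). -/

/-- Every number in the state is at most `B`. -/
def State.Bdd (B : ℕ) (σ : State) : Prop :=
  (∀ x, σ.reg x ≤ B) ∧ ∀ a i, σ.mem a i ≤ B

@[simp] theorem State.reg_setReg (σ : State) (x v y : ℕ) :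
    (σ.setReg x v).reg y = if y = x then v else σ.reg y := by
  simp [State.setReg, Function.update_apply]

@[simp] theorem State.mem_setReg (σ : State) (x v : ℕ) : (σ.setReg x v).mem = σ.mem := rfl

@[simp] theorem State.reg_setMem (σ : State) (a i v : ℕ) : (σ.setMem a i v).reg = σ.reg := rfl

@[simp] theorem State.mem_setMem (σ : State) (a i v b : ℕ) :
    (σ.setMem a i v).mem b = if b = a then Function.update (σ.mem a) i v else σ.mem b := by
  simp [State.setMem, Function.update_apply]

theorem State.Bdd.setReg {B : ℕ} {σ : State} (h : σ.Bdd B) {x v : ℕ} (hv : v ≤ B) :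
    (σ.setReg x v).Bdd B := by
  refine ⟨fun y => ?_, h.2⟩
  rw [State.reg_setReg]
  split
  exacts [hv, h.1 y]

theorem State.Bdd.setMem {B : ℕ} {σ : State} (h : σ.Bdd B) {a i v : ℕ} (hv : v ≤ B) :
    (σ.setMem a i v).Bdd B := by
  refine ⟨h.1, fun b j => ?_⟩
  rw [State.mem_setMem]
  split
  · rw [Function.update_apply]
    split
    exacts [hv, h.2 a j]
  · exact h.2 b j

/-- A factor by which the value of an expression can exceed the numbers in the state. -/
def Expr.weight : Expr → ℕ
  | .lit c => c + 1
  | .var _ => 1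
  | .read _ i => i.weight + 1
  | .add e f => e.weight + f.weight
  | .sub e f => e.weight + f.weight

/-- The sum of the weights of the expressions in a test. -/
def Test.weight : Test → ℕ
  | .lt e f => e.weight + f.weight
  | .eq e f => e.weight + f.weight
  | .not b => b.weight
  | .and b c => b.weight + c.weight

/-- The sum of the weights of the expressions in a program. -/
def Prog.weight : Prog → ℕ
  | .skip => 0
  | .assign _ e => e.weight
  | .write _ i e => i.weight + e.weight
  | .seq p q => p.weight + q.weight
  | .ite b p q => b.weight + p.weight + q.weight
  | .loop b p => b.weight + p.weight

/-- There is no multiplication among the operations, so a value exceeds the stored numbers at most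
by a factor that depends on the expression alone. This is why words for numbers polynomial in `n`
suffice for a fixed program. -/
theorem Expr.eval_le_weight {B : ℕ} {σ : State} (h : σ.Bdd B) (e : Expr) :
    e.eval σ ≤ e.weight * (B + 1) := by
  induction e with
  | lit c => simp only [Expr.eval, Expr.weight]; nlinarith
  | var x => simpa [Expr.eval, Expr.weight] using (h.1 x).trans (Nat.le_succ B)
  | read a i _ => simp only [Expr.eval, Expr.weight]; nlinarith [h.2 a (i.eval σ)]
  | add e f he hf => simp only [Expr.eval, Expr.weight]; nlinarith
  | sub e f he hf =>
    simp only [Expr.eval, Expr.weight]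
    have := Nat.sub_le (e.eval σ) (f.eval σ)
    nlinarith

theorem Expr.fits_of_weight {B W : ℕ} {σ : State} (h : σ.Bdd B) (e : Expr)
    (hW : e.weight * (B + 1) ≤ W) : e.Fits W σ := by
  induction e with
  | lit c => simp only [Expr.Fits, Expr.weight] at *; nlinarith
  | var x =>
    have := h.1 x
    simp only [Expr.Fits, Expr.weight] at *
    omega
  | read a i ih =>
    have := h.2 a (i.eval σ)
    simp only [Expr.Fits, Expr.weight] at *
    exact ⟨ih (by nlinarith), by nlinarith⟩
  | add e f he hf =>
    have h1 := Expr.eval_le_weight h e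
    have h2 := Expr.eval_le_weight h f
    simp only [Expr.Fits, Expr.weight] at *
    exact ⟨he (by nlinarith), hf (by nlinarith), by nlinarith⟩
  | sub e f he hf =>
    simp only [Expr.Fits, Expr.weight] at *
    exact ⟨he (by nlinarith), hf (by nlinarith)⟩

theorem Test.fits_of_weight {B W : ℕ} {σ : State} (h : σ.Bdd B) (b : Test)
    (hW : b.weight * (B + 1) ≤ W) : b.Fits W σ := by
  induction b with
  | lt e f =>
    simp only [Test.Fits, Test.weight] at *
    exact ⟨e.fits_of_weight h (by nlinarith), f.fits_of_weight h (by nlinarith)⟩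
  | eq e f =>
    simp only [Test.Fits, Test.weight] at *
    exact ⟨e.fits_of_weight h (by nlinarith), f.fits_of_weight h (by nlinarith)⟩
  | not b ih => exact ih hW
  | and b c hb hc =>
    simp only [Test.Fits, Test.weight] at *
    exact ⟨hb (by nlinarith), hc (by nlinarith)⟩

/-- The program halts within `t` operations in a bounded state that satisfies `Q`, whenever the
words are long enough for it. -/
def Runs (B : ℕ) (p : Prog) (t : ℕ) (Q : State → Prop) (σ : State) : Prop :=
  ∀ W, p.weight * (B + 1) ≤ W →
    ∃ s ≤ t, ∃ τ, Exec W p σ s τ ∧ τ.Bdd B ∧ Q τ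

theorem Runs.mono {B : ℕ} {p : Prog} {t t' : ℕ} {Q Q' : State → Prop} {σ : State}
    (h : Runs B p t Q σ) (ht : t ≤ t') (hQ : ∀ τ, τ.Bdd B → Q τ → Q' τ) : Runs B p t' Q' σ := by
  intro W hW
  obtain ⟨s, hs, τ, hx, hb, hq⟩ := h W hW
  exact ⟨s, hs.trans ht, τ, hx, hb, hQ τ hb hq⟩

theorem Runs.seq {B : ℕ} {p q : Prog} {s t : ℕ} {Q : State → Prop} {σ : State}
    (h : Runs B p s (fun τ => Runs B q t Q τ) σ) : Runs B (.seq p q) (s + t) Q σ := by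
  intro W hW
  simp only [Prog.weight, add_mul] at hW
  obtain ⟨s', hs, τ, hx, hb, hq⟩ := h W (by omega)
  obtain ⟨t', ht, υ, hx', hb', hq'⟩ := hq W (by omega)
  exact ⟨s' + t', by omega, υ, .seq hx hx', hb', hq'⟩

/-- Values that need no bound of their own. -/
def Expr.Simple : Expr → Prop
  | .lit _ => False
  | .var _ => True
  | .read _ _ => True
  | .add _ _ => False
  | .sub e _ => e.Simple

theorem Expr.Simple.eval_le {B : ℕ} {σ : State} (h : σ.Bdd B) {e : Expr} (he : e.Simple) :
    e.eval σ ≤ B := by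
  induction e with
  | lit c => exact he.elim
  | var x => exact h.1 x
  | read a i _ => exact h.2 a _
  | add e f _ _ => exact he.elim
  | sub e f ih _ => exact (Nat.sub_le _ _).trans (ih he)

/-- Weakest precondition of a program without loops. -/
def Prog.wp (B : ℕ) : Prog → (State → Prop) → State → Prop
  | .skip, Q, σ => Q σ
  -- A simple value is at most some number already stored; only for other values is the bound `B` an
  -- obligation.
  | .assign x e, Q, σ => (¬ e.Simple → e.eval σ ≤ B) ∧ Q (σ.setReg x (e.eval σ))
  | .write a i e, Q, σ => (¬ e.Simple → e.eval σ ≤ B) ∧ Q (σ.setMem a (i.eval σ) (e.eval σ))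
  | .seq p q, Q, σ => p.wp B (q.wp B Q) σ
  | .ite b p q, Q, σ => (b.Holds σ → p.wp B Q σ) ∧ (¬ b.Holds σ → q.wp B Q σ)
  | .loop _ _, _, _ => False

/-- A bound for the running time of a program without loops. -/
def Prog.time : Prog → ℕ
  | .skip => 1
  | .assign _ e => e.cost + 1
  | .write _ i e => i.cost + e.cost + 1
  | .seq p q => p.time + q.time
  -- Counting both branches makes the bound independent of the state. The value for loops is a
  -- dummy, as `wp` is `False` there.
  | .ite b p q => b.cost + (p.time + q.time)
  | .loop _ _ => 0

theorem Runs.of_wp {B : ℕ} {p : Prog} {Q : State → Prop} {σ : State} (hσ : σ.Bdd B)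
    (h : p.wp B Q σ) : Runs B p p.time Q σ := by
  induction p generalizing Q σ with
  | skip => exact fun W _ => ⟨1, le_rfl, σ, .skip σ, hσ, h⟩
  | assign x e =>
    refine fun W hW => ⟨_, le_rfl, _, .assign x e σ (e.fits_of_weight hσ hW),
      hσ.setReg ?_, h.2⟩
    by_cases he : e.Simple
    exacts [he.eval_le hσ, h.1 he]
  | write a i e =>
    refine fun W hW => ?_
    simp only [Prog.weight, add_mul] at hW
    refine ⟨_, le_rfl, _, .write a i e σ (i.fits_of_weight hσ (by omega))
      (e.fits_of_weight hσ (by omega)), hσ.setMem ?_, h.2⟩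
    by_cases he : e.Simple
    exacts [he.eval_le hσ, h.1 he]
  | seq p q hp hq => exact Runs.seq ((hp hσ h).mono le_rfl fun τ hb hτ => hq hb hτ)
  | ite b p q hp hq =>
    intro W hW
    simp only [Prog.weight, add_mul] at hW
    have hf : b.Fits W σ := b.fits_of_weight hσ (by omega)
    by_cases hb : b.Holds σ
    · obtain ⟨s, hs, τ, hx, hB, hQ⟩ := hp hσ (h.1 hb) W (by omega)
      exact ⟨_, by simp only [Prog.time]; omega, τ, .iteTrue hf hb hx, hB, hQ⟩
    · obtain ⟨s, hs, τ, hx, hB, hQ⟩ := hq hσ (h.2 hb) W (by omega)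
      exact ⟨_, by simp only [Prog.time]; omega, τ, .iteFalse hf hb hx, hB, hQ⟩
  | loop b p => exact h.elim

/-- A loop whose invariant `I f` leaves at most `f` further rounds. -/
theorem Runs.loop {B : ℕ} {b : Test} {p : Prog} {c : ℕ} (I : ℕ → State → Prop)
    (hstep : ∀ f σ, σ.Bdd B → I f σ → b.Holds σ →
      ∃ f', f = f' + 1 ∧ Runs B p c (I f') σ)
    {f : ℕ} {σ : State} (hσ : σ.Bdd B) (hI : I f σ) :
    Runs B (.loop b p) (f * (b.cost + c) + b.cost) (fun τ => (∃ f', I f' τ) ∧ ¬ b.Holds τ) σ := by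
  intro W hW
  simp only [Prog.weight, add_mul] at hW
  induction f generalizing σ with
  | zero =>
    -- The test cannot succeed without fuel, since a round would write `0` as a successor.
    have hb : ¬ b.Holds σ := fun hb => by
      obtain ⟨f', h, _⟩ := hstep _ _ hσ hI hb
      omega
    exact ⟨b.cost, by simp, σ, .loopFalse (b.fits_of_weight hσ (by omega)) hb, hσ, ⟨_, hI⟩, hb⟩
  | succ f ih =>
    have hf : b.Fits W σ := b.fits_of_weight hσ (by omega)
    by_cases hb : b.Holds σ
    · obtain ⟨f', h, hr⟩ := hstep _ _ hσ hI hb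
      obtain rfl : f = f' := by omega
      obtain ⟨s, hs, τ, hx, hB, hQ⟩ := hr W (by omega)
      obtain ⟨t, ht, υ, hx', hB', hQ'⟩ := ih hB hQ
      exact ⟨_, by rw [add_mul]; omega, υ, .loopTrue hf hb hx hx', hB', hQ'⟩
    · exact ⟨b.cost, by omega, σ, .loopFalse hf hb, hσ, ⟨_, hI⟩, hb⟩

/-- A loop that counts register `x` up to the value `N` of register `y`. -/
theorem Runs.forUp {B x y c N : ℕ} {p : Prog} (I : ℕ → State → Prop)
    (hx : ∀ i σ, I i σ → σ.reg x = i ∧ σ.reg y = N)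
    (hstep : ∀ i σ, σ.Bdd B → I i σ → i < N → Runs B p c (I (i + 1)) σ)
    {i : ℕ} (hi : i ≤ N) {σ : State} (hσ : σ.Bdd B) (hI : I i σ) :
    Runs B (.loop (.lt (.var x) (.var y)) p) (N * (3 + c) + 3) (I N) σ := by
  -- The fuel is the distance from the counter to `N`; the constant 3 in the bound is the cost of
  -- the test.
  refine (Runs.loop (b := .lt (.var x) (.var y)) (p := p) (c := c) (f := N - i)
    (fun f τ => ∃ j, f + j = N ∧ I j τ) ?_ hσ ⟨i, by omega, hI⟩).mono ?_ ?_
  · rintro f τ hτ ⟨j, hj, hI⟩ hb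
    simp only [Test.Holds, Expr.eval, (hx _ _ hI).1, (hx _ _ hI).2] at hb
    refine ⟨f - 1, by omega, (hstep j τ hτ hI hb).mono le_rfl fun υ _ hυ => ⟨j + 1, by omega, hυ⟩⟩
  · simp only [Test.cost, Expr.cost, Nat.reduceAdd]
    have := Nat.mul_le_mul_right (3 + c) (Nat.sub_le N i)
    omega
  · rintro τ _ ⟨⟨f, j, hj, hI⟩, hb⟩
    simp only [Test.Holds, Expr.eval, (hx _ _ hI).1, (hx _ _ hI).2] at hb
    obtain rfl : j = N := by omega
    exact hI

/-- A loop that counts register `x` down to `0`. -/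
theorem Runs.forDown {B x c : ℕ} {p : Prog} (I : ℕ → State → Prop)
    (hx : ∀ i σ, I i σ → σ.reg x = i)
    (hstep : ∀ i σ, σ.Bdd B → I (i + 1) σ → Runs B p c (I i) σ)
    {i : ℕ} {σ : State} (hσ : σ.Bdd B) (hI : I i σ) :
    Runs B (.loop (.lt (.lit 0) (.var x)) p) (i * (3 + c) + 3) (I 0) σ := by
  refine (Runs.loop (b := .lt (.lit 0) (.var x)) (p := p) (c := c) (f := i) I ?_ hσ hI).mono
    (by simp only [Test.cost, Expr.cost, Nat.reduceAdd]; omega) ?_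
  · intro f τ hτ hI hb
    simp only [Test.Holds, Expr.eval, hx _ _ hI] at hb
    obtain ⟨f, rfl⟩ : ∃ g, f = g + 1 := ⟨f - 1, by omega⟩
    exact ⟨f, rfl, hstep f τ hτ hI⟩
  · rintro τ _ ⟨⟨f, hI⟩, hb⟩
    simp only [Test.Holds, Expr.eval, hx _ _ hI] at hb
    obtain rfl : f = 0 := by omega
    exact hI

end Rainbow

namespace Rainbow

/-! ### Rainbow trails in a graph given by arrays -/

/-- Edge number `i` joins `u` and `v`. -/
def Link (m : ℕ) (E₀ E₁ : ℕ → ℕ) (i u v : ℕ) : Prop :=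
  i < m ∧ ((E₀ i = u ∧ E₁ i = v) ∨ (E₀ i = v ∧ E₁ i = u))

theorem Link.symm {m : ℕ} {E₀ E₁ : ℕ → ℕ} {i u v : ℕ} (h : Link m E₀ E₁ i u v) :
    Link m E₀ E₁ i v u := ⟨h.1, h.2.symm⟩

/-- A walk from `u` to `v` along the edges with the given numbers. -/
inductive Trail (m : ℕ) (E₀ E₁ : ℕ → ℕ) : ℕ → ℕ → List ℕ → Prop where
  | nil (u : ℕ) : Trail m E₀ E₁ u u []
  | cons {i u v w : ℕ} {L : List ℕ} (h : Link m E₀ E₁ i u w) (t : Trail m E₀ E₁ w v L) :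
      Trail m E₀ E₁ u v (i :: L)

theorem Trail.append {m : ℕ} {E₀ E₁ : ℕ → ℕ} {u v w : ℕ} {L M : List ℕ}
    (h : Trail m E₀ E₁ u v L) (h' : Trail m E₀ E₁ v w M) : Trail m E₀ E₁ u w (L ++ M) := by
  induction h with
  | nil u => exact h'
  | cons hl _ ih => exact .cons hl (ih h')

theorem Trail.reverse {m : ℕ} {E₀ E₁ : ℕ → ℕ} {u v : ℕ} {L : List ℕ}
    (h : Trail m E₀ E₁ u v L) : Trail m E₀ E₁ v u L.reverse := by
  induction h with
  | nil u => exact .nil u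
  | cons hl _ ih =>
    rw [List.reverse_cons]
    exact ih.append (.cons hl.symm (.nil _))

theorem Trail.lt_of_mem {m : ℕ} {E₀ E₁ : ℕ → ℕ} {u v i : ℕ} {L : List ℕ}
    (h : Trail m E₀ E₁ u v L) (hi : i ∈ L) : i < m := by
  induction h with
  | nil u => simp at hi
  | cons hl _ ih =>
    rcases List.mem_cons.1 hi with rfl | hi
    exacts [hl.1, ih hi]

/-- Some walk from `u` to `v` along edges inside `D` has distinct colours, all in `S`. -/
def RainbowIn (m : ℕ) (E₀ E₁ col : ℕ → ℕ) (D S : Set ℕ) (u v : ℕ) : Prop :=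
  ∃ L, Trail m E₀ E₁ u v L ∧ (L.map col).Nodup ∧ ∀ i ∈ L, E₀ i ∈ D ∧ E₁ i ∈ D ∧ col i ∈ S

section RainbowIn

variable {m : ℕ} {E₀ E₁ col col' : ℕ → ℕ} {D D' S S' : Set ℕ} {u v w i : ℕ}

theorem RainbowIn.refl (u : ℕ) : RainbowIn m E₀ E₁ col D S u u :=
  ⟨[], .nil u, by simp, by simp⟩

theorem RainbowIn.of_link (h : Link m E₀ E₁ i u v) (hu : u ∈ D) (hv : v ∈ D) (hc : col i ∈ S) :
    RainbowIn m E₀ E₁ col D S u v := by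
  refine ⟨[i], .cons h (.nil v), by simp, ?_⟩
  simp only [List.mem_singleton, forall_eq]
  rcases h.2 with ⟨rfl, rfl⟩ | ⟨rfl, rfl⟩
  exacts [⟨hu, hv, hc⟩, ⟨hv, hu, hc⟩]

theorem RainbowIn.symm (h : RainbowIn m E₀ E₁ col D S u v) : RainbowIn m E₀ E₁ col D S v u := by
  obtain ⟨L, ht, hn, hL⟩ := h
  refine ⟨L.reverse, ht.reverse, ?_, by simpa using hL⟩
  rwa [List.map_reverse, List.nodup_reverse]

theorem RainbowIn.mono (h : RainbowIn m E₀ E₁ col D S u v) (hD : D ⊆ D') (hS : S ⊆ S') :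
    RainbowIn m E₀ E₁ col D' S' u v := by
  obtain ⟨L, ht, hn, hL⟩ := h
  exact ⟨L, ht, hn, fun i hi => ⟨hD (hL i hi).1, hD (hL i hi).2.1, hS (hL i hi).2.2⟩⟩

theorem RainbowIn.congr_of_lt (h : RainbowIn m E₀ E₁ col D S u v)
    (hc : ∀ i < m, E₀ i ∈ D → E₁ i ∈ D → col' i = col i) : RainbowIn m E₀ E₁ col' D S u v := by
  obtain ⟨L, ht, hn, hL⟩ := h
  have heq : ∀ i ∈ L, col' i = col i := fun i hi => hc i (ht.lt_of_mem hi) (hL i hi).1 (hL i hi).2.1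
  refine ⟨L, ht, ?_, fun i hi => ⟨(hL i hi).1, (hL i hi).2.1, heq i hi ▸ (hL i hi).2.2⟩⟩
  rwa [List.map_congr_left heq]

/-- Keeping a set that contains the colours, instead of the colours themselves, reduces every
concatenation below to the disjointness of two explicit sets. -/
theorem RainbowIn.trans (h : RainbowIn m E₀ E₁ col D S u v)
    (h' : RainbowIn m E₀ E₁ col D S' v w) (hS : Disjoint S S') :
    RainbowIn m E₀ E₁ col D (S ∪ S') u w := by
  obtain ⟨L, ht, hn, hL⟩ := h
  obtain ⟨M, ht', hn', hM⟩ := h'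
  refine ⟨L ++ M, ht.append ht', ?_, ?_⟩
  · rw [List.map_append, List.nodup_append']
    refine ⟨hn, hn', ?_⟩
    rw [List.disjoint_left]
    simp only [List.mem_map, not_exists, not_and]
    rintro _ ⟨i, hi, rfl⟩ j hj hij
    exact Set.disjoint_left.1 hS (hL i hi).2.2 (hij ▸ (hM j hj).2.2)
  · intro i hi
    rcases List.mem_append.1 hi with hi | hi
    exacts [⟨(hL i hi).1, (hL i hi).2.1, .inl (hL i hi).2.2⟩,
      ⟨(hM i hi).1, (hM i hi).2.1, .inr (hM i hi).2.2⟩]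

end RainbowIn

/-! ### Cuts, rooted trees and the branches outside of a set -/

/-- Deleting edge number `i` separates its ends. -/
def IsCut (m : ℕ) (E₀ E₁ : ℕ → ℕ) (i : ℕ) : Prop :=
  ∃ T : Set ℕ, ¬ (E₀ i ∈ T ↔ E₁ i ∈ T) ∧ ∀ j < m, j ≠ i → (E₀ j ∈ T ↔ E₁ j ∈ T)

/-- A spanning tree of height at most `h` with root `s`: `dist v` is the depth of `v`, edge number
`pe v - 1` joins `v` to its parent `par v`, and `Q 0, …, Q (t - 1)` are the vertices, parents
first. -/
structure IsTree (n m : ℕ) (E₀ E₁ : ℕ → ℕ) (s h t : ℕ) (dist par pe Q : ℕ → ℕ) : Prop where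
  root_lt : s < n
  dist_root : dist s = 0
  pe_root : pe s = 0
  par_lt : ∀ v < n, v ≠ s → par v < n
  dist_par : ∀ v < n, v ≠ s → dist v = dist (par v) + 1
  pe_pos : ∀ v < n, v ≠ s → 0 < pe v
  link : ∀ v < n, v ≠ s → Link m E₀ E₁ (pe v - 1) v (par v)
  dist_le : ∀ v < n, dist v ≤ h
  Q_lt : ∀ j < t, Q j < n
  Q_inj : ∀ j < t, ∀ k < t, Q j = Q k → j = k
  Q_surj : ∀ v < n, ∃ j < t, Q j = v
  Q_par : ∀ j < t, Q j ≠ s → ∃ k < j, Q k = par (Q j)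

namespace IsTree

variable {n m s h t : ℕ} {E₀ E₁ dist par pe Q : ℕ → ℕ}
  (T : IsTree n m E₀ E₁ s h t dist par pe Q)
include T

/-- An edge has only two ends, so two different vertices with the same parent edge would be parents
of each other, against the depths. -/
theorem pe_inj {v w : ℕ} (hv : v < n) (hw : w < n) (hvs : v ≠ s) (hws : w ≠ s)
    (e : pe v = pe w) : v = w := by
  have h1 := T.link v hv hvs
  have h2 := T.link w hw hws
  have d1 := T.dist_par v hv hvs
  have d2 := T.dist_par w hw hws
  rw [← e] at h2
  by_contra hne
  rcases h1.2 with ⟨a, b⟩ | ⟨a, b⟩ <;> rcases h2.2 with ⟨c, d⟩ | ⟨c, d⟩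
  · omega
  · rw [← b, d] at d1; rw [← c, a] at d2; omega
  · rw [← a, c] at d1; rw [← d, b] at d2; omega
  · omega

theorem tree_induction {P : ℕ → Prop} (h0 : P s)
    (h1 : ∀ v < n, v ≠ s → P (par v) → P v) : ∀ v < n, P v := by
  intro v hv
  induction hd : dist v generalizing v with
  | zero =>
    by_cases hs : v = s
    · exact hs ▸ h0
    · have := T.dist_par v hv hs; omega
  | succ d ih =>
    by_cases hs : v = s
    · exact hs ▸ h0
    · exact h1 v hv hs (ih _ (T.par_lt v hv hs) (by have := T.dist_par v hv hs; omega))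

end IsTree

/-- A vertex of the tree lies outside of `D` and below the branch root `br v`; the vertices of `D`
have branch `n`. -/
structure IsBranching (n s : ℕ) (par : ℕ → ℕ) (D : Set ℕ) (br : ℕ → ℕ) : Prop where
  root_mem : s ∈ D
  par_mem : ∀ v < n, v ∈ D → v ≠ s → par v ∈ D
  of_mem : ∀ v < n, v ∈ D → br v = n
  of_par : ∀ v < n, v ∉ D → par v ∈ D → br v = v
  of_not_par : ∀ v < n, v ∉ D → par v ∉ D → br v = br (par v)

namespace IsBranching

variable {n m s h t : ℕ} {E₀ E₁ dist par pe Q br : ℕ → ℕ} {D : Set ℕ}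
  (F : IsBranching n s par D br) (T : IsTree n m E₀ E₁ s h t dist par pe Q)
include F T

/-- `br v` is the topmost ancestor of `v` outside of `D`; the difference of the two depths is the
level of `v` in its branch, on which the colours depend. -/
theorem spec {v : ℕ} (hv : v < n) (hD : v ∉ D) :
    br v < n ∧ br v ∉ D ∧ par (br v) ∈ D ∧ br (br v) = br v ∧ dist (br v) ≤ dist v := by
  refine T.tree_induction (P := fun v => v ∉ D → br v < n ∧ br v ∉ D ∧ par (br v) ∈ D ∧
    br (br v) = br v ∧ dist (br v) ≤ dist v) (fun hs => (hs F.root_mem).elim) ?_ v hv hD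
  intro v hv hs ih hD
  by_cases hp : par v ∈ D
  · have e := F.of_par v hv hD hp
    simp only [e, le_refl, and_true]
    exact ⟨hv, hD, hp⟩
  · have e := F.of_not_par v hv hD hp
    rw [e]
    have := T.dist_par v hv hs
    obtain ⟨h1, h2, h3, h4, h5⟩ := ih hp
    exact ⟨h1, h2, h3, h4, by omega⟩

theorem eq_iff {v : ℕ} (hv : v < n) : br v = n ↔ v ∈ D :=
  ⟨fun e => by_contra fun hD => (F.spec T hv hD).1.ne e, F.of_mem v hv⟩

end IsBranching

/-- Edge number `i` joins a marked vertex `u` to a marked vertex `w`, is not a tree edge, and its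
ends lie in branches of different types `1` and `2` (where the type of `D` is `2`). -/
structure IsEar (n m : ℕ) (E₀ E₁ pe br ty : ℕ → ℕ) (M : Set ℕ) (i u w : ℕ) : Prop where
  link : Link m E₀ E₁ i u w
  pe_ne : ∀ v < n, pe v ≠ i + 1
  ty_add : ty (br u) + ty (br w) = 3
  left_mem : u ∈ M
  right_mem : w ∈ M

end Rainbow

/-! ### Ears, types and the correctness of one phase -/

namespace Rainbow

/-- What is known when the branches of `D` have received their types and the ends of the ears have
been marked, by a scan of the edges with numbers below `l`. Branches of type `0` have no ear. -/
structure IsTyping (n m l : ℕ) (E₀ E₁ pe br ty : ℕ → ℕ) (D M : Set ℕ) : Prop where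
  ty_n : ty n = 2
  ty_le : ∀ x, ty x ≤ 2
  typed : ∀ i < l, (∀ v < n, pe v ≠ i + 1) → br (E₀ i) ≠ br (E₁ i) →
    ty (br (E₀ i)) ≠ 0 ∧ ty (br (E₁ i)) ≠ 0
  ear : ∀ x < n, x ∉ D → br x = x → ty x ≠ 0 →
    ∃ i u w, IsEar n m E₀ E₁ pe br ty M i u w ∧ br u = x
  -- Apart from `D`, only branch roots and ends of ears are marked. Thus in an untyped branch
  -- nothing but the root is marked.
  marked : ∀ v ∈ M, v ∉ D → br v = v ∨ ∃ i w, IsEar n m E₀ E₁ pe br ty M i v w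
  lt_of_mem : ∀ v ∈ M, v < n
  subset : D ⊆ M
  root_mem : ∀ x < n, x ∉ D → br x = x → x ∈ M

/-- `M'` is the closure of `M` under taking parents outside of `D`. -/
structure IsClosure (n : ℕ) (par : ℕ → ℕ) (D M M' : Set ℕ) : Prop where
  subset : M ⊆ M'
  lt_of_mem : ∀ v ∈ M', v < n
  par_mem : ∀ v ∈ M', v ∉ D → par v ∈ M'
  below : ∀ v ∈ M', v ∉ D → ∃ u ∈ M, u ∉ D ∧ Relation.ReflTransGen (fun a b => b = par a ∧ b ∉ D) u v

/-- How a phase changes the colours. -/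
structure IsRecolouring (n m : ℕ) (E₀ E₁ dist pe br ty : ℕ → ℕ) (D : Set ℕ) (base : ℕ)
    (col col' : ℕ → ℕ) : Prop where
  -- Twice the level plus a type 1 or 2 makes the colours of the two types disjoint and keeps `base`
  -- free for the ears. In an untyped branch the colour is the number of the lower vertex, which no
  -- other tree edge shares; below the root of such a branch it is provisional, because those edges
  -- stay outside of the new part.
  tree : ∀ v < n, v ∉ D → col' (pe v - 1) =
    if ty (br v) = 0 then v else base + 2 * (dist v - dist (br v)) + ty (br v)
  inside : ∀ i < m, (∀ v < n, v ∉ D → pe v ≠ i + 1) → E₀ i ∈ D → E₁ i ∈ D → col' i = col i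
  outside : ∀ i < m, (∀ v < n, v ∉ D → pe v ≠ i + 1) → ¬ (E₀ i ∈ D ∧ E₁ i ∈ D) → col' i = base

/-- `D` spans a part of the graph that is rainbow connected by the colours below `base`; the colours
below `n` are used for bridges only. -/
structure IsPartial (n m : ℕ) (E₀ E₁ : ℕ → ℕ) (s : ℕ) (par col : ℕ → ℕ) (D : Set ℕ)
    (base : ℕ) : Prop where
  lt_of_mem : ∀ v ∈ D, v < n
  root_mem : s ∈ D
  par_mem : ∀ v ∈ D, v ≠ s → par v ∈ D
  n_le : n ≤ base
  -- A colour `c < n` belongs to the bridge above vertex `c`. Requiring `c ∈ D` makes the colours of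
  -- bridges to vertices outside of `D` fresh.
  rainbow : ∀ u ∈ D, ∀ v ∈ D,
    RainbowIn m E₀ E₁ col D {c | c < base ∧ (c < n → c ∈ D)} u v
  colour : ∀ i < m, E₀ i ∈ D → E₁ i ∈ D →
    col i < base ∧ (col i < n → col i ∈ D ∧ IsCut m E₀ E₁ i)

/-- Colours of the tree edges of a branch. -/
def levelColours (base t : ℕ) (I : Set ℕ) : Set ℕ := {c | ∃ j ∈ I, c = base + 2 * j + t}

section Phase

variable {n m s h t k base : ℕ} {E₀ E₁ dist par pe Q br ty col col' : ℕ → ℕ} {D M M' : Set ℕ}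

/-- The vertices of a chain of parents in a branch. -/
theorem IsBranching.chain_spec (F : IsBranching n s par D br)
    (T : IsTree n m E₀ E₁ s h t dist par pe Q) {u v : ℕ} (hu : u < n) (huD : u ∉ D)
    (huv : Relation.ReflTransGen (fun a b => b = par a ∧ b ∉ D) u v) :
    v < n ∧ v ∉ D ∧ br v = br u ∧ dist v ≤ dist u ∧ (br u = u → v = u) := by
  induction huv with
  | refl => exact ⟨hu, huD, rfl, le_rfl, fun _ => rfl⟩
  | @tail b c _ hc ih =>
    obtain ⟨rfl, hc⟩ := hc
    obtain ⟨h1, h2, h3, h4, h5⟩ := ih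
    have hs : b ≠ s := fun e => h2 (e ▸ F.root_mem)
    have e := F.of_not_par b h1 h2 hc
    have hlt := T.par_lt b h1 hs
    have hd := T.dist_par b h1 hs
    refine ⟨hlt, hc, by rw [← h3, e], by omega, fun h6 => ?_⟩
    obtain rfl := h5 h6
    have := (F.spec T hlt hc).2.2.2.2
    rw [← e, h6] at this
    omega

theorem IsBranching.chain_root (F : IsBranching n s par D br)
    (T : IsTree n m E₀ E₁ s h t dist par pe Q) {v : ℕ} (hv : v < n) (hD : v ∉ D) :
    Relation.ReflTransGen (fun a b => b = par a ∧ b ∉ D) v (br v) := by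
  refine T.tree_induction (P := fun v => v ∉ D →
    Relation.ReflTransGen (fun a b => b = par a ∧ b ∉ D) v (br v))
    (fun hs => (hs F.root_mem).elim) ?_ v hv hD
  intro v hv hs ih hD
  by_cases hp : par v ∈ D
  · rw [F.of_par v hv hD hp]
  · rw [F.of_not_par v hv hD hp]
    exact .head ⟨rfl, hp⟩ (ih hp)

variable (F : IsBranching n s par D br) (T : IsTree n m E₀ E₁ s h t dist par pe Q)
  (Y : IsTyping n m m E₀ E₁ pe br ty D M) (K : IsClosure n par D M M')
  (R : IsRecolouring n m E₀ E₁ dist pe br ty D base col col')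

include Y in
theorem IsTyping.ty_of_ear {i u w : ℕ} (e : IsEar n m E₀ E₁ pe br ty M i u w) :
    ty (br u) ≠ 0 ∧ ty (br w) ≠ 0 := by
  have := e.ty_add
  have := Y.ty_le (br u)
  have := Y.ty_le (br w)
  omega

-- An ear is not a tree edge, and it cannot lie inside `D`, where both ends would have type 2 and
-- the types would add up to 4. So the phase paints it with `base`.
include F Y R in
theorem IsTyping.colour_ear (hE : ∀ i < m, E₀ i < n ∧ E₁ i < n) {i u w : ℕ}
    (e : IsEar n m E₀ E₁ pe br ty M i u w) : col' i = base := by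
  refine R.outside i e.link.1 (fun v hv _ => e.pe_ne v hv) fun ⟨h0, h1⟩ => ?_
  have b0 := F.of_mem _ (hE i e.link.1).1 h0
  have b1 := F.of_mem _ (hE i e.link.1).2 h1
  have h3 := e.ty_add
  have h2 := Y.ty_n
  rcases e.link.2 with ⟨rfl, rfl⟩ | ⟨rfl, rfl⟩
  · rw [b0, b1] at h3; omega
  · rw [b0, b1] at h3; omega

include F T K R

/-- The tree path from a typed vertex to `D`. -/
theorem IsRecolouring.rainbow_up {v : ℕ} (hv : v ∈ M') (hD : v ∉ D) (ht : ty (br v) ≠ 0) :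
    ∃ d ∈ D, RainbowIn m E₀ E₁ col' M'
      (levelColours base (ty (br v)) {j | j ≤ dist v - dist (br v)}) v d := by
  refine T.tree_induction (P := fun v => v ∈ M' → v ∉ D → ty (br v) ≠ 0 →
    ∃ d ∈ D, RainbowIn m E₀ E₁ col' M'
      (levelColours base (ty (br v)) {j | j ≤ dist v - dist (br v)}) v d)
    (fun _ hs => (hs F.root_mem).elim) ?_ v (K.lt_of_mem v hv) hv hD ht
  intro v hv hs ih hM hD ht
  have hl := T.link v hv hs
  have hc := R.tree v hv hD
  rw [if_neg ht] at hc
  have hpM := K.par_mem v hM hD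
  by_cases hp : par v ∈ D
  · exact ⟨par v, hp, .of_link hl hM hpM ⟨_, le_refl (dist v - dist (br v)), hc⟩⟩
  · have e := F.of_not_par v hv hD hp
    obtain ⟨d, hd, hr⟩ := ih hpM hp (e ▸ ht)
    rw [← e] at hr
    have hdv := T.dist_par v hv hs
    have hdb := (F.spec T (T.par_lt v hv hs) hp).2.2.2.2
    rw [← e] at hdb
    have h1 : RainbowIn m E₀ E₁ col' M' {base + 2 * (dist v - dist (br v)) + ty (br v)} v (par v) :=
      .of_link hl hM hpM hc
    -- The level of `v` is larger by one than that of its parent, so the colour of the first edge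
    -- does not recur higher up.
    refine ⟨d, hd, (h1.trans hr ?_).mono le_rfl ?_⟩
    · rw [Set.disjoint_singleton_left]
      rintro ⟨j, hj, hj'⟩
      simp only [Set.mem_ofPred_eq] at hj
      omega
    · rintro c (rfl | ⟨j, hj, rfl⟩)
      · exact ⟨_, le_refl (dist v - dist (br v)), rfl⟩
      · simp only [Set.mem_ofPred_eq] at hj
        exact ⟨j, by simp only [Set.mem_ofPred_eq]; omega, rfl⟩

/-- The tree path from a typed vertex to one of its ancestors in the branch. -/
theorem IsRecolouring.rainbow_chain {u v : ℕ} (hu : u ∈ M') (hD : u ∉ D) (ht : ty (br u) ≠ 0)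
    (huv : Relation.ReflTransGen (fun a b => b = par a ∧ b ∉ D) u v) :
    RainbowIn m E₀ E₁ col' M'
      (levelColours base (ty (br v)) {j | dist v - dist (br v) < j ∧ j ≤ dist u - dist (br v)})
      u v := by
  induction huv using Relation.ReflTransGen.head_induction_on with
  | refl => exact .refl _
  | @head a b hb hbv ih =>
    obtain ⟨rfl, hp⟩ := hb
    have ha := K.lt_of_mem a hu
    have hs : a ≠ s := fun e => hD (e ▸ F.root_mem)
    have e := F.of_not_par a ha hD hp
    have hpM := K.par_mem a hu hD
    have hr := ih hpM hp (e ▸ ht)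
    have hlt := T.par_lt a ha hs
    obtain ⟨g1, g2, g3, g4, -⟩ := F.chain_spec T hlt hp hbv
    have g5 := (F.spec T g1 g2).2.2.2.2
    have hdv := T.dist_par a ha hs
    have hc := R.tree a ha hD
    rw [if_neg ht, e, ← g3] at hc
    have h1 : RainbowIn m E₀ E₁ col' M' {base + 2 * (dist a - dist (br v)) + ty (br v)} a (par a) :=
      .of_link (T.link a ha hs) hu hpM hc
    refine (h1.trans hr ?_).mono le_rfl ?_
    · rw [Set.disjoint_singleton_left]
      rintro ⟨j, hj, hj'⟩
      simp only [Set.mem_ofPred_eq] at hj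
      omega
    · rintro c (rfl | ⟨j, hj, rfl⟩)
      · exact ⟨dist a - dist (br v), by simp only [Set.mem_ofPred_eq]; omega, rfl⟩
      · simp only [Set.mem_ofPred_eq] at hj
        exact ⟨j, by simp only [Set.mem_ofPred_eq]; omega, rfl⟩

include Y

/-- The other way from a typed vertex to `D`, along its ear. -/
theorem IsTyping.rainbow_around (hE : ∀ i < m, E₀ i < n ∧ E₁ i < n) {v : ℕ} (hv : v ∈ M')
    (hD : v ∉ D) (ht : ty (br v) ≠ 0) :
    ∃ d ∈ D, RainbowIn m E₀ E₁ col' M'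
      (levelColours base (ty (br v)) {j | dist v - dist (br v) < j} ∪
        ({base} ∪ levelColours base (3 - ty (br v)) Set.univ)) v d := by
  -- Some end `u` of an ear lies at or below `v` in the branch: either `v` was reached by closing an
  -- ear end under parents, or `v` is the root of a typed branch and any ear of that branch will do.
  have key : ∃ i u w, IsEar n m E₀ E₁ pe br ty M i u w ∧ u ∉ D ∧
      Relation.ReflTransGen (fun a b => b = par a ∧ b ∉ D) u v := by
    obtain ⟨u, hu, huD, huv⟩ := K.below v hv hD
    have hun := Y.lt_of_mem u hu
    rcases Y.marked u hu huD with hr | ⟨i, w, e⟩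
    · obtain ⟨-, -, g3, -, g5⟩ := F.chain_spec T hun huD huv
      obtain rfl := g5 hr
      obtain ⟨i, u, w, e, hu'⟩ := Y.ear v hun hD hr (hr ▸ ht)
      have hu2 := Y.lt_of_mem u e.left_mem
      have hu3 : u ∉ D := fun h => by
        have := F.of_mem u hu2 h
        omega
      exact ⟨i, u, w, e, hu3, hu' ▸ F.chain_root T hu2 hu3⟩
    · exact ⟨i, u, w, e, huD, huv⟩
  obtain ⟨i, u, w, e, huD, huv⟩ := key
  have huM := K.subset e.left_mem
  have hwM := K.subset e.right_mem
  obtain ⟨-, -, g3, -, -⟩ := F.chain_spec T (K.lt_of_mem u huM) huD huv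
  have hty := Y.ty_of_ear e
  have h1 := (R.rainbow_chain F T K huM huD hty.1 huv).symm
  have h2 : RainbowIn m E₀ E₁ col' M' {base} u w :=
    .of_link e.link huM hwM (Y.colour_ear F R hE e)
  have hsum := e.ty_add
  rw [← g3] at hsum
  -- The far end of the ear lies in `D` already or climbs to it through a branch of the opposite
  -- type `3 - ty (br v)`.
  have h3 : ∃ d ∈ D, RainbowIn m E₀ E₁ col' M'
      (levelColours base (3 - ty (br v)) Set.univ) w d := by
    by_cases hw : w ∈ D
    · exact ⟨w, hw, .refl w⟩
    · obtain ⟨d, hd, hr⟩ := R.rainbow_up F T K hwM hw hty.2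
      refine ⟨d, hd, hr.mono le_rfl ?_⟩
      rw [show ty (br w) = 3 - ty (br v) by omega]
      rintro c ⟨j, -, rfl⟩
      exact ⟨j, trivial, rfl⟩
  obtain ⟨d, hd, h3⟩ := h3
  refine ⟨d, hd, (h1.trans (h2.trans h3 ?_) ?_).mono le_rfl ?_⟩
  · rw [Set.disjoint_singleton_left]
    rintro ⟨j, -, hj⟩
    have := Y.ty_le (br v)
    omega
  · rw [Set.disjoint_left]
    rintro c ⟨j, -, rfl⟩ (hc | ⟨l, -, hl⟩)
    · simp only [Set.mem_singleton_iff] at hc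
      omega
    · have := Y.ty_le (br v)
      omega
  · refine Set.union_subset_union_left _ ?_
    rintro c ⟨j, hj, rfl⟩
    exact ⟨j, hj.1, rfl⟩

omit K R in
/-- The tree edge above an untyped branch is a bridge. -/
theorem IsTyping.isCut {x : ℕ} (hx : x < n) (hD : x ∉ D)
    (hr : br x = x) (ht : ty x = 0) : IsCut m E₀ E₁ (pe x - 1) := by
  have hxs : x ≠ s := fun e => hD (e ▸ F.root_mem)
  have hpD : par x ∈ D := by
    have := (F.spec T hx hD).2.2.1
    rwa [hr] at this
  -- The branch itself is the side of the cut.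
  refine ⟨{v | br v = x}, ?_, ?_⟩
  · have hb := F.of_mem _ (T.par_lt x hx hxs) hpD
    simp only [Set.mem_ofPred_eq]
    rcases (T.link x hx hxs).2 with ⟨e0, e1⟩ | ⟨e0, e1⟩
    · rw [e0, e1, hr, hb]
      omega
    · rw [e0, e1, hr, hb]
      omega
  · intro j hj hne
    simp only [Set.mem_ofPred_eq]
    -- A non-tree edge leaving the branch would have given it a type; a tree edge leaves it only
    -- above its root, and that is the edge removed.
    by_cases htree : ∀ v < n, pe v ≠ j + 1
    · by_cases hb : br (E₀ j) = br (E₁ j)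
      · rw [hb]
      · obtain ⟨h0, h1⟩ := Y.typed j hj htree hb
        constructor <;> intro h2
        · rw [h2] at h0; contradiction
        · rw [h2] at h1; contradiction
    · push Not at htree
      obtain ⟨v, hv, hpe⟩ := htree
      have hvs : v ≠ s := by
        rintro rfl
        have := T.pe_root
        omega
      have hl := T.link v hv hvs
      rw [hpe, Nat.add_sub_cancel] at hl
      have key : br v = x ↔ br (par v) = x := by
        have hpl := T.par_lt v hv hvs
        by_cases hvD : v ∈ D
        · rw [F.of_mem v hv hvD, F.of_mem _ hpl (F.par_mem v hv hvD hvs)]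
        · by_cases hpv : par v ∈ D
          · rw [F.of_par v hv hvD hpv, F.of_mem _ hpl hpv]
            constructor
            · rintro rfl
              omega
            · intro e
              omega
          · rw [F.of_not_par v hv hvD hpv]
      rcases hl.2 with ⟨e0, e1⟩ | ⟨e0, e1⟩
      · rw [e0, e1, key]
      · rw [e0, e1, key]

omit R in
/-- Untyped marked vertices are branch roots. -/
theorem IsTyping.br_eq_of_untyped {v : ℕ} (hv : v ∈ M') (hD : v ∉ D) (ht : ty (br v) = 0) :
    br v = v := by
  obtain ⟨u, hu, huD, huv⟩ := K.below v hv hD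
  obtain ⟨-, -, g3, -, g5⟩ := F.chain_spec T (Y.lt_of_mem u hu) huD huv
  rcases Y.marked u hu huD with hr | ⟨i, w, e⟩
  · have := g5 hr
    rw [g3, hr, this]
  · exact ((Y.ty_of_ear e).1 (g3 ▸ ht)).elim


/-- A phase of the algorithm. -/
theorem IsPartial.step (hE : ∀ i < m, E₀ i < n ∧ E₁ i < n)
    (P : IsPartial n m E₀ E₁ s par col D base) (hk : ∀ v < n, dist v + k ≤ h → v ∈ D) :
    IsPartial n m E₀ E₁ s par col' M' (base + 2 * k + 1) := by
  have hDM : D ⊆ M' := Y.subset.trans K.subset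
  have hn := P.n_le
  -- Branch roots have depth greater than `h - k` and no depth exceeds `h`, so only the levels `0,
  -- …, k - 1` occur and the new colours are `base, …, base + 2 * k`.
  have hJ : ∀ v < n, v ∉ D → dist v - dist (br v) < k := by
    intro v hv hD
    obtain ⟨h1, h2, -, -, h5⟩ := F.spec T hv hD
    have h3 : ¬ dist (br v) + k ≤ h := fun h' => h2 (hk _ h1 h')
    have := T.dist_le v hv
    omega
  have hpar : ∀ v ∈ M', v ≠ s → par v ∈ M' := by
    intro v hv hs
    by_cases hD : v ∈ D
    exacts [hDM (P.par_mem v hD hs), K.par_mem v hv hD]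
  have hcol : ∀ i < m, E₀ i ∈ M' → E₁ i ∈ M' →
      col' i < base + 2 * k + 1 ∧ (col' i < n → col' i ∈ M' ∧ IsCut m E₀ E₁ i) := by
    intro i hi h0 h1
    by_cases htree : ∀ v < n, v ∉ D → pe v ≠ i + 1
    · by_cases hin : E₀ i ∈ D ∧ E₁ i ∈ D
      · rw [R.inside i hi htree hin.1 hin.2]
        obtain ⟨a, b⟩ := P.colour i hi hin.1 hin.2
        exact ⟨by omega, fun hc => ⟨hDM (b hc).1, (b hc).2⟩⟩
      · rw [R.outside i hi htree hin]
        exact ⟨by omega, fun hc => by omega⟩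
    · push Not at htree
      obtain ⟨v, hv, hD, hpe⟩ := htree
      have hc := R.tree v hv hD
      have hvs : v ≠ s := fun e => hD (e ▸ P.root_mem)
      have hl := T.link v hv hvs
      rw [hpe, Nat.add_sub_cancel] at hc hl
      have hvM : v ∈ M' := by
        rcases hl.2 with ⟨e0, -⟩ | ⟨-, e1⟩
        exacts [e0 ▸ h0, e1 ▸ h1]
      rw [hc]
      split
      · next ht =>
        have hr := Y.br_eq_of_untyped F T K hvM hD ht
        refine ⟨by omega, fun _ => ⟨hvM, ?_⟩⟩
        have := Y.isCut F T hv hD hr (hr ▸ ht)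
        rwa [hpe, Nat.add_sub_cancel] at this
      · have := hJ v hv hD
        have := Y.ty_le (br v)
        exact ⟨by omega, fun _ => by omega⟩
  refine ⟨K.lt_of_mem, hDM P.root_mem, hpar, by omega, ?_, hcol⟩
  -- The restriction on colours follows from `hcol` for every edge inside `M'`, so it can be dropped
  -- from the construction of the trails.
  suffices hu : ∀ u ∈ M', ∀ v ∈ M', RainbowIn m E₀ E₁ col' M' Set.univ u v by
    intro u huM v hvM
    obtain ⟨L, hL, hnd, hS⟩ := hu u huM v hvM
    refine ⟨L, hL, hnd, fun i hi => ⟨(hS i hi).1, (hS i hi).2.1, ?_⟩⟩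
    obtain ⟨a, b⟩ := hcol i (hL.lt_of_mem hi) (hS i hi).1 (hS i hi).2.1
    exact ⟨a, fun hc => (b hc).1⟩
  -- The old trails survive: a tree edge above a vertex outside of `D` is not inside `D`, and the
  -- remaining edges inside `D` keep their colours.
  have hin : ∀ d ∈ D, ∀ d' ∈ D,
      RainbowIn m E₀ E₁ col' M' {c | c < base ∧ (c < n → c ∈ D)} d d' := by
    intro d hd d' hd'
    refine ((P.rainbow d hd d' hd').congr_of_lt fun i hi h0 h1 => ?_).mono hDM le_rfl
    refine R.inside i hi (fun v hv hD hpe => hD ?_) h0 h1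
    have hvs : v ≠ s := fun e => hD (e ▸ P.root_mem)
    have hl := T.link v hv hvs
    rw [hpe, Nat.add_sub_cancel] at hl
    rcases hl.2 with ⟨e0, -⟩ | ⟨-, e1⟩
    exacts [e0 ▸ h0, e1 ▸ h1]
  -- Two arms to `D` with disjoint fresh colours are joined through `D` by old colours. Fresh means
  -- at least `base`, or the number of a vertex outside of `D`.
  have join : ∀ (S S' : Set ℕ) (u v : ℕ),
      (∃ d ∈ D, RainbowIn m E₀ E₁ col' M' S u d) → (∃ d ∈ D, RainbowIn m E₀ E₁ col' M' S' v d) →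
      (∀ c ∈ S, base ≤ c ∨ c < n ∧ c ∉ D) → (∀ c ∈ S', base ≤ c ∨ c < n ∧ c ∉ D) →
      Disjoint S S' → RainbowIn m E₀ E₁ col' M' Set.univ u v := by
    rintro S S' u v ⟨d, hd, hu⟩ ⟨d', hd', hv⟩ hS hS' hSS
    refine ((hu.trans (hin d hd d' hd') ?_).trans hv.symm ?_).mono le_rfl (Set.subset_univ _)
    · rw [Set.disjoint_left]
      rintro c hc ⟨h1, h2⟩
      rcases hS c hc with h | h
      · omega
      · exact h.2 (h2 h.1)
    · rw [Set.disjoint_union_left]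
      refine ⟨hSS, ?_⟩
      rw [Set.disjoint_left]
      rintro c ⟨h1, h2⟩ hc
      rcases hS' c hc with h | h
      · omega
      · exact h.2 (h2 h.1)
  have hlev : ∀ (t : ℕ) (I : Set ℕ), ∀ c ∈ levelColours base t I, base ≤ c ∨ c < n ∧ c ∉ D := by
    rintro t I c ⟨j, -, rfl⟩
    exact .inl (by omega)
  have bridge : ∀ v ∈ M', v ∉ D → ty (br v) = 0 →
      ∃ d ∈ D, RainbowIn m E₀ E₁ col' M' {v} v d := by
    intro v hv hD ht
    have hvn := K.lt_of_mem v hv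
    have hvs : v ≠ s := fun e => hD (e ▸ P.root_mem)
    have hr := Y.br_eq_of_untyped F T K hv hD ht
    have hc := R.tree v hvn hD
    rw [if_pos ht] at hc
    have hp := (F.spec T hvn hD).2.2.1
    rw [hr] at hp
    exact ⟨par v, hp, .of_link (T.link v hvn hvs) hv (hDM hp) hc⟩
  have direct : ∀ v ∈ M', v ∉ D → ∃ S : Set ℕ, (∃ d ∈ D, RainbowIn m E₀ E₁ col' M' S v d) ∧
      (∀ c ∈ S, base ≤ c ∨ c < n ∧ c ∉ D) ∧
      ((ty (br v) = 0 ∧ S = {v}) ∨ (ty (br v) ≠ 0 ∧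
        S = levelColours base (ty (br v)) {j | j ≤ dist v - dist (br v)})) := by
    intro v hv hD
    by_cases ht : ty (br v) = 0
    · exact ⟨_, bridge v hv hD ht, by simpa using .inr ⟨K.lt_of_mem v hv, hD⟩, .inl ⟨ht, rfl⟩⟩
    · exact ⟨_, R.rainbow_up F T K hv hD ht, hlev _ _, .inr ⟨ht, rfl⟩⟩
  -- The vertex of smaller level climbs, using levels up to its own. The other goes around its ear
  -- and uses, in the common type, only levels beyond its own.
  have same : ∀ u ∈ M', ∀ v ∈ M', u ∉ D → v ∉ D → ty (br u) ≠ 0 → ty (br u) = ty (br v) →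
      dist u - dist (br u) ≤ dist v - dist (br v) →
      RainbowIn m E₀ E₁ col' M' Set.univ u v := by
    intro u hu v hv huD hvD ht e hle
    refine join _ _ u v (R.rainbow_up F T K hu huD ht)
      (Y.rainbow_around F T K R hE hv hvD (e ▸ ht)) (hlev _ _) ?_ ?_
    · rintro c (hc | hc | hc)
      · exact hlev _ _ c hc
      · exact .inl hc.ge
      · exact hlev _ _ c hc
    · rw [Set.disjoint_left]
      have := Y.ty_le (br u)
      rintro c ⟨j, hj, rfl⟩ (⟨l, hl, hc⟩ | hc | ⟨l, -, hc⟩)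
      · simp only [Set.mem_ofPred_eq] at hj hl
        omega
      · simp only [Set.mem_singleton_iff] at hc
        omega
      · omega
  intro u hu v hv
  by_cases huD : u ∈ D
  · by_cases hvD : v ∈ D
    · exact (hin u huD v hvD).mono le_rfl (Set.subset_univ _)
    · obtain ⟨S, h1, h2, -⟩ := direct v hv hvD
      exact join ∅ S u v ⟨u, huD, .refl u⟩ h1 (by simp) h2 (Set.empty_disjoint _)
  · obtain ⟨S, h1, h2, h3⟩ := direct u hu huD
    by_cases hvD : v ∈ D
    · exact join S ∅ u v h1 ⟨v, hvD, .refl v⟩ h2 (by simp) (Set.disjoint_empty _)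
    · obtain ⟨S', h1', h2', h3'⟩ := direct v hv hvD
      have hun := K.lt_of_mem u hu
      have hvn := K.lt_of_mem v hv
      rcases h3 with ⟨t0, rfl⟩ | ⟨t0, rfl⟩ <;> rcases h3' with ⟨t0', rfl⟩ | ⟨t0', rfl⟩
      · by_cases e : u = v
        · exact e ▸ .refl u
        · exact join _ _ u v h1 h1' h2 h2' (by simpa using e)
      · refine join _ _ u v h1 h1' h2 h2' ?_
        rw [Set.disjoint_singleton_left]
        rintro ⟨j, -, hj⟩
        omega
      · refine join _ _ u v h1 h1' h2 h2' ?_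
        rw [Set.disjoint_singleton_right]
        rintro ⟨j, -, hj⟩
        omega
      · by_cases e : ty (br u) = ty (br v)
        · rcases Nat.le_total (dist u - dist (br u)) (dist v - dist (br v)) with hle | hle
          · exact same u hu v hv huD hvD t0 e hle
          · exact (same v hv u hu hvD huD t0' e.symm hle).symm
        · refine join _ _ u v h1 h1' h2 h2' ?_
          rw [Set.disjoint_left]
          rintro c ⟨j, -, rfl⟩ ⟨l, -, hc⟩
          have := Y.ty_le (br u)
          have := Y.ty_le (br v)
          omega

omit Y R in
/-- After a phase the tree below `M'` is lower by one. -/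
theorem IsClosure.mem_of_dist (Y : IsTyping n m m E₀ E₁ pe br ty D M)
    (hk : ∀ v < n, dist v + (k + 1) ≤ h → v ∈ D) : ∀ v < n, dist v + k ≤ h → v ∈ M' := by
  intro v hv hd
  by_cases hD : v ∈ D
  · exact K.subset (Y.subset hD)
  · have hvs : v ≠ s := fun e => hD (e ▸ F.root_mem)
    have := T.dist_par v hv hvs
    have hp := hk _ (T.par_lt v hv hvs) (by omega)
    exact K.subset (Y.root_mem v hv hD (F.of_par v hv hD hp))

end Phase

end Rainbow

namespace Rainbow

/-! ### Programs

Registers: `0` number of vertices, `1` number of edges, `2` counter, `3` number of arcs, `4` source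
of the search, `5` number of the search, `6` current vertex, `7` and `8` ends of the queue, `9`
current arc, `10` neighbour, `11` height of the tree, `12` and `13` best height and source,
`14` counter of sources, `15` rounds left, `16` next free colour, `17` and `18` branches.

Arrays: `0` and `1` ends of edges, `2` colours, `3` first arc of a vertex, `4` next arc, `5` last
search that saw the vertex, `6` depth, `7` parent, `8` number of the parent edge plus one, `9`
queue, `10` branch, `11` type of a branch, `12` marks, `13` head of an arc, `14` edge of an arc. -/

infixr:60 " ;; " => Prog.seq

/-- Add edge `reg 2` to the adjacency lists. -/
def buildBody : Prog :=
  -- Edge `i` becomes the arcs `2 * i + 1` and `2 * i + 2`. As arc numbers start from 1, the value 0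
  -- can end a list, and zeroed memory represents empty lists.
  .assign 3 (.add (.var 3) (.lit 1)) ;;
  .write 4 (.var 3) (.read 3 (.read 0 (.var 2))) ;;
  .write 3 (.read 0 (.var 2)) (.var 3) ;;
  .write 13 (.var 3) (.read 1 (.var 2)) ;;
  .write 14 (.var 3) (.var 2) ;;
  .assign 3 (.add (.var 3) (.lit 1)) ;;
  .write 4 (.var 3) (.read 3 (.read 1 (.var 2))) ;;
  .write 3 (.read 1 (.var 2)) (.var 3) ;;
  .write 13 (.var 3) (.read 0 (.var 2)) ;;
  .write 14 (.var 3) (.var 2) ;;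
  .assign 2 (.add (.var 2) (.lit 1))

/-- Make the adjacency lists. -/
def build : Prog := .loop (.lt (.var 2) (.var 1)) buildBody

/-- The pointers `next` run from `a` through the list and end with `0`. -/
inductive Chain (next : ℕ → ℕ) : ℕ → List ℕ → Prop where
  | nil : Chain next 0 []
  | cons {a : ℕ} {L : List ℕ} (ha : a ≠ 0) (h : Chain next (next a) L) : Chain next a (a :: L)

theorem Chain.congr {next next' : ℕ → ℕ} {a : ℕ} {L : List ℕ} (h : Chain next a L)
    (he : ∀ b ∈ L, next' b = next b) : Chain next' a L := by
  induction h with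
  | nil => exact .nil
  | @cons b L ha _ ih =>
    refine .cons ha ?_
    rw [he b (by simp)]
    exact ih fun c hc => he c (by simp [hc])

theorem Chain.eq_nil {next : ℕ → ℕ} {L : List ℕ} (h : Chain next 0 L) : L = [] := by
  cases h with
  | nil => rfl
  | cons ha _ => exact (ha rfl).elim

theorem Chain.eq_cons {next : ℕ → ℕ} {a : ℕ} {L : List ℕ} (h : Chain next a L) (ha : a ≠ 0) :
    ∃ L', L = a :: L' ∧ Chain next (next a) L' := by
  cases h with
  | nil => exact (ha rfl).elim
  | cons _ h => exact ⟨_, rfl, h⟩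

/-- The lists `A u` of arcs, stored in the arrays, describe the edges with numbers below `m`. -/
structure IsAdjacency (n m : ℕ) (E₀ E₁ first next head edge : ℕ → ℕ) (A : ℕ → List ℕ) : Prop where
  chain : ∀ u, Chain next (first u) (A u)
  link : ∀ u, ∀ a ∈ A u, Link m E₀ E₁ (edge a) u (head a)
  exists_arc : ∀ i u w, Link m E₀ E₁ i u w → ∃ a ∈ A u, edge a = i ∧ head a = w
  sum_le : ∑ u ∈ Finset.range n, (A u).length ≤ 2 * m

/-- Intermediate form of `IsAdjacency` for the arcs with numbers at most `c`. -/
structure IsArcs (n c : ℕ) (P : ℕ → ℕ → ℕ → Prop) (first next head edge : ℕ → ℕ)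
    (A : ℕ → List ℕ) : Prop where
  chain : ∀ u, Chain next (first u) (A u)
  le : ∀ u, ∀ a ∈ A u, a ≤ c
  link : ∀ u, ∀ a ∈ A u, P (edge a) u (head a)
  exists_arc : ∀ i u w, P i u w → ∃ a ∈ A u, edge a = i ∧ head a = w
  sum_le : ∑ u ∈ Finset.range n, (A u).length ≤ c

/-- The number `c + 1` is not in use, so putting this arc in front of the list of `u` leaves all
existing pointers intact. -/
theorem IsArcs.add {n c : ℕ} {P : ℕ → ℕ → ℕ → Prop} {first next head edge : ℕ → ℕ}
    {A : ℕ → List ℕ} (h : IsArcs n c P first next head edge A) (i u w : ℕ) :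
    IsArcs n (c + 1) (fun i' u' w' => P i' u' w' ∨ (i' = i ∧ u' = u ∧ w' = w))
      (Function.update first u (c + 1)) (Function.update next (c + 1) (first u))
      (Function.update head (c + 1) w) (Function.update edge (c + 1) i)
      (Function.update A u ((c + 1) :: A u)) := by
  have hne : ∀ v, ∀ a ∈ A v, a ≠ c + 1 := fun v a ha => by have := h.le v a ha; omega
  have hch : ∀ v, Chain (Function.update next (c + 1) (first u)) (first v) (A v) := fun v =>
    (h.chain v).congr fun b hb => Function.update_of_ne (hne v b hb) _ _
  refine ⟨fun v => ?_, fun v a => ?_, fun v a => ?_, fun i' v w' hP => ?_, ?_⟩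
  · by_cases hv : v = u
    · subst hv
      rw [Function.update_self, Function.update_self]
      refine .cons (by omega) ?_
      rw [Function.update_self]
      exact hch v
    · rw [Function.update_of_ne hv, Function.update_of_ne hv]
      exact hch v
  · by_cases hv : v = u
    · subst hv
      rw [Function.update_self, List.mem_cons]
      rintro (rfl | ha)
      exacts [le_rfl, (h.le v a ha).trans (Nat.le_succ c)]
    · rw [Function.update_of_ne hv]
      exact fun ha => (h.le v a ha).trans (Nat.le_succ c)
  · have old : a ∈ A v → P (Function.update edge (c + 1) i a) v (Function.update head (c + 1) w a) ∨
        (Function.update edge (c + 1) i a = i ∧ v = u ∧ Function.update head (c + 1) w a = w) := by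
      intro ha
      rw [Function.update_of_ne (hne v a ha), Function.update_of_ne (hne v a ha)]
      exact .inl (h.link v a ha)
    by_cases hv : v = u
    · subst hv
      rw [Function.update_self, List.mem_cons]
      rintro (rfl | ha)
      · simp
      · exact old ha
    · rw [Function.update_of_ne hv]
      exact old
  · rcases hP with hP | ⟨rfl, rfl, rfl⟩
    · obtain ⟨a, ha, h1, h2⟩ := h.exists_arc i' v w' hP
      refine ⟨a, ?_, ?_⟩
      · by_cases hv : v = u
        · subst hv
          simp [ha]
        · rwa [Function.update_of_ne hv]
      · rw [Function.update_of_ne (hne v a ha), Function.update_of_ne (hne v a ha)]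
        exact ⟨h1, h2⟩
    · exact ⟨c + 1, by simp⟩
  · have key : ∀ v, (Function.update A u ((c + 1) :: A u) v).length =
        (A v).length + if v = u then 1 else 0 := by
      intro v
      by_cases hv : v = u
      · subst hv
        simp
      · simp [hv]
    simp only [key, Finset.sum_add_distrib, Finset.sum_ite_eq']
    have := h.sum_le
    split <;> omega

/-- The sizes and the edges of the graph, as they are kept in the memory. -/
structure HasGraph (n m : ℕ) (E₀ E₁ : ℕ → ℕ) (σ : State) : Prop where
  reg_zero : σ.reg 0 = n
  reg_one : σ.reg 1 = m
  mem_zero : σ.mem 0 = E₀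
  mem_one : σ.mem 1 = E₁

theorem Link.succ_iff {m : ℕ} {E₀ E₁ : ℕ → ℕ} {i u w : ℕ} : Link (m + 1) E₀ E₁ i u w ↔
    (Link m E₀ E₁ i u w ∨ (i = m ∧ u = E₀ m ∧ w = E₁ m)) ∨ (i = m ∧ u = E₁ m ∧ w = E₀ m) := by
  unfold Link
  by_cases h : i = m
  · subst h
    simp only [lt_add_iff_pos_right, zero_lt_one, lt_irrefl]
    grind
  · simp only [h]
    grind

theorem build_runs {n m B : ℕ} {E₀ E₁ : ℕ → ℕ} (hB : 2 * m + 1 ≤ B) {σ : State} (hσ : σ.Bdd B)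
    (hg : HasGraph n m E₀ E₁ σ) (h2 : σ.reg 2 = 0) (h3 : σ.reg 3 = 0) (hf : σ.mem 3 = fun _ => 0) :
    Runs B build (100 * m + 3) (fun τ => HasGraph n m E₀ E₁ τ ∧
      (∃ A, IsAdjacency n m E₀ E₁ (τ.mem 3) (τ.mem 4) (τ.mem 13) (τ.mem 14) A) ∧
      τ.reg 5 = σ.reg 5 ∧ τ.mem 5 = σ.mem 5 ∧ τ.mem 11 = σ.mem 11 ∧ τ.mem 12 = σ.mem 12) σ := by
  refine (Runs.forUp (x := 2) (y := 1) (N := m) (c := buildBody.time) (p := buildBody)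
    (fun i τ => (τ.reg 2 = i ∧ τ.reg 3 = 2 * i ∧ HasGraph n m E₀ E₁ τ) ∧
      (∃ A, IsArcs n (2 * i) (Link i E₀ E₁) (τ.mem 3) (τ.mem 4) (τ.mem 13) (τ.mem 14) A) ∧
      τ.reg 5 = σ.reg 5 ∧ τ.mem 5 = σ.mem 5 ∧ τ.mem 11 = σ.mem 11 ∧ τ.mem 12 = σ.mem 12)
    (fun i τ h => ⟨h.1.1, h.1.2.2.2⟩) ?_ (Nat.zero_le m) hσ ?_).mono ?_ ?_
  · rintro i τ hτ ⟨⟨r2, r3, ⟨g0, g1, g2, g3⟩⟩, ⟨A, hA⟩, hk⟩ hi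
    refine Runs.of_wp hτ ?_
    simp only [buildBody, Prog.wp, Expr.Simple, Expr.eval, State.reg_setReg, State.mem_setReg,
      State.reg_setMem, State.mem_setMem, r2, r3, g2, g3]
    simp
    refine ⟨by omega, by omega, by omega, ⟨by omega, g0, g1, g2, g3⟩, ?_, hk⟩
    have := (hA.add i (E₀ i) (E₁ i)).add i (E₁ i) (E₀ i)
    rw [show (fun i' u' w' => (Link i E₀ E₁ i' u' w' ∨ i' = i ∧ u' = E₀ i ∧ w' = E₁ i) ∨
      i' = i ∧ u' = E₁ i ∧ w' = E₀ i) = Link (i + 1) E₀ E₁ from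
      funext fun _ => funext fun _ => funext fun _ => propext Link.succ_iff.symm] at this
    exact ⟨_, this⟩
  · refine ⟨⟨h2, by rw [h3], hg⟩, ⟨fun _ => [], ?_⟩, rfl, rfl, rfl, rfl⟩
    rw [hf]
    exact ⟨fun u => .nil, by simp, by simp, by simp [Link], by simp⟩
  · simp only [buildBody, Prog.time, Expr.cost]
    omega
  · rintro τ _ ⟨⟨_, _, h⟩, ⟨A, hA⟩, hk⟩
    exact ⟨h, ⟨A, hA.chain, hA.link, hA.exists_arc, hA.sum_le⟩, hk⟩

end Rainbow

namespace Rainbow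

/-! ### Breadth first search -/

/-- Prepare the search from `reg 4`. -/
def searchInit : Prog :=
  -- A new stamp makes all vertices unseen without clearing the array.
  .assign 5 (.add (.var 5) (.lit 1)) ;;
  .write 5 (.var 4) (.var 5) ;;
  .write 6 (.var 4) (.lit 0) ;;
  .write 8 (.var 4) (.lit 0) ;;
  .write 9 (.lit 0) (.var 4) ;;
  .assign 6 (.var 4) ;;
  .assign 7 (.lit 0) ;;
  .assign 8 (.lit 1) ;;
  .assign 9 (.lit 0) ;;
  .assign 11 (.lit 0)

/-- Take the next vertex from the queue, or follow an arc of the current vertex. -/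
def searchBody : Prog :=
  .ite (.eq (.var 9) (.lit 0))
    (.assign 6 (.read 9 (.var 7)) ;;
      .assign 7 (.add (.var 7) (.lit 1)) ;;
      .assign 9 (.read 3 (.var 6)))
    (.assign 10 (.read 13 (.var 9)) ;;
      .ite (.eq (.read 5 (.var 10)) (.var 5)) .skip
        (.write 5 (.var 10) (.var 5) ;;
          .assign 11 (.add (.read 6 (.var 6)) (.lit 1)) ;;
          .write 6 (.var 10) (.var 11) ;;
          .write 7 (.var 10) (.var 6) ;;
          .write 8 (.var 10) (.add (.read 14 (.var 9)) (.lit 1)) ;;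
          .write 9 (.var 8) (.var 10) ;;
          .assign 8 (.add (.var 8) (.lit 1))) ;;
      .assign 9 (.read 4 (.var 9)))

/-- Breadth first search from `reg 4`. -/
def search : Prog :=
  searchInit ;;
  -- One flat loop replaces the usual nested ones: each round takes a vertex or follows an arc, so a
  -- single fuel bounds the whole search.
  .loop (.not (.and (.eq (.var 9) (.lit 0)) (.not (.lt (.var 7) (.var 8))))) searchBody

/-- Invariant of the search: `Q 0, …, Q (t - 1)` have been seen, `Q 0, …, Q (q - 1)` have been
taken from the queue, `u` was taken last and has the arcs `R` left. -/
structure IsSearch (n m : ℕ) (E₀ E₁ next head edge : ℕ → ℕ) (s stamp u q t a h : ℕ)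
    (seen dist par pe Q : ℕ → ℕ) (R : List ℕ) : Prop where
  root_lt : s < n
  dist_root : dist s = 0
  pe_root : pe s = 0
  q_le : q ≤ t
  t_pos : 0 < t
  Q_zero : Q 0 = s
  Q_lt : ∀ j < t, Q j < n
  Q_inj : ∀ j < t, ∀ k < t, Q j = Q k → j = k
  seen_le : ∀ v, seen v ≤ stamp
  seen_iff : ∀ v, seen v = stamp ↔ ∃ j < t, Q j = v
  tree : ∀ j < t, Q j ≠ s → (∃ k < j, Q k = par (Q j)) ∧ dist (Q j) = dist (par (Q j)) + 1 ∧
    0 < pe (Q j) ∧ Link m E₀ E₁ (pe (Q j) - 1) (Q j) (par (Q j))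
  -- The queue is sorted by depth, and its waiting part contains only the depths `dist u` and `dist
  -- u + 1`.
  mono : ∀ j k, j ≤ k → k < t → dist (Q j) ≤ dist (Q k)
  dist_le : ∀ j < t, dist (Q j) ≤ dist u + 1
  le_dist : ∀ j < t, q ≤ j → dist u ≤ dist (Q j)
  current : ∃ j < t, Q j = u
  -- An edge at a vertex already taken has been explored, unless it is still in the arc list of the
  -- current vertex.
  done : ∀ j < q, ∀ i w, Link m E₀ E₁ i (Q j) w →
    (seen w = stamp ∧ dist w ≤ dist (Q j) + 1) ∨ (Q j = u ∧ ∃ b ∈ R, edge b = i ∧ head b = w)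
  chain : Chain next a R
  arcs : ∀ b ∈ R, Link m E₀ E₁ (edge b) u (head b)
  le_height : ∀ j < t, dist (Q j) ≤ h
  height : ∃ j < t, dist (Q j) = h

section Search

variable {n m : ℕ} {E₀ E₁ first next head edge : ℕ → ℕ} {A : ℕ → List ℕ} {s stamp u q t a h : ℕ}
  {seen dist par pe Q : ℕ → ℕ} {R : List ℕ}

theorem IsSearch.init (hs : s < n) (hseen : ∀ v, seen v < stamp) :
    IsSearch n m E₀ E₁ next head edge s stamp s 0 1 0 0 (Function.update seen s stamp)
      (Function.update dist s 0) par (Function.update pe s 0) (Function.update Q 0 s) [] := by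
  have h1 : ∀ j < 1, Function.update Q 0 s j = s := by
    rintro j hj
    obtain rfl : j = 0 := by omega
    simp
  refine ⟨hs, by simp, by simp, by omega, by omega, by simp, fun j hj => by rwa [h1 j hj],
    fun j hj k hk _ => by omega, fun v => ?_, fun v => ?_, fun j hj hne => (hne (h1 j hj)).elim,
    fun j k hjk hk => ?_, fun j hj => ?_, fun j hj _ => ?_, ⟨0, by simp⟩,
    fun j hj => by omega, .nil, by simp, fun j hj => ?_, ⟨0, by simp⟩⟩
  · rw [Function.update_apply]
    split
    exacts [le_rfl, (hseen v).le]
  · rw [Function.update_apply]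
    constructor
    · intro h
      split at h
      · next e => exact ⟨0, by omega, by simp [e]⟩
      · exact absurd h (hseen v).ne
    · rintro ⟨j, hj, rfl⟩
      rw [h1 j hj, if_pos rfl]
  · rw [h1 j (by omega), h1 k hk]
  · rw [h1 j hj]; simp
  · rw [h1 j hj]
  · rw [h1 j hj]; simp

variable (S : IsSearch n m E₀ E₁ next head edge s stamp u q t a h seen dist par pe Q R)
include S

/-- With the arc list exhausted, `done` has no exception left, so another vertex may become current
and bring its own list. -/
theorem IsSearch.pop (hA : IsAdjacency n m E₀ E₁ first next head edge A) (ha : a = 0)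
    (hq : q < t) :
    IsSearch n m E₀ E₁ next head edge s stamp (Q q) (q + 1) t (first (Q q)) h seen dist par pe Q
      (A (Q q)) := by
  obtain rfl : R = [] := (ha ▸ S.chain).eq_nil
  refine { S with
    q_le := hq
    dist_le := fun j hj => (S.dist_le j hj).trans (by have := S.le_dist q hq le_rfl; omega)
    le_dist := fun j hj hqj => S.mono q j (by omega) hj
    current := ⟨q, hq, rfl⟩
    done := fun j hj i w hl => ?_
    chain := hA.chain _
    arcs := hA.link _ }
  by_cases hjq : j = q
  · subst hjq
    exact .inr ⟨rfl, hA.exists_arc i _ w hl⟩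
  · rcases S.done j (by omega) i w hl with h | ⟨_, b, hb, _⟩
    · exact .inl h
    · simp at hb

/-- A vertex seen before has depth at most `dist u + 1`, which is all that exploring the arc has to
ensure. -/
theorem IsSearch.skip (ha : a ≠ 0) (hv : seen (head a) = stamp) : ∃ R', R = a :: R' ∧
    IsSearch n m E₀ E₁ next head edge s stamp u q t (next a) h seen dist par pe Q R' := by
  obtain ⟨R', rfl, hch⟩ := S.chain.eq_cons ha
  refine ⟨R', rfl, { S with
    done := fun j hj i w hl => ?_
    chain := hch
    arcs := fun b hb => S.arcs b (by simp [hb]) }⟩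
  rcases S.done j hj i w hl with h | ⟨hu, b, hb, h1, h2⟩
  · exact .inl h
  · rcases List.mem_cons.1 hb with rfl | hb
    · obtain ⟨k, hk, hkv⟩ := (S.seen_iff _).1 hv
      refine .inl ⟨h2 ▸ hv, ?_⟩
      rw [hu, ← h2, ← hkv]
      exact S.dist_le k hk
    · exact .inr ⟨hu, b, hb, h1, h2⟩

/-- The new depth `dist u + 1` is as large as any so far. Hence the queue stays sorted when the
vertex is appended, and this depth is the new height. -/
theorem IsSearch.push (hE : ∀ i < m, E₀ i < n ∧ E₁ i < n) (ha : a ≠ 0)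
    (hv : seen (head a) ≠ stamp) : ∃ R', R = a :: R' ∧
    IsSearch n m E₀ E₁ next head edge s stamp u q (t + 1) (next a) (dist u + 1)
      (Function.update seen (head a) stamp) (Function.update dist (head a) (dist u + 1))
      (Function.update par (head a) u) (Function.update pe (head a) (edge a + 1))
      (Function.update Q t (head a)) R' := by
  obtain ⟨R', rfl, hch⟩ := S.chain.eq_cons ha
  refine ⟨R', rfl, ?_⟩
  set v := head a with hvdef
  have hnew : ∀ j < t, Q j ≠ v := fun j hj e => hv ((S.seen_iff v).2 ⟨j, hj, e⟩)
  have hvs : s ≠ v := S.Q_zero ▸ hnew 0 S.t_pos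
  have hQ : ∀ j < t, Function.update Q t v j = Q j := fun j hj =>
    Function.update_of_ne (by omega) _ _
  have hQt : Function.update Q t v t = v := Function.update_self _ _ _
  have hlt : ∀ {j}, j < t + 1 → j ≠ t → j < t := fun h1 h2 => by omega
  have hdQ : ∀ j < t, Function.update dist v (dist u + 1) (Q j) = dist (Q j) := fun j hj =>
    Function.update_of_ne (hnew j hj) _ _
  obtain ⟨ju, hju, hjuu⟩ := S.current
  have huv : u ≠ v := hjuu ▸ hnew ju hju
  have hdu : Function.update dist v (dist u + 1) u = dist u := Function.update_of_ne huv _ _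
  have hl := S.arcs a (by simp)
  have hvn : v < n := by
    have := hE _ hl.1
    rcases hl.2 with ⟨_, h⟩ | ⟨h, _⟩ <;> omega
  refine ⟨S.root_lt, ?_, ?_, S.q_le.trans (Nat.le_succ t), by omega, ?_, fun j hj => ?_,
    fun j hj k hk e => ?_, fun w => ?_, fun w => ?_, fun j hj hne => ?_, fun j k hjk hk => ?_,
    fun j hj => ?_, fun j hj hqj => ?_, ⟨ju, by omega, ?_⟩, fun j hj i w hl' => ?_, hch,
    fun b hb => S.arcs b (by simp [hb]), fun j hj => ?_, ⟨t, by omega, ?_⟩⟩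
  · rw [Function.update_of_ne hvs, S.dist_root]
  · rw [Function.update_of_ne hvs, S.pe_root]
  · rw [hQ 0 S.t_pos, S.Q_zero]
  · by_cases h : j = t
    · rw [h, hQt]; exact hvn
    · rw [hQ j (hlt hj h)]; exact S.Q_lt j (hlt hj h)
  · by_cases hj' : j = t <;> by_cases hk' : k = t
    · rw [hj', hk']
    · rw [hj', hQt, hQ k (hlt hk hk')] at e
      exact (hnew k (hlt hk hk') e.symm).elim
    · rw [hk', hQt, hQ j (hlt hj hj')] at e
      exact (hnew j (hlt hj hj') e).elim
    · rw [hQ j (hlt hj hj'), hQ k (hlt hk hk')] at e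
      exact S.Q_inj j (hlt hj hj') k (hlt hk hk') e
  · rw [Function.update_apply]
    split
    exacts [le_rfl, S.seen_le w]
  · by_cases hw : w = v
    · rw [hw, Function.update_self]
      exact ⟨fun _ => ⟨t, by omega, hQt⟩, fun _ => rfl⟩
    · rw [Function.update_of_ne hw, S.seen_iff]
      constructor
      · rintro ⟨j, hj, e⟩
        exact ⟨j, by omega, (hQ j hj).trans e⟩
      · rintro ⟨j, hj, e⟩
        by_cases h : j = t
        · rw [h, hQt] at e
          exact (hw e.symm).elim
        · exact ⟨j, hlt hj h, by rw [← e, hQ j (hlt hj h)]⟩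
  · by_cases h : j = t
    · subst h
      rw [hQt, Function.update_self, Function.update_self, Function.update_self, hdu]
      exact ⟨⟨ju, hju, (hQ ju hju).trans hjuu⟩, rfl, by omega, by simpa using hl.symm⟩
    · have hj' := hlt hj h
      rw [hQ j hj'] at hne ⊢
      obtain ⟨⟨k, hk, e⟩, h1, h2, h3⟩ := S.tree j hj' hne
      rw [Function.update_of_ne (hnew j hj'), Function.update_of_ne (hnew j hj'),
        Function.update_of_ne (hnew j hj'), ← e,
        hdQ k (by omega), e]
      exact ⟨⟨k, hk, (hQ k (by omega)).trans e⟩, h1, h2, h3⟩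
  · by_cases h : k = t
    · rw [h, hQt, Function.update_self]
      by_cases h' : j = t
      · rw [h', hQt, Function.update_self]
      · rw [hQ j (by omega), hdQ j (by omega)]
        exact S.dist_le j (by omega)
    · rw [hQ j (by omega), hQ k (by omega), hdQ j (by omega), hdQ k (by omega)]
      exact S.mono j k hjk (by omega)
  · rw [hdu]
    by_cases h : j = t
    · rw [h, hQt, Function.update_self]
    · rw [hQ j (by omega), hdQ j (by omega)]
      exact S.dist_le j (by omega)
  · rw [hdu]
    by_cases h : j = t
    · rw [h, hQt, Function.update_self]
      omega
    · rw [hQ j (by omega), hdQ j (by omega)]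
      exact S.le_dist j (by omega) hqj
  · rw [hQ ju hju, hjuu]
  · have hjt : j < t := hj.trans_le S.q_le
    rw [hQ j hjt] at hl' ⊢
    rw [hdQ j hjt]
    by_cases hw : w = v
    · rw [hw, Function.update_self, Function.update_self]
      rcases S.done j hj i w hl' with ⟨h, _⟩ | ⟨hu, b, hb, h1, h2⟩
      · exact (hv (hw ▸ h)).elim
      · exact .inl ⟨rfl, by rw [hu]⟩
    · rw [Function.update_of_ne hw, Function.update_of_ne hw]
      rcases S.done j hj i w hl' with h | ⟨hu, b, hb, h1, h2⟩
      · exact .inl h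
      · rcases List.mem_cons.1 hb with rfl | hb
        · exact (hw h2.symm).elim
        · exact .inr ⟨hu, b, hb, h1, h2⟩
  · by_cases h : j = t
    · rw [h, hQt, Function.update_self]
    · rw [hQ j (by omega), hdQ j (by omega)]
      exact S.dist_le j (by omega)
  · rw [hQt, Function.update_self]

theorem IsSearch.t_le : t ≤ n := by
  have := Finset.card_le_card_of_injOn (s := Finset.range t) (t := Finset.range n) Q
    (fun j hj => by simpa using S.Q_lt j (by simpa using hj))
    (fun j hj k hk e => S.Q_inj j (by simpa using hj) k (by simpa using hk) e)
  simpa using this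

/-- Parents stand earlier in the queue. As the queue has at most `n` entries, this keeps all depths
below `n`. -/
theorem IsSearch.dist_le_index : ∀ j < t, dist (Q j) ≤ j := by
  intro j
  induction j using Nat.strong_induction_on with
  | _ j ih =>
    intro hj
    by_cases hs : Q j = s
    · rw [hs, S.dist_root]; omega
    · obtain ⟨⟨k, hk, e⟩, h1, -, -⟩ := S.tree j hj hs
      have := ih k hk (by omega)
      rw [e] at this
      omega

/-- The number of steps that remain. -/
def searchFuel (n q : ℕ) (A : ℕ → List ℕ) (Q : ℕ → ℕ) (R : List ℕ) : ℕ :=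
  R.length + ∑ v ∈ Finset.range n \ (Finset.range q).image Q, ((A v).length + 1)

omit S in
theorem searchFuel_zero_le (hA : IsAdjacency n m E₀ E₁ first next head edge A) :
    searchFuel n 0 A Q [] ≤ 2 * m + n := by
  have := hA.sum_le
  simp only [searchFuel, List.length_nil, Finset.range_zero, Finset.image_empty,
    Finset.sdiff_empty, Finset.sum_add_distrib, Finset.sum_const, Finset.card_range,
    smul_eq_mul, mul_one]
  omega

/-- The arcs of the vertex move from the sum to the current list, and the extra 1 in its summand
pays for the round that takes it. -/
theorem IsSearch.fuel_pop (hR : R = []) (hq : q < t) :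
    searchFuel n q A Q R = searchFuel n (q + 1) A Q (A (Q q)) + 1 := by
  have hmem : Q q ∈ Finset.range n \ (Finset.range q).image Q := by
    simp only [Finset.mem_sdiff, Finset.mem_range, Finset.mem_image, not_exists, not_and]
    refine ⟨S.Q_lt q hq, fun j hj e => ?_⟩
    have := S.Q_inj j (by omega) q hq e
    omega
  have hsd : Finset.range n \ (Finset.range (q + 1)).image Q =
      (Finset.range n \ (Finset.range q).image Q).erase (Q q) := by
    ext v
    simp only [Finset.mem_sdiff, Finset.mem_range, Finset.mem_image, Finset.mem_erase]
    grind
  simp only [searchFuel, hR, List.length_nil, hsd]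
  rw [← Finset.add_sum_erase _ _ hmem]
  ring

-- The fuel sees only the part of the queue already taken, so appending a vertex does not alter it.
omit S in
theorem searchFuel_congr {Q' : ℕ → ℕ} (h : ∀ j < q, Q' j = Q j) :
    searchFuel n q A Q' R = searchFuel n q A Q R := by
  have : (Finset.range q).image Q' = (Finset.range q).image Q :=
    Finset.image_congr fun j hj => h j (by simpa using hj)
  rw [searchFuel, this, searchFuel]

omit S in
theorem searchFuel_cons : searchFuel n q A Q (a :: R) = searchFuel n q A Q R + 1 := by
  simp only [searchFuel, List.length_cons]
  ring

/-- The graph is connected. -/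
def IsLinked (n m : ℕ) (E₀ E₁ : ℕ → ℕ) : Prop :=
  ∀ S : Set ℕ, (∃ v ∈ S, v < n) → (∀ i u w, Link m E₀ E₁ i u w → u ∈ S → w ∈ S) →
    ∀ v < n, v ∈ S

/-- The tree is a tree of shortest paths, and `h` is its exact height. -/
structure IsShortest (n m : ℕ) (E₀ E₁ : ℕ → ℕ) (h : ℕ) (dist : ℕ → ℕ) : Prop where
  dist_le : ∀ i u w, Link m E₀ E₁ i u w → dist w ≤ dist u + 1
  height : ∃ v < n, dist v = h

/-- When no arc and no waiting vertex is left, the seen vertices are closed under adjacency, so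
connectedness makes them everything. Then `done` says that depth grows by at most one along an edge,
which identifies depths with distances. -/
theorem IsSearch.finish (hE : ∀ i < m, E₀ i < n ∧ E₁ i < n) (hc : IsLinked n m E₀ E₁)
    (ha : a = 0) (hq : ¬ q < t) :
    IsTree n m E₀ E₁ s h t dist par pe Q ∧ IsShortest n m E₀ E₁ h dist ∧ h < n := by
  obtain rfl : R = [] := (ha ▸ S.chain).eq_nil
  obtain rfl : q = t := le_antisymm S.q_le (by omega)
  have hdone : ∀ j < q, ∀ i w, Link m E₀ E₁ i (Q j) w →
      (∃ k < q, Q k = w) ∧ dist w ≤ dist (Q j) + 1 := by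
    intro j hj i w hl
    rcases S.done j hj i w hl with ⟨h1, h2⟩ | ⟨_, b, hb, _⟩
    · exact ⟨(S.seen_iff w).1 h1, h2⟩
    · simp at hb
  have hsurj : ∀ v < n, ∃ j < q, Q j = v :=
    hc {v | ∃ j < q, Q j = v} ⟨s, ⟨0, S.t_pos, S.Q_zero⟩, S.root_lt⟩ (by
      rintro i u w hl ⟨j, hj, rfl⟩
      exact (hdone j hj i w hl).1)
  refine ⟨⟨S.root_lt, S.dist_root, S.pe_root, ?_, ?_, ?_, ?_, ?_, S.Q_lt, S.Q_inj, hsurj, ?_⟩,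
    ⟨?_, ?_⟩, ?_⟩
  · intro v hv hs
    obtain ⟨j, hj, rfl⟩ := hsurj v hv
    obtain ⟨⟨k, hk, e⟩, -⟩ := S.tree j hj hs
    exact e ▸ S.Q_lt k (by omega)
  · intro v hv hs
    obtain ⟨j, hj, rfl⟩ := hsurj v hv
    exact (S.tree j hj hs).2.1
  · intro v hv hs
    obtain ⟨j, hj, rfl⟩ := hsurj v hv
    exact (S.tree j hj hs).2.2.1
  · intro v hv hs
    obtain ⟨j, hj, rfl⟩ := hsurj v hv
    exact (S.tree j hj hs).2.2.2
  · intro v hv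
    obtain ⟨j, hj, rfl⟩ := hsurj v hv
    exact S.le_height j hj
  · exact fun j hj hs => (S.tree j hj hs).1
  · intro i u w hl
    have hu : u < n := by
      have := hE i hl.1
      rcases hl.2 with ⟨h, _⟩ | ⟨_, h⟩ <;> omega
    obtain ⟨j, hj, rfl⟩ := hsurj u hu
    exact (hdone j hj i w hl).2
  · obtain ⟨j, hj, e⟩ := S.height
    exact ⟨Q j, S.Q_lt j hj, e⟩
  · obtain ⟨j, hj, e⟩ := S.height
    have := S.dist_le_index j hj
    have := S.t_le
    omega

end Search

/-- The adjacency lists in the memory, and the number of the last search. -/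
structure HasLists (n m : ℕ) (E₀ E₁ : ℕ → ℕ) (σ : State) : Prop extends HasGraph n m E₀ E₁ σ where
  lists : ∃ A, IsAdjacency n m E₀ E₁ (σ.mem 3) (σ.mem 4) (σ.mem 13) (σ.mem 14) A
  seen_le : ∀ v, σ.mem 5 v ≤ σ.reg 5

/-- The tree in the memory, with height `h` and root `s`. -/
structure HasTree (n m : ℕ) (E₀ E₁ : ℕ → ℕ) (s h : ℕ) (σ : State) : Prop where
  tree : IsTree n m E₀ E₁ s h (σ.reg 8) (σ.mem 6) (σ.mem 7) (σ.mem 8) (σ.mem 9)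
  shortest : IsShortest n m E₀ E₁ h (σ.mem 6)
  height_lt : h < n
  reg_source : σ.reg 4 = s
  reg_height : σ.reg 11 = h

/-- The parts of the memory that a search does not touch. -/
structure SameRest (σ τ : State) : Prop where
  reg : ∀ x ≥ 12, τ.reg x = σ.reg x
  mem_eleven : τ.mem 11 = σ.mem 11
  mem_twelve : τ.mem 12 = σ.mem 12

theorem search_runs {n m B s p : ℕ} {E₀ E₁ : ℕ → ℕ} (hE : ∀ i < m, E₀ i < n ∧ E₁ i < n)
    (hc : IsLinked n m E₀ E₁) (hB : n + m + 1 ≤ B) {σ : State} (hσ : σ.Bdd B)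
    (hl : HasLists n m E₀ E₁ σ) (h5 : σ.reg 5 = p) (hp : p + 1 ≤ B) (h4 : σ.reg 4 = s)
    (hs : s < n) :
    Runs B search (100 * (2 * m + n) + 100) (fun τ => HasLists n m E₀ E₁ τ ∧
      (∃ h, HasTree n m E₀ E₁ s h τ) ∧ τ.reg 5 = p + 1 ∧ SameRest σ τ) σ := by
  obtain ⟨⟨g0, g1, g2, g3⟩, ⟨A, hA⟩, hseen⟩ := hl
  let I : ℕ → State → Prop := fun f τ => HasGraph n m E₀ E₁ τ ∧
    IsAdjacency n m E₀ E₁ (τ.mem 3) (τ.mem 4) (τ.mem 13) (τ.mem 14) A ∧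
    (∃ R, f = searchFuel n (τ.reg 7) A (τ.mem 9) R ∧
      IsSearch n m E₀ E₁ (τ.mem 4) (τ.mem 13) (τ.mem 14) s (p + 1) (τ.reg 6) (τ.reg 7) (τ.reg 8)
        (τ.reg 9) (τ.reg 11) (τ.mem 5) (τ.mem 6) (τ.mem 7) (τ.mem 8) (τ.mem 9) R) ∧
    τ.reg 4 = s ∧ τ.reg 5 = p + 1 ∧ SameRest σ τ
  have hinit : Runs B searchInit searchInit.time (fun τ => ∃ f ≤ 2 * m + n, I f τ) σ := by
    refine Runs.of_wp hσ ?_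
    simp only [searchInit, Prog.wp, Expr.Simple, Expr.eval, State.reg_setReg, State.reg_setMem,
      h5, h4]
    simp
    refine ⟨by omega, by omega, _, searchFuel_zero_le hA (Q := Function.update (σ.mem 9) 0 s), ?_⟩
    refine ⟨⟨by simpa, by simpa, by simpa, by simpa⟩, by simpa using hA, ⟨[], by simp, ?_⟩,
      by simpa, by simp, ⟨fun x hx => ?_, by simp, by simp⟩⟩
    · simp
      exact IsSearch.init hs fun v => by have := hseen v; omega
    · simp
      grind
  have hbody : ∀ f τ, τ.Bdd B → I f τ →
      (Test.not (.and (.eq (.var 9) (.lit 0)) (.not (.lt (.var 7) (.var 8))))).Holds τ →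
      ∃ f', f = f' + 1 ∧ Runs B searchBody searchBody.time (I f') τ := by
    rintro f τ hτ ⟨⟨k0, k1, k2, k3⟩, hA', ⟨R, hf, hS⟩, h4', h5', hrest⟩ hb
    simp only [Test.Holds, Expr.eval] at hb
    by_cases ha : τ.reg 9 = 0
    · have hq : τ.reg 7 < τ.reg 8 := by
        by_contra hq
        exact hb ⟨ha, hq⟩
      have hR : R = [] := (ha ▸ hS.chain).eq_nil
      refine ⟨_, hf.trans (hS.fuel_pop hR hq), Runs.of_wp hτ ?_⟩
      simp only [searchBody, Prog.wp, Expr.Simple, Expr.eval, State.reg_setReg, State.mem_setReg,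
        State.reg_setMem, State.mem_setMem, Test.Holds, ha]
      simp
      have := hS.t_le
      refine ⟨by omega, ⟨by simpa, by simpa, by simpa, by simpa⟩, by simpa using hA',
        ⟨A (τ.mem 9 (τ.reg 7)), by simp, ?_⟩, by simpa, by simpa,
        ⟨fun x hx => ?_, by simpa using hrest.mem_eleven, by simpa using hrest.mem_twelve⟩⟩
      · simp
        exact hS.pop hA' ha hq
      · have := hrest.reg x hx
        simp
        grind
    · by_cases hv : τ.mem 5 (τ.mem 13 (τ.reg 9)) = p + 1
      · obtain ⟨R', rfl, hS'⟩ := hS.skip ha hv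
        refine ⟨_, hf.trans searchFuel_cons, Runs.of_wp hτ ?_⟩
        simp only [searchBody, Prog.wp, Expr.Simple, Expr.eval, State.reg_setReg, State.mem_setReg,
          State.reg_setMem, State.mem_setMem, Test.Holds, ha]
        simp [h5', hv]
        refine ⟨⟨by simpa, by simpa, by simpa, by simpa⟩, by simpa using hA',
          ⟨R', by simp, ?_⟩, by simpa, by simpa,
          ⟨fun x hx => ?_, by simpa using hrest.mem_eleven, by simpa using hrest.mem_twelve⟩⟩
        · simpa using hS'
        · have := hrest.reg x hx
          simp
          grind
      · obtain ⟨R', rfl, hS'⟩ := hS.push hE ha hv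
        refine ⟨_, hf.trans searchFuel_cons, Runs.of_wp hτ ?_⟩
        simp only [searchBody, Prog.wp, Expr.Simple, Expr.eval, State.reg_setReg, State.mem_setReg,
          State.reg_setMem, State.mem_setMem, Test.Holds, ha]
        simp [h5', hv]
        have hl := (hS.arcs _ (List.mem_cons_self ..)).1
        have hd : τ.mem 6 (τ.reg 6) < n := by
          obtain ⟨j, hj, e⟩ := hS.current
          have := hS.dist_le_index j hj
          have := hS.t_le
          rw [e] at *
          omega
        have := hS'.t_le
        refine ⟨by omega, by omega, by omega, ⟨by simpa, by simpa, by simpa, by simpa⟩,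
          by simpa using hA', ⟨R', ?_, ?_⟩, by simpa, by simpa,
          ⟨fun x hx => ?_, by simpa using hrest.mem_eleven, by simpa using hrest.mem_twelve⟩⟩
        · simp
          refine (searchFuel_congr fun j hj => Function.update_of_ne ?_ _ _).symm
          have := hS.q_le
          omega
        · simpa using hS'
        · have := hrest.reg x hx
          simp
          grind
  refine ((hinit.mono (t' := searchInit.time) le_rfl (Q' := fun τ => Runs B
    (.loop (.not (.and (.eq (.var 9) (.lit 0)) (.not (.lt (.var 7) (.var 8))))) searchBody)
    (100 * (2 * m + n) + 50) _ τ) ?_).seq).mono ?_ fun τ _ h => h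
  · rintro τ hτ ⟨f, hf, hI⟩
    refine (Runs.loop (c := searchBody.time) I hbody hτ hI).mono ?_ ?_
    · simp only [searchBody, Prog.time, Expr.cost, Test.cost]
      omega
    · rintro υ hυ ⟨⟨f', ⟨k, hA', ⟨R, -, hS⟩, k4, k5, hr⟩⟩, hb⟩
      simp only [Test.Holds, Expr.eval, not_not] at hb
      obtain ⟨h1, h2, h3⟩ := hS.finish hE hc hb.1 hb.2
      exact ⟨⟨k, ⟨A, hA'⟩, by rw [k5]; exact hS.seen_le⟩, ⟨_, h1, h2, h3, k4, rfl⟩, k5, hr⟩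
  · simp only [searchInit, Prog.time, Expr.cost]
    omega

end Rainbow

namespace Rainbow

/-! ### A phase -/

/-- Compute the branches; mark the branch roots and give them type `0`. -/
def labelBody : Prog :=
  .assign 10 (.read 9 (.var 2)) ;;
  -- The number `n`, which is no vertex, serves as the branch of `D`. The queue lists parents first,
  -- so the branch of the parent is known already.
  .ite (.eq (.read 12 (.var 10)) (.lit 1)) (.write 10 (.var 10) (.var 0))
    (.ite (.eq (.read 10 (.read 7 (.var 10))) (.var 0))
      (.write 10 (.var 10) (.var 10) ;;
        .write 12 (.var 10) (.lit 1) ;;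
        .write 11 (.var 10) (.lit 0))
      (.write 10 (.var 10) (.read 10 (.read 7 (.var 10))))) ;;
  .assign 2 (.add (.var 2) (.lit 1))

/-- Colour the edges outside of the marked part. -/
def paintBody : Prog :=
  -- Tree edges outside are painted here too; they get their final colour of the phase from
  -- `treeBody`.
  .ite (.and (.eq (.read 10 (.read 0 (.var 2))) (.var 0))
      (.eq (.read 10 (.read 1 (.var 2))) (.var 0)))
    .skip (.write 2 (.var 2) (.var 16)) ;;
  .assign 2 (.add (.var 2) (.lit 1))

/-- Give types to the branches joined by an edge, and mark its ends. -/
def typeBody : Prog :=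
  .assign 6 (.read 0 (.var 2)) ;;
  .assign 10 (.read 1 (.var 2)) ;;
  .assign 17 (.read 10 (.var 6)) ;;
  .assign 18 (.read 10 (.var 10)) ;;
  -- The counter is increased before the test, because parent edges are stored with their number
  -- plus one.
  .assign 2 (.add (.var 2) (.lit 1)) ;;
  .ite (.and (.not (.eq (.read 8 (.var 6)) (.var 2))) (.and
      (.not (.eq (.read 8 (.var 10)) (.var 2))) (.not (.eq (.var 17) (.var 18)))))
    (.ite (.eq (.read 11 (.var 17)) (.lit 0))
      -- If both branches are untyped, the second receives type 2, and then the first receives `3 -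
      -- 2 = 1`. If just one is untyped, it receives the type complementary to the other.
      (.ite (.eq (.read 11 (.var 18)) (.lit 0)) (.write 11 (.var 18) (.lit 2)) .skip ;;
        .write 11 (.var 17) (.sub (.lit 3) (.read 11 (.var 18))) ;;
        .write 12 (.var 6) (.lit 1) ;;
        .write 12 (.var 10) (.lit 1))
      (.ite (.eq (.read 11 (.var 18)) (.lit 0))
        (.write 11 (.var 18) (.sub (.lit 3) (.read 11 (.var 17))) ;;
          .write 12 (.var 6) (.lit 1) ;;
          .write 12 (.var 10) (.lit 1))
        .skip))
    .skip

/-- Mark the parent of a marked vertex. -/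
def markBody : Prog :=
  -- The queue is read backwards, so that a vertex is treated after all of its children and one pass
  -- gives the closure.
  .assign 2 (.sub (.var 2) (.lit 1)) ;;
  .assign 10 (.read 9 (.var 2)) ;;
  .ite (.and (.eq (.read 12 (.var 10)) (.lit 1)) (.not (.eq (.read 10 (.var 10)) (.var 0))))
    (.write 12 (.read 7 (.var 10)) (.lit 1)) .skip

/-- Colour the edge to the parent. -/
def treeBody : Prog :=
  .assign 10 (.read 9 (.var 2)) ;;
  .assign 17 (.read 10 (.var 10)) ;;
  .assign 2 (.add (.var 2) (.lit 1)) ;;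
  .ite (.eq (.var 17) (.var 0)) .skip
    (.ite (.eq (.read 11 (.var 17)) (.lit 0))
      (.write 2 (.sub (.read 8 (.var 10)) (.lit 1)) (.var 10))
      (.write 2 (.sub (.read 8 (.var 10)) (.lit 1))
        (.add (.add (.var 16) (.add (.sub (.read 6 (.var 10)) (.read 6 (.var 17)))
          (.sub (.read 6 (.var 10)) (.read 6 (.var 17))))) (.read 11 (.var 17)))))

/-- A phase of the algorithm. -/
def phase : Prog :=
  (.assign 2 (.lit 0) ;; .loop (.lt (.var 2) (.var 8)) labelBody) ;;
  (.assign 2 (.lit 0) ;; .loop (.lt (.var 2) (.var 1)) paintBody) ;;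
  (.assign 2 (.lit 0) ;; .loop (.lt (.var 2) (.var 1)) typeBody) ;;
  (.assign 2 (.var 8) ;; .loop (.lt (.lit 0) (.var 2)) markBody) ;;
  (.assign 2 (.lit 0) ;; .loop (.lt (.var 2) (.var 8)) treeBody) ;;
  (.assign 16 (.add (.var 16) (.add (.add (.var 15) (.var 15)) (.lit 1))) ;;
    .assign 15 (.sub (.var 15) (.lit 1)))

/-- The part of the memory that is fixed during the main part of a phase. -/
structure HasPhase (n m : ℕ) (E₀ E₁ : ℕ → ℕ) (t : ℕ) (dist par pe Q : ℕ → ℕ) (k base : ℕ)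
    (σ : State) : Prop where
  reg_zero : σ.reg 0 = n
  reg_one : σ.reg 1 = m
  reg_eight : σ.reg 8 = t
  reg_fifteen : σ.reg 15 = k
  reg_sixteen : σ.reg 16 = base
  mem_zero : σ.mem 0 = E₀
  mem_one : σ.mem 1 = E₁
  mem_six : σ.mem 6 = dist
  mem_seven : σ.mem 7 = par
  mem_eight : σ.mem 8 = pe
  mem_nine : σ.mem 9 = Q

section Phase

variable {n m s h t k base B : ℕ} {E₀ E₁ dist par pe Q br ty mk col : ℕ → ℕ} {D M : Set ℕ}

/-! #### Branches -/

/-- The branches of `Q 0, …, Q (i - 1)` are known. -/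
structure IsLabelling (n i : ℕ) (par Q : ℕ → ℕ) (D : Set ℕ) (br ty mk : ℕ → ℕ) : Prop where
  of_mem : ∀ j < i, Q j ∈ D → br (Q j) = n
  of_par : ∀ j < i, Q j ∉ D → par (Q j) ∈ D → br (Q j) = Q j ∧ ty (Q j) = 0
  of_not_par : ∀ j < i, Q j ∉ D → par (Q j) ∉ D → br (Q j) = br (par (Q j))
  lt : ∀ j < i, Q j ∉ D → br (Q j) < n
  mark : ∀ v, mk v = 1 ↔ v ∈ D ∨ ∃ j < i, Q j = v ∧ v ∉ D ∧ par v ∈ D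
  ty_n : ty n = 2
  ty_le : ∀ x, ty x ≤ 2

theorem IsLabelling.step {i : ℕ} (T : IsTree n m E₀ E₁ s h t dist par pe Q)
    (L : IsLabelling n i par Q D br ty mk) (hi : i < t) {b : ℕ} {ty' mk' : ℕ → ℕ}
    (h1 : Q i ∈ D → b = n ∧ ty' = ty ∧ mk' = mk)
    (h2 : Q i ∉ D → par (Q i) ∈ D → b = Q i ∧ ty' = Function.update ty (Q i) 0 ∧
      mk' = Function.update mk (Q i) 1)
    (h3 : Q i ∉ D → par (Q i) ∉ D → b = br (par (Q i)) ∧ ty' = ty ∧ mk' = mk)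
    (hs : s ∈ D) : IsLabelling n (i + 1) par Q D (Function.update br (Q i) b) ty' mk' := by
  have hne : ∀ j < i, Q j ≠ Q i := fun j hj e => by
    have := T.Q_inj j (by omega) i hi e
    omega
  have hb : ∀ j < i, Function.update br (Q i) b (Q j) = br (Q j) := fun j hj =>
    Function.update_of_ne (hne j hj) _ _
  have hpar : ∀ j ≤ i, Q j ∉ D → ∃ l < i, Q l = par (Q j) := by
    intro j hj hD
    obtain ⟨l, hl, e⟩ := T.Q_par j (by omega) fun e => hD (e ▸ hs)
    exact ⟨l, by omega, e⟩
  have hbp : ∀ j ≤ i, Q j ∉ D → Function.update br (Q i) b (par (Q j)) = br (par (Q j)) := by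
    intro j hj hD
    obtain ⟨l, hl, e⟩ := hpar j hj hD
    rw [← e, hb l hl]
  have hty : ∀ v, v ≠ Q i → ty' v = ty v := by
    intro v hv
    by_cases hD : Q i ∈ D
    · rw [(h1 hD).2.1]
    · by_cases hp : par (Q i) ∈ D
      · rw [(h2 hD hp).2.1, Function.update_of_ne hv]
      · rw [(h3 hD hp).2.1]
  have split : ∀ {j}, j < i + 1 → j < i ∨ j = i := fun h => by omega
  refine ⟨fun j hj hD => ?_, fun j hj hD hp => ?_, fun j hj hD hp => ?_, fun j hj hD => ?_,
    fun v => ?_, ?_, fun x => ?_⟩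
  · rcases split hj with hj | rfl
    · rw [hb j hj, L.of_mem j hj hD]
    · rw [Function.update_self, (h1 hD).1]
  · rcases split hj with hj | rfl
    · rw [hb j hj, hty _ (hne j hj)]
      exact L.of_par j hj hD hp
    · obtain ⟨e1, e2, -⟩ := h2 hD hp
      rw [Function.update_self, e2, Function.update_self]
      exact ⟨e1, rfl⟩
  · rw [hbp j (by omega) hD]
    rcases split hj with hj | rfl
    · rw [hb j hj, L.of_not_par j hj hD hp]
    · rw [Function.update_self, (h3 hD hp).1]
  · rcases split hj with hj | rfl
    · rw [hb j hj]
      exact L.lt j hj hD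
    · rw [Function.update_self]
      by_cases hp : par (Q j) ∈ D
      · rw [(h2 hD hp).1]
        exact T.Q_lt j hi
      · obtain ⟨l, hl, e⟩ := hpar j le_rfl hD
        rw [(h3 hD hp).1, ← e]
        exact L.lt l hl (e ▸ hp)
  · have old : (v ∈ D ∨ ∃ j < i, Q j = v ∧ v ∉ D ∧ par v ∈ D) ∨
        (v = Q i ∧ v ∉ D ∧ par v ∈ D) ↔
        v ∈ D ∨ ∃ j < i + 1, Q j = v ∧ v ∉ D ∧ par v ∈ D := by
      constructor
      · rintro ((hD | ⟨j, hj, e⟩) | ⟨rfl, e⟩)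
        exacts [.inl hD, .inr ⟨j, by omega, e⟩, .inr ⟨i, by omega, rfl, e⟩]
      · rintro (hD | ⟨j, hj, e, e'⟩)
        · exact .inl (.inl hD)
        · rcases split hj with hj | rfl
          exacts [.inl (.inr ⟨j, hj, e, e'⟩), .inr ⟨e.symm, e'⟩]
    rw [← old, ← L.mark]
    by_cases hD : Q i ∈ D
    · rw [(h1 hD).2.2]
      grind
    · by_cases hp : par (Q i) ∈ D
      · rw [(h2 hD hp).2.2, Function.update_apply]
        grind
      · rw [(h3 hD hp).2.2]
        grind
  · rw [hty n (T.Q_lt i hi).ne', L.ty_n]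
  · by_cases hx : x = Q i
    · by_cases hD : Q i ∈ D
      · rw [(h1 hD).2.1]
        exact L.ty_le x
      · by_cases hp : par (Q i) ∈ D
        · rw [(h2 hD hp).2.1, hx, Function.update_self]
          omega
        · rw [(h3 hD hp).2.1]
          exact L.ty_le x
    · rw [hty x hx]
      exact L.ty_le x

theorem IsLabelling.finish (T : IsTree n m E₀ E₁ s h t dist par pe Q) (hs : s ∈ D)
    (hp : ∀ v ∈ D, v ≠ s → par v ∈ D) (hD : ∀ v ∈ D, v < n)
    (L : IsLabelling n t par Q D br ty mk) :
    IsBranching n s par D br ∧ IsTyping n m 0 E₀ E₁ pe br ty D {v | mk v = 1} := by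
  have F : IsBranching n s par D br := by
    refine ⟨hs, fun v _ => hp v, fun v hv => ?_, fun v hv => ?_, fun v hv => ?_⟩ <;>
      obtain ⟨j, hj, rfl⟩ := T.Q_surj v hv
    · exact L.of_mem j hj
    · exact fun h1 h2 => (L.of_par j hj h1 h2).1
    · exact L.of_not_par j hj
  refine ⟨F, L.ty_n, L.ty_le, fun i hi => by omega, fun x hx hxD hr h0 => ?_, fun v hv hvD => ?_,
    fun v hv => ?_, fun v hv => (L.mark v).2 (.inl hv), fun x hx hxD hr => (L.mark x).2 ?_⟩
  · have h1 := (F.spec T hx hxD).2.2.1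
    rw [hr] at h1
    obtain ⟨j, hj, rfl⟩ := T.Q_surj x hx
    exact (h0 (L.of_par j hj hxD h1).2).elim
  · rcases (L.mark v).1 hv with h | ⟨j, hj, rfl, -, h⟩
    · exact (hvD h).elim
    · exact .inl (L.of_par j hj hvD h).1
  · rcases (L.mark v).1 hv with h | ⟨j, hj, rfl, -⟩
    exacts [hD v h, T.Q_lt j hj]
  · have h1 := (F.spec T hx hxD).2.2.1
    rw [hr] at h1
    obtain ⟨j, hj, rfl⟩ := T.Q_surj x hx
    exact .inr ⟨j, hj, rfl, hxD, h1⟩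

theorem label_runs (T : IsTree n m E₀ E₁ s h t dist par pe Q) (hB : n + 2 ≤ B) {σ : State}
    (hσ : σ.Bdd B) (hh : HasPhase n m E₀ E₁ t dist par pe Q k base σ)
    (hD : D = {v | σ.mem 12 v = 1}) (hs : s ∈ D)
    (hp : ∀ v ∈ D, v ≠ s → par v ∈ D) (hDn : ∀ v ∈ D, v < n) (hn : σ.mem 11 n = 2)
    (hle : ∀ x, σ.mem 11 x ≤ 2) (ht : t ≤ n) :
    Runs B (.assign 2 (.lit 0) ;; .loop (.lt (.var 2) (.var 8)) labelBody) (2 + (t * 100 + 3))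
      (fun τ => HasPhase n m E₀ E₁ t dist par pe Q k base τ ∧ τ.mem 2 = σ.mem 2 ∧
        IsBranching n s par D (τ.mem 10) ∧
        IsTyping n m 0 E₀ E₁ pe (τ.mem 10) (τ.mem 11) D {v | τ.mem 12 v = 1}) σ := by
  let I : ℕ → State → Prop := fun i τ => τ.reg 2 = i ∧
    HasPhase n m E₀ E₁ t dist par pe Q k base τ ∧ τ.mem 2 = σ.mem 2 ∧
    IsLabelling n i par Q D (τ.mem 10) (τ.mem 11) (τ.mem 12)
  refine Runs.seq (((Runs.of_wp hσ (Q := I 0) ?_).mono le_rfl fun τ hτ hI =>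
    (Runs.forUp (y := 8) (N := t) (c := labelBody.time) I (fun i τ h => ⟨h.1, h.2.1.reg_eight⟩)
      ?_ (Nat.zero_le t) hτ hI).mono ?_ ?_))
  · obtain ⟨a1, a2, a3, a4, a5, a6, a7, a8, a9, a10, a11⟩ := hh
    simp [Prog.wp, Expr.Simple, Expr.eval, I]
    refine ⟨by constructor <;> simpa, ⟨by simp, by simp, by simp, by simp, by simp [hD], hn, hle⟩⟩
  · rintro i τ hτ ⟨r2, ⟨a1, a2, a3, a4, a5, a6, a7, a8, a9, a10, a11⟩, hcol, L⟩ hi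
    refine Runs.of_wp hτ ?_
    -- New marks have been placed only at earlier vertices of the queue, so the mark of `Q i` still
    -- decides membership in `D`.
    have hmk : τ.mem 12 (Q i) = 1 ↔ Q i ∈ D := by
      rw [L.mark]
      refine ⟨?_, .inl⟩
      rintro (h | ⟨j, hj, e, -⟩)
      · exact h
      · have := T.Q_inj j (by omega) i hi e
        omega
    have hbr : Q i ∉ D → (τ.mem 10 (par (Q i)) = n ↔ par (Q i) ∈ D) := by
      intro hD
      obtain ⟨l, hl, e⟩ := T.Q_par i hi fun e => hD (e ▸ hs)
      rw [← e]
      exact ⟨fun h => by_contra fun h' => (L.lt l hl h').ne h, L.of_mem l hl⟩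
    simp only [labelBody, Prog.wp, Expr.Simple, Expr.eval, State.reg_setReg, State.mem_setReg,
      State.reg_setMem, State.mem_setMem, Test.Holds, r2, a1, a9, a11, I]
    simp
    refine ⟨fun hc => ?_, fun hc => ⟨fun hc' => ?_, fun hc' => ?_⟩⟩
    · refine ⟨by omega, by constructor <;> simpa, hcol, ?_⟩
      exact L.step T hi (fun _ => ⟨rfl, rfl, rfl⟩) (fun h => (h (hmk.1 hc)).elim)
        (fun h => (h (hmk.1 hc)).elim) hs
    · have h1 : Q i ∉ D := fun h => hc (hmk.2 h)
      have h2 := (hbr h1).1 hc'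
      refine ⟨by omega, by omega, by constructor <;> simpa, hcol, ?_⟩
      exact L.step T hi (fun h => (h1 h).elim) (fun _ _ => ⟨rfl, rfl, rfl⟩)
        (fun _ h => (h h2).elim) hs
    · have h1 : Q i ∉ D := fun h => hc (hmk.2 h)
      have h2 := fun h => hc' ((hbr h1).2 h)
      refine ⟨by omega, by constructor <;> simpa, hcol, ?_⟩
      exact L.step T hi (fun h => (h1 h).elim) (fun _ h => (h2 h).elim)
        (fun _ _ => ⟨rfl, rfl, rfl⟩) hs
  · simp only [labelBody, Prog.time, Expr.cost, Test.cost]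
    omega
  · rintro τ _ ⟨_, h1, h2, L⟩
    exact ⟨h1, h2, L.finish T hs hp hDn⟩

/-! #### Colours outside -/

theorem paint_runs (hB : m + 1 ≤ B) {σ : State}
    (hσ : σ.Bdd B) (hh : HasPhase n m E₀ E₁ t dist par pe Q k base σ) :
    Runs B (.assign 2 (.lit 0) ;; .loop (.lt (.var 2) (.var 1)) paintBody) (2 + (m * 100 + 3))
      (fun τ => HasPhase n m E₀ E₁ t dist par pe Q k base τ ∧
        (∀ j < m, τ.mem 2 j = if σ.mem 10 (E₀ j) = n ∧ σ.mem 10 (E₁ j) = n then σ.mem 2 j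
          else base) ∧
        τ.mem 10 = σ.mem 10 ∧ τ.mem 11 = σ.mem 11 ∧ τ.mem 12 = σ.mem 12) σ := by
  let I : ℕ → State → Prop := fun i τ => τ.reg 2 = i ∧
    HasPhase n m E₀ E₁ t dist par pe Q k base τ ∧
    (∀ j < i, τ.mem 2 j = if σ.mem 10 (E₀ j) = n ∧ σ.mem 10 (E₁ j) = n then σ.mem 2 j else base) ∧
    (∀ j ≥ i, τ.mem 2 j = σ.mem 2 j) ∧
    τ.mem 10 = σ.mem 10 ∧ τ.mem 11 = σ.mem 11 ∧ τ.mem 12 = σ.mem 12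
  refine Runs.seq (((Runs.of_wp hσ (Q := I 0) ?_).mono le_rfl fun τ hτ hI =>
    (Runs.forUp (y := 1) (N := m) (c := paintBody.time) I (fun i τ h => ⟨h.1, h.2.1.reg_one⟩)
      ?_ (Nat.zero_le m) hτ hI).mono ?_ ?_))
  · obtain ⟨a1, a2, a3, a4, a5, a6, a7, a8, a9, a10, a11⟩ := hh
    simp [Prog.wp, Expr.Simple, Expr.eval, I]
    constructor <;> simpa
  · rintro i τ hτ ⟨r2, ⟨a1, a2, a3, a4, a5, a6, a7, a8, a9, a10, a11⟩, hc, hc', hr⟩ hi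
    refine Runs.of_wp hτ ?_
    simp only [paintBody, Prog.wp, Expr.Simple, Expr.eval, State.reg_setReg, State.mem_setReg,
      State.reg_setMem, State.mem_setMem, Test.Holds, r2, a1, a5, a6, a7, I, hr.1]
    simp
    refine ⟨fun h1 h2 => ⟨by omega, by constructor <;> simpa, fun j hj => ?_,
      fun j hj => hc' j (by omega), hr.2⟩,
      fun h1 => ⟨by omega, by constructor <;> simpa, fun j hj => ?_, fun j hj => ?_, hr.2⟩⟩
    · by_cases e : j = i
      · subst e
        rw [hc' j le_rfl, if_pos ⟨h1, h2⟩]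
      · exact hc j (by omega)
    · by_cases e : j = i
      · subst e
        rw [Function.update_self, if_neg fun h => h1 h.1 h.2]
      · rw [Function.update_of_ne e]
        exact hc j (by omega)
    · rw [Function.update_of_ne (by omega)]
      exact hc' j (by omega)
  · simp only [paintBody, Prog.time, Expr.cost, Test.cost]
    omega
  · rintro τ _ ⟨_, h1, h2, -, h3⟩
    exact ⟨h1, h2, h3⟩

/-! #### Types -/

theorem IsEar.symm {i u w : ℕ} (e : IsEar n m E₀ E₁ pe br ty M i u w) :
    IsEar n m E₀ E₁ pe br ty M i w u :=
  ⟨e.link.symm, e.pe_ne, by rw [add_comm]; exact e.ty_add, e.right_mem, e.left_mem⟩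

theorem IsTyping.skip {i : ℕ} (Y : IsTyping n m i E₀ E₁ pe br ty D M)
    (h : (∀ v < n, pe v ≠ i + 1) → br (E₀ i) ≠ br (E₁ i) →
      ty (br (E₀ i)) ≠ 0 ∧ ty (br (E₁ i)) ≠ 0) : IsTyping n m (i + 1) E₀ E₁ pe br ty D M :=
  { Y with
    typed := fun j hj => by
      by_cases e : j = i
      · exact e ▸ h
      · exact Y.typed j (by omega) }

/-- Nonzero types never change, so old ears remain ears. Edge `i` serves as an ear for whichever of
its two branches has just been typed. -/
theorem IsTyping.step {i : ℕ} (Y : IsTyping n m i E₀ E₁ pe br ty D M) (hi : i < m)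
    (hE : ∀ i < m, E₀ i < n ∧ E₁ i < n) (hpe : ∀ v < n, pe v ≠ i + 1) {ty' : ℕ → ℕ}
    (hkeep : ∀ z, ty z ≠ 0 → ty' z = ty z)
    (hother : ∀ z, z ≠ br (E₀ i) → z ≠ br (E₁ i) → ty' z = ty z)
    (hsum : ty' (br (E₀ i)) + ty' (br (E₁ i)) = 3) (hle : ∀ z, ty' z ≤ 2) :
    IsTyping n m (i + 1) E₀ E₁ pe br ty' D (insert (E₁ i) (insert (E₀ i) M)) := by
  have hM : M ⊆ insert (E₁ i) (insert (E₀ i) M) :=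
    (Set.subset_insert _ _).trans (Set.subset_insert _ _)
  have hold : ∀ {j u w}, IsEar n m E₀ E₁ pe br ty M j u w →
      IsEar n m E₀ E₁ pe br ty' (insert (E₁ i) (insert (E₀ i) M)) j u w := by
    intro j u w e
    have h1 := e.ty_add
    have h2 := Y.ty_le (br u)
    have h3 := Y.ty_le (br w)
    refine ⟨e.link, e.pe_ne, ?_, hM e.left_mem, hM e.right_mem⟩
    rw [hkeep _ (by omega), hkeep _ (by omega), h1]
  have hnew : IsEar n m E₀ E₁ pe br ty' (insert (E₁ i) (insert (E₀ i) M)) i (E₀ i) (E₁ i) :=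
    ⟨⟨hi, .inl ⟨rfl, rfl⟩⟩, hpe, hsum, by simp, by simp⟩
  refine ⟨by rw [hkeep n (by rw [Y.ty_n]; omega), Y.ty_n], hle, fun j hj hj' hb => ?_,
    fun x hx hxD hr h0 => ?_, fun v hv hvD => ?_, fun v hv => ?_, Y.subset.trans hM,
    fun x hx hxD hr => hM (Y.root_mem x hx hxD hr)⟩
  · by_cases e : j = i
    · subst e
      have := hle (br (E₀ j))
      have := hle (br (E₁ j))
      omega
    · obtain ⟨h1, h2⟩ := Y.typed j (by omega) hj' hb
      rw [hkeep _ h1, hkeep _ h2]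
      exact ⟨h1, h2⟩
  · by_cases hx0 : ty x = 0
    · by_cases e0 : x = br (E₀ i)
      · exact ⟨i, _, _, hnew, e0.symm⟩
      · by_cases e1 : x = br (E₁ i)
        · exact ⟨i, _, _, hnew.symm, e1.symm⟩
        · exact (h0 (by rw [hother x e0 e1, hx0])).elim
    · obtain ⟨j, u, w, e, hu⟩ := Y.ear x hx hxD hr hx0
      exact ⟨j, u, w, hold e, hu⟩
  · rcases hv with rfl | rfl | hv
    · exact .inr ⟨i, _, hnew.symm⟩
    · exact .inr ⟨i, _, hnew⟩
    · rcases Y.marked v hv hvD with h | ⟨j, w, e⟩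
      exacts [.inl h, .inr ⟨j, w, hold e⟩]
  · rcases hv with rfl | rfl | hv
    exacts [(hE i hi).2, (hE i hi).1, Y.lt_of_mem v hv]

theorem setOf_update_one (mk : ℕ → ℕ) (u w : ℕ) :
    {v | Function.update (Function.update mk u 1) w 1 v = 1} =
      insert w (insert u {v | mk v = 1}) := by
  ext v
  simp only [Set.mem_ofPred_eq, Set.mem_insert_iff, Function.update_apply]
  grind

theorem type_runs (T : IsTree n m E₀ E₁ s h t dist par pe Q) (hB : m + 3 ≤ B)
    (hE : ∀ i < m, E₀ i < n ∧ E₁ i < n) {σ : State} (hσ : σ.Bdd B)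
    (hh : HasPhase n m E₀ E₁ t dist par pe Q k base σ)
    (Y : IsTyping n m 0 E₀ E₁ pe (σ.mem 10) (σ.mem 11) D {v | σ.mem 12 v = 1}) :
    Runs B (.assign 2 (.lit 0) ;; .loop (.lt (.var 2) (.var 1)) typeBody) (2 + (m * 100 + 3))
      (fun τ => HasPhase n m E₀ E₁ t dist par pe Q k base τ ∧
        τ.mem 2 = σ.mem 2 ∧ τ.mem 10 = σ.mem 10 ∧
        IsTyping n m m E₀ E₁ pe (τ.mem 10) (τ.mem 11) D {v | τ.mem 12 v = 1}) σ := by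
  let I : ℕ → State → Prop := fun i τ => τ.reg 2 = i ∧
    HasPhase n m E₀ E₁ t dist par pe Q k base τ ∧ τ.mem 2 = σ.mem 2 ∧ τ.mem 10 = σ.mem 10 ∧
    IsTyping n m i E₀ E₁ pe (τ.mem 10) (τ.mem 11) D {v | τ.mem 12 v = 1}
  refine Runs.seq (((Runs.of_wp hσ (Q := I 0) ?_).mono le_rfl fun τ hτ hI =>
    (Runs.forUp (y := 1) (N := m) (c := typeBody.time) I (fun i τ h => ⟨h.1, h.2.1.reg_one⟩)
      ?_ (Nat.zero_le m) hτ hI).mono ?_ ?_))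
  · obtain ⟨a1, a2, a3, a4, a5, a6, a7, a8, a9, a10, a11⟩ := hh
    simp [Prog.wp, Expr.Simple, Expr.eval, I]
    exact ⟨by constructor <;> simpa, Y⟩
  · rintro i τ hτ ⟨r2, ⟨a1, a2, a3, a4, a5, a6, a7, a8, a9, a10, a11⟩, hc, hb, Y⟩ hi
    refine Runs.of_wp hτ ?_
    rw [hb] at Y
    -- Testing the two ends is enough, as the parent edge of a vertex has that vertex as an end.
    have hpe : pe (E₀ i) ≠ i + 1 → pe (E₁ i) ≠ i + 1 → ∀ v < n, pe v ≠ i + 1 := by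
      intro h0 h1 v hv e
      have hvs : v ≠ s := by
        rintro rfl
        rw [T.pe_root] at e
        omega
      have hl := T.link v hv hvs
      rw [e, Nat.add_sub_cancel] at hl
      rcases hl.2 with ⟨e', -⟩ | ⟨-, e'⟩
      · exact h0 (e' ▸ e)
      · exact h1 (e' ▸ e)
    have l0 := Y.ty_le (σ.mem 10 (E₀ i))
    have l1 := Y.ty_le (σ.mem 10 (E₁ i))
    simp only [typeBody, Prog.wp, Expr.Simple, Expr.eval, State.reg_setReg, State.mem_setReg,
      State.reg_setMem, State.mem_setMem, Test.Holds, r2, a6, a7, a10, hb, I]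
    simp
    refine ⟨by omega, fun h1 h2 h3 => ⟨fun t0 => ⟨fun t1 => ?_, fun t1 => ?_⟩,
      fun t0 => ⟨fun t1 => ?_, fun t1 => ?_⟩⟩, fun h1 => ?_⟩
    · refine ⟨by omega, by omega, by constructor <;> simpa, hc, ?_⟩
      rw [setOf_update_one]
      have hle := Y.ty_le
      refine Y.step hi hE (hpe h1 h2) ?_ ?_ ?_ ?_ <;> simp only [Function.update_apply] <;> grind
    · refine ⟨by omega, by omega, by constructor <;> simpa, hc, ?_⟩
      rw [setOf_update_one]
      have hle := Y.ty_le
      refine Y.step hi hE (hpe h1 h2) ?_ ?_ ?_ ?_ <;> simp only [Function.update_apply] <;> grind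
    · refine ⟨by omega, by omega, by constructor <;> simpa, hc, ?_⟩
      rw [setOf_update_one]
      have hle := Y.ty_le
      refine Y.step hi hE (hpe h1 h2) ?_ ?_ ?_ ?_ <;> simp only [Function.update_apply] <;> grind
    · exact ⟨by constructor <;> simpa, hc, Y.skip fun _ _ => ⟨t0, t1⟩⟩
    · exact ⟨by constructor <;> simpa, hc, Y.skip fun h2 h3 =>
        (h3 (h1 (h2 _ (hE i hi).1) (h2 _ (hE i hi).2))).elim⟩
  · simp only [typeBody, Prog.time, Expr.cost, Test.cost]
    omega
  · rintro τ _ ⟨_, h1, h2, h3, h4⟩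
    exact ⟨h1, h2, h3, h4⟩

/-! #### Closure -/

/-- The marked vertices among `Q i, …, Q (t - 1)` outside of `D` have marked parents. -/
structure IsMarking (n i t : ℕ) (par Q : ℕ → ℕ) (D M M' : Set ℕ) : Prop where
  subset : M ⊆ M'
  lt_of_mem : ∀ v ∈ M', v < n
  par_mem : ∀ j < t, i ≤ j → Q j ∈ M' → Q j ∉ D → par (Q j) ∈ M'
  below : ∀ v ∈ M', v ∉ D → ∃ u ∈ M, u ∉ D ∧ Relation.ReflTransGen (fun a b => b = par a ∧ b ∉ D) u v

theorem IsMarking.skip {i : ℕ} {M' : Set ℕ} (K : IsMarking n (i + 1) t par Q D M M')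
    (h : Q i ∈ M' → Q i ∈ D) : IsMarking n i t par Q D M M' :=
  { K with
    par_mem := fun j hj hij h1 h2 => by
      by_cases e : j = i
      · subst e
        exact (h2 (h h1)).elim
      · exact K.par_mem j hj (by omega) h1 h2 }

/-- The parent stands before the child in the queue, so marking it creates no new obligation for the
vertices already treated. -/
theorem IsMarking.step {i : ℕ} {M' : Set ℕ} (T : IsTree n m E₀ E₁ s h t dist par pe Q)
    (K : IsMarking n (i + 1) t par Q D M M') (hi : i < t) (hs : s ∈ D) (hM : Q i ∈ M')
    (hD : Q i ∉ D) : IsMarking n i t par Q D M (insert (par (Q i)) M') := by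
  have hQs : Q i ≠ s := fun e => hD (e ▸ hs)
  refine ⟨K.subset.trans (Set.subset_insert _ _), fun v hv => ?_, fun j hj hij h1 h2 => ?_,
    fun v hv hvD => ?_⟩
  · rcases hv with rfl | hv
    exacts [T.par_lt _ (T.Q_lt i hi) hQs, K.lt_of_mem v hv]
  · by_cases e : j = i
    · subst e
      exact .inl rfl
    · rcases h1 with h1 | h1
      · obtain ⟨k, hk, e'⟩ := T.Q_par i hi hQs
        have := T.Q_inj k (by omega) j hj (e'.trans h1.symm)
        omega
      · exact .inr (K.par_mem j hj (by omega) h1 h2)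
  · rcases hv with rfl | hv
    · obtain ⟨u, h1, h2, h3⟩ := K.below _ hM hD
      exact ⟨u, h1, h2, h3.tail ⟨rfl, hvD⟩⟩
    · exact K.below v hv hvD

theorem IsMarking.finish {M' : Set ℕ} (T : IsTree n m E₀ E₁ s h t dist par pe Q)
    (K : IsMarking n 0 t par Q D M M') : IsClosure n par D M M' := by
  refine ⟨K.subset, K.lt_of_mem, fun v hv => ?_, K.below⟩
  obtain ⟨j, hj, rfl⟩ := T.Q_surj v (K.lt_of_mem v hv)
  exact K.par_mem j hj (Nat.zero_le j) hv

theorem setOf_update (mk : ℕ → ℕ) (u : ℕ) :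
    {v | Function.update mk u 1 v = 1} = insert u {v | mk v = 1} := by
  ext v
  simp only [Set.mem_ofPred_eq, Set.mem_insert_iff, Function.update_apply]
  grind

theorem mark_runs (T : IsTree n m E₀ E₁ s h t dist par pe Q) (hB : 3 ≤ B) {σ : State}
    (hσ : σ.Bdd B) (hh : HasPhase n m E₀ E₁ t dist par pe Q k base σ)
    (F : IsBranching n s par D (σ.mem 10)) (hM : M = {v | σ.mem 12 v = 1})
    (hMn : ∀ v ∈ M, v < n) :
    Runs B (.assign 2 (.var 8) ;; .loop (.lt (.lit 0) (.var 2)) markBody) (2 + (t * 100 + 3))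
      (fun τ => HasPhase n m E₀ E₁ t dist par pe Q k base τ ∧
        τ.mem 2 = σ.mem 2 ∧ τ.mem 10 = σ.mem 10 ∧ τ.mem 11 = σ.mem 11 ∧
        IsClosure n par D M {v | τ.mem 12 v = 1}) σ := by
  let I : ℕ → State → Prop := fun i τ => (τ.reg 2 = i ∧ i ≤ t) ∧
    HasPhase n m E₀ E₁ t dist par pe Q k base τ ∧ τ.mem 2 = σ.mem 2 ∧ τ.mem 10 = σ.mem 10 ∧
    τ.mem 11 = σ.mem 11 ∧ IsMarking n i t par Q D M {v | τ.mem 12 v = 1}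
  refine Runs.seq (((Runs.of_wp hσ (Q := I t) ?_).mono le_rfl fun τ hτ hI =>
    (Runs.forDown (c := markBody.time) I (fun i τ h => h.1.1) ?_ hτ hI).mono ?_ ?_))
  · obtain ⟨a1, a2, a3, a4, a5, a6, a7, a8, a9, a10, a11⟩ := hh
    simp [Prog.wp, Expr.Simple, Expr.eval, I, a3]
    refine ⟨by constructor <;> simpa, ?_⟩
    subst hM
    exact ⟨le_rfl, hMn, fun j hj hij => by omega, fun v hv hvD => ⟨v, hv, hvD, .refl⟩⟩
  · rintro i τ hτ ⟨⟨r2, hit⟩, ⟨a1, a2, a3, a4, a5, a6, a7, a8, a9, a10, a11⟩, hc, hb, hty, K⟩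
    refine Runs.of_wp hτ ?_
    have hbr := F.eq_iff T (T.Q_lt i hit)
    simp only [markBody, Prog.wp, Expr.Simple, Expr.eval, State.reg_setReg, State.mem_setReg,
      State.reg_setMem, State.mem_setMem, Test.Holds, r2, a1, a9, a11, I, hb]
    simp [hbr]
    refine ⟨fun h1 h2 => ⟨by omega, by omega, by constructor <;> simpa, hc, hty, ?_⟩,
      fun h1 => ⟨by omega, by constructor <;> simpa, hc, hty, K.skip h1⟩⟩
    rw [setOf_update]
    exact K.step T hit F.root_mem h1 h2
  · simp only [markBody, Prog.time, Expr.cost, Test.cost]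
    omega
  · rintro τ _ ⟨_, h1, h2, h3, h4, h5⟩
    exact ⟨h1, h2, h3, h4, h5.finish T⟩

/-! #### Colours of tree edges -/

/-- The edges above `Q 0, …, Q (i - 1)` have their colours. -/
structure IsPainting (i : ℕ) (dist pe Q br ty : ℕ → ℕ) (D : Set ℕ) (base : ℕ)
    (col col' : ℕ → ℕ) : Prop where
  tree : ∀ j < i, Q j ∉ D → col' (pe (Q j) - 1) =
    if ty (br (Q j)) = 0 then Q j
    else base + 2 * (dist (Q j) - dist (br (Q j))) + ty (br (Q j))
  other : ∀ e, (∀ j < i, Q j ∉ D → pe (Q j) ≠ e + 1) → col' e = col e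

theorem IsPainting.skip {i : ℕ} {col' : ℕ → ℕ} (P : IsPainting i dist pe Q br ty D base col col')
    (hD : Q i ∈ D) : IsPainting (i + 1) dist pe Q br ty D base col col' := by
  refine ⟨fun j hj h => ?_, fun e he => P.other e fun j hj => he j (by omega)⟩
  by_cases e : j = i
  · subst e
    exact (h hD).elim
  · exact P.tree j (by omega) h

/-- Distinct vertices have distinct parent edges, so this write spoils no colour assigned earlier in
the pass. -/
theorem IsPainting.step {i c : ℕ} {col' : ℕ → ℕ} (T : IsTree n m E₀ E₁ s h t dist par pe Q)
    (P : IsPainting i dist pe Q br ty D base col col') (hi : i < t) (hs : s ∈ D) (hD : Q i ∉ D)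
    (hc : c = if ty (br (Q i)) = 0 then Q i
      else base + 2 * (dist (Q i) - dist (br (Q i))) + ty (br (Q i))) :
    IsPainting (i + 1) dist pe Q br ty D base col (Function.update col' (pe (Q i) - 1) c) := by
  have hQs : ∀ {j}, Q j ∉ D → Q j ≠ s := fun h e => h (e ▸ hs)
  have hpos := T.pe_pos _ (T.Q_lt i hi) (hQs hD)
  refine ⟨fun j hj h => ?_, fun e he => ?_⟩
  · by_cases e : j = i
    · subst e
      rw [Function.update_self, hc]
    · rw [Function.update_of_ne, P.tree j (by omega) h]
      intro hpe
      have h1 := T.pe_pos _ (T.Q_lt j (by omega)) (hQs h)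
      have h2 := T.pe_inj (T.Q_lt j (by omega)) (T.Q_lt i hi) (hQs h) (hQs hD) (by omega)
      exact e (T.Q_inj j (by omega) i hi h2)
  · rw [Function.update_of_ne, P.other e fun j hj => he j (by omega)]
    have := he i (by omega) hD
    omega

theorem tree_runs (T : IsTree n m E₀ E₁ s h t dist par pe Q) (htn : t ≤ n)
    (hB : base + 2 * h + n + 3 ≤ B) {σ : State} (hσ : σ.Bdd B)
    (hh : HasPhase n m E₀ E₁ t dist par pe Q k base σ)
    (F : IsBranching n s par D (σ.mem 10)) (hty : ∀ x, σ.mem 11 x ≤ 2) :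
    Runs B (.assign 2 (.lit 0) ;; .loop (.lt (.var 2) (.var 8)) treeBody) (2 + (t * 100 + 3))
      (fun τ => HasPhase n m E₀ E₁ t dist par pe Q k base τ ∧
        τ.mem 11 = σ.mem 11 ∧ τ.mem 12 = σ.mem 12 ∧
        IsPainting t dist pe Q (σ.mem 10) (σ.mem 11) D base (σ.mem 2) (τ.mem 2)) σ := by
  let I : ℕ → State → Prop := fun i τ => τ.reg 2 = i ∧
    HasPhase n m E₀ E₁ t dist par pe Q k base τ ∧ τ.mem 10 = σ.mem 10 ∧
    τ.mem 11 = σ.mem 11 ∧ τ.mem 12 = σ.mem 12 ∧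
    IsPainting i dist pe Q (σ.mem 10) (σ.mem 11) D base (σ.mem 2) (τ.mem 2)
  refine Runs.seq (((Runs.of_wp hσ (Q := I 0) ?_).mono le_rfl fun τ hτ hI =>
    (Runs.forUp (y := 8) (N := t) (c := treeBody.time) I (fun i τ h => ⟨h.1, h.2.1.reg_eight⟩)
      ?_ (Nat.zero_le t) hτ hI).mono ?_ ?_))
  · obtain ⟨a1, a2, a3, a4, a5, a6, a7, a8, a9, a10, a11⟩ := hh
    simp [Prog.wp, Expr.Simple, Expr.eval, I]
    exact ⟨by constructor <;> simpa, by simp, by simp⟩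
  · rintro i τ hτ ⟨r2, ⟨a1, a2, a3, a4, a5, a6, a7, a8, a9, a10, a11⟩, hb, hty', hmk, P⟩ hi
    refine Runs.of_wp hτ ?_
    have hQ := T.Q_lt i hi
    have hbr := F.eq_iff T hQ
    have hd := T.dist_le _ hQ
    have ht2 := hty (σ.mem 10 (Q i))
    simp only [treeBody, Prog.wp, Expr.Simple, Expr.eval, State.reg_setReg, State.mem_setReg,
      State.reg_setMem, State.mem_setMem, Test.Holds, r2, a1, a5, a8, a10, a11, I, hb, hty']
    simp [hbr]
    refine ⟨by omega, fun hD => ⟨by constructor <;> simpa, hmk, P.skip hD⟩,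
      fun hD => ⟨fun h0 => ⟨by constructor <;> simpa, hmk, ?_⟩,
      fun h0 => ⟨by omega, by constructor <;> simpa, hmk, ?_⟩⟩⟩
    · exact P.step T hi F.root_mem hD (by rw [if_pos h0])
    · exact P.step T hi F.root_mem hD (by rw [if_neg h0]; omega)
  · simp only [treeBody, Prog.time, Expr.cost, Test.cost]
    omega
  · rintro τ _ ⟨_, h1, h2, h3, h4, h5⟩
    exact ⟨h1, h3, h4, h5⟩

/-! #### The whole phase -/

/-- Invariant of the phases: `k` of them remain. -/
structure IsStage (n m : ℕ) (E₀ E₁ : ℕ → ℕ) (s h t : ℕ) (dist par pe Q : ℕ → ℕ) (k : ℕ)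
    (σ : State) : Prop where
  -- The remaining phases use `∑ (2 * j + 1)` colours over `1 ≤ j ≤ k`, which is `k * (k + 2)`.
  -- Colours start from `n`, as the smaller ones are reserved for bridges.
  base_eq : σ.reg 16 + k * (k + 2) = n + h * (h + 2)
  phase : HasPhase n m E₀ E₁ t dist par pe Q k (σ.reg 16) σ
  part : IsPartial n m E₀ E₁ s par (σ.mem 2) {v | σ.mem 12 v = 1} (σ.reg 16)
  mem_of_dist : ∀ v < n, dist v + k ≤ h → v ∈ {v | σ.mem 12 v = 1}
  ty_n : σ.mem 11 n = 2
  ty_le : ∀ x, σ.mem 11 x ≤ 2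

theorem phase_runs (T : IsTree n m E₀ E₁ s h t dist par pe Q) (htn : t ≤ n)
    (hE : ∀ i < m, E₀ i < n ∧ E₁ i < n) (hB : 3 * (n + h * (h + 2)) + m + 10 ≤ B) {σ : State}
    (hσ : σ.Bdd B) (hS : IsStage n m E₀ E₁ s h t dist par pe Q (k + 1) σ) :
    Runs B phase (300 * n + 200 * m + 100) (IsStage n m E₀ E₁ s h t dist par pe Q k) σ := by
  classical
  obtain ⟨hbase, hh, P, hk, hn, hle⟩ := hS
  generalize hbs : σ.reg 16 = base at *
  generalize hDD : {v | σ.mem 12 v = 1} = D at *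
  have hbase' : base + (k * k + 4 * k + 3) = n + h * (h + 2) := by rw [← hbase]; ring
  have hh2 : h ≤ h * (h + 2) := Nat.le_mul_of_pos_right h (by omega)
  have hkk : k ≤ k * k + 4 * k + 3 := by nlinarith
  refine Runs.mono (t := (2 + (t * 100 + 3)) + ((2 + (m * 100 + 3)) + ((2 + (m * 100 + 3)) +
    ((2 + (t * 100 + 3)) + ((2 + (t * 100 + 3)) + 50))))) (Runs.seq ((label_runs T (by omega) hσ hh
    hDD.symm P.root_mem P.par_mem P.lt_of_mem hn hle htn).mono le_rfl ?_)) (by omega)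
    (fun _ _ h => h)
  rintro τ₁ hτ₁ ⟨hh₁, hc₁, F₁, Y₁⟩
  refine Runs.seq ((paint_runs (by omega) hτ₁ hh₁).mono le_rfl ?_)
  rintro τ₂ hτ₂ ⟨hh₂, hc₂, hb₂, ht₂, hm₂⟩
  rw [← hb₂] at F₁
  rw [← hb₂, ← ht₂, ← hm₂] at Y₁
  refine Runs.seq ((type_runs T (by omega) hE hτ₂ hh₂ Y₁).mono le_rfl ?_)
  rintro τ₃ hτ₃ ⟨hh₃, hc₃, hb₃, Y₃⟩
  rw [← hb₃] at F₁
  refine Runs.seq ((mark_runs T (by omega) hτ₃ hh₃ F₁ rfl Y₃.lt_of_mem).mono le_rfl ?_)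
  rintro τ₄ hτ₄ ⟨hh₄, hc₄, hb₄, ht₄, K₄⟩
  rw [← hb₄] at F₁
  refine Runs.seq ((tree_runs T htn (by omega) hτ₄ hh₄ F₁ (ht₄ ▸ Y₃.ty_le)).mono le_rfl ?_)
  rintro τ₅ hτ₅ ⟨hh₅, ht₅, hm₅, P₅⟩
  rw [← hb₄, ← ht₄] at Y₃
  rw [← hm₅] at K₄
  rw [← hb₃, ← hb₄] at hb₂
  -- An edge that is not a tree edge outside of `D` keeps what the painting pass gave it; the others
  -- are described by the last pass.
  have R : IsRecolouring n m E₀ E₁ dist pe (τ₄.mem 10) (τ₄.mem 11) D base (σ.mem 2)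
      (τ₅.mem 2) := by
    have hout : ∀ i < m, (∀ v < n, v ∉ D → pe v ≠ i + 1) → τ₅.mem 2 i =
        if E₀ i ∈ D ∧ E₁ i ∈ D then σ.mem 2 i else base := by
      intro i hi htree
      rw [P₅.other i fun j hj => htree _ (T.Q_lt j hj), hc₄, hc₃, hc₂ i hi, ← hb₂, hc₁]
      simp only [F₁.eq_iff T (hE i hi).1, F₁.eq_iff T (hE i hi).2]
    refine ⟨fun v hv hD => ?_, fun i hi htree h0 h1 => ?_, fun i hi htree h => ?_⟩
    · obtain ⟨j, hj, rfl⟩ := T.Q_surj v hv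
      exact P₅.tree j hj hD
    · rw [hout i hi htree, if_pos ⟨h0, h1⟩]
    · rw [hout i hi htree, if_neg h]
  have P' := P.step F₁ T Y₃ K₄ R hE hk
  have hk' := K₄.mem_of_dist F₁ T Y₃ hk
  obtain ⟨a1, a2, a3, a4, a5, a6, a7, a8, a9, a10, a11⟩ := hh₅
  refine (Runs.of_wp hτ₅ (p := .assign 16 (.add (.var 16) (.add (.add (.var 15) (.var 15))
    (.lit 1))) ;; .assign 15 (.sub (.var 15) (.lit 1))) ?_).mono ?_ fun _ _ h => h
  · simp [Prog.wp, Expr.Simple, Expr.eval, a4, a5]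
    have e : base + (k + 1 + (k + 1) + 1) = base + 2 * (k + 1) + 1 := by ring
    refine ⟨by omega, ⟨?_, by constructor <;> simp [a1, a2, a3, a6, a7, a8, a9, a10, a11], ?_, ?_, ?_, ?_⟩⟩
    · simp
      rw [← hbase]
      ring
    · simpa [e] using P'
    · simpa using hk'
    · simpa [ht₅] using Y₃.ty_n
    · simpa [ht₅] using Y₃.ty_le
  · simp [Prog.time, Expr.cost]

end Phase

end Rainbow

namespace Rainbow

/-! ### The programs -/

/-- All phases, from the tree that the last search has found. -/
def phases : Prog :=
  -- Initially `D` is the root, branch `n` has type 2, the next free colour is `n`, and as many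
  -- phases remain as the height of the tree.
  (.write 12 (.var 4) (.lit 1) ;; .write 11 (.var 0) (.lit 2) ;;
    .assign 16 (.var 0) ;; .assign 15 (.var 11)) ;;
  .loop (.lt (.lit 0) (.var 15)) phase

/-- Compare the source `reg 14` with the best one. -/
def centreBody : Prog :=
  .assign 4 (.var 14) ;; search ;;
  (.ite (.lt (.var 11) (.var 12)) (.assign 12 (.var 11) ;; .assign 13 (.var 14)) .skip ;;
    .assign 14 (.add (.var 14) (.lit 1)))

/-- Find a tree of least height. -/
def centre : Prog :=
  -- The search from `0` supplies a first value to compare with. Only the best source is remembered,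
  -- so its tree is rebuilt at the end.
  .assign 4 (.lit 0) ;; search ;;
  (.assign 12 (.var 11) ;; .assign 13 (.lit 0) ;; .assign 14 (.lit 0)) ;;
  .loop (.lt (.var 14) (.var 0)) centreBody ;;
  .assign 4 (.var 13) ;; search

/-- Colour the graph, starting from the vertex `0`. -/
def colourFromVertex : Prog := build ;; .assign 4 (.lit 0) ;; search ;; phases

/-- Colour the graph, starting from a central vertex. -/
def colourFromCentre : Prog := build ;; centre ;; phases

/-- A rainbow colouring with the colours below `n + h * (h + 2)`, where colours below `n` are used
for bridges only. -/
structure IsResult (n m : ℕ) (E₀ E₁ : ℕ → ℕ) (h : ℕ) (col : ℕ → ℕ) : Prop where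
  rainbow : ∀ u < n, ∀ v < n, ∃ L, Trail m E₀ E₁ u v L ∧ (L.map col).Nodup
  colour : ∀ i < m, col i < n + h * (h + 2) ∧ (col i < n → IsCut m E₀ E₁ i)

/-- Some vertex has distance at least `k` from `s`. -/
def IsFar (n m : ℕ) (E₀ E₁ : ℕ → ℕ) (s k : ℕ) : Prop :=
  ∃ v < n, ∀ L, Trail m E₀ E₁ s v L → k ≤ L.length

theorem IsFar.mono {n m s k l : ℕ} {E₀ E₁ : ℕ → ℕ} (h : IsFar n m E₀ E₁ s k) (hl : l ≤ k) :
    IsFar n m E₀ E₁ s l := by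
  obtain ⟨v, hv, hL⟩ := h
  exact ⟨v, hv, fun L ht => hl.trans (hL L ht)⟩

section

variable {n m s h t B : ℕ} {E₀ E₁ dist par pe Q : ℕ → ℕ}

theorem IsTree.exists_trail (T : IsTree n m E₀ E₁ s h t dist par pe Q) :
    ∀ v < n, ∃ L, Trail m E₀ E₁ s v L ∧ L.length = dist v := by
  refine T.tree_induction ⟨[], .nil s, by simp [T.dist_root]⟩ ?_
  rintro v hv hs ⟨L, hL, hd⟩
  refine ⟨L ++ [pe v - 1], hL.append (.cons (T.link v hv hs).symm (.nil v)), ?_⟩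
  simp [hd, T.dist_par v hv hs]

theorem IsShortest.dist_le_length (S : IsShortest n m E₀ E₁ h dist) {u v : ℕ} {L : List ℕ}
    (hL : Trail m E₀ E₁ u v L) : dist v ≤ dist u + L.length := by
  induction hL with
  | nil u => simp
  | cons hl _ ih =>
    have := S.dist_le _ _ _ hl
    rw [List.length_cons]
    omega

/-- Depth grows by at most one per edge, so no walk reaches a deepest vertex in fewer than `h`
steps. -/
theorem IsTree.isFar (T : IsTree n m E₀ E₁ s h t dist par pe Q)
    (S : IsShortest n m E₀ E₁ h dist) : IsFar n m E₀ E₁ s h := by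
  obtain ⟨v, hv, e⟩ := S.height
  refine ⟨v, hv, fun L hL => ?_⟩
  have := S.dist_le_length hL
  rw [T.dist_root] at this
  omega

theorem IsTree.t_le (T : IsTree n m E₀ E₁ s h t dist par pe Q) : t ≤ n := by
  have := Finset.card_le_card_of_injOn (s := Finset.range t) (t := Finset.range n) Q
    (fun j hj => by simpa using T.Q_lt j (by simpa using hj))
    (fun j hj k hk e => T.Q_inj j (by simpa using hj) k (by simpa using hk) e)
  simpa using this

theorem phases_runs (hE : ∀ i < m, E₀ i < n ∧ E₁ i < n) (hne : ∀ i < m, E₀ i ≠ E₁ i)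
    (hB : 3 * (n + h * (h + 2)) + m + 10 ≤ B) {σ : State} (hσ : σ.Bdd B)
    (hg : HasLists n m E₀ E₁ σ) (hT : HasTree n m E₀ E₁ s h σ)
    (hty : σ.mem 11 = fun _ => 0) (hmk : σ.mem 12 = fun _ => 0) :
    Runs B phases (100 + h * (300 * n + 200 * m + 103))
      (fun τ => IsResult n m E₀ E₁ h (τ.mem 2)) σ := by
  obtain ⟨T, -, -, h4, h11⟩ := hT
  obtain ⟨⟨g0, g1, g2, g3⟩, -, -⟩ := hg
  generalize h8 : σ.reg 8 = t at T
  generalize h6 : σ.mem 6 = dist at T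
  generalize h7 : σ.mem 7 = par at T
  generalize h8' : σ.mem 8 = pe at T
  generalize h9 : σ.mem 9 = Q at T
  refine ((Runs.of_wp hσ (Q := IsStage n m E₀ E₁ s h t dist par pe Q h) ?_).mono le_rfl
    (Q' := fun τ => Runs B (.loop (.lt (.lit 0) (.var 15)) phase)
      (h * (3 + (300 * n + 200 * m + 100)) + 3) _ τ) fun τ hτ hI => ?_).seq.mono ?_
      fun _ _ h => h
  · have hs : {v | Function.update (fun _ => 0) s 1 v = 1} = ({s} : Set ℕ) := by
      ext v
      by_cases hv : v = s <;> simp [hv]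
    have hs1 := T.root_lt
    simp [Prog.wp, Expr.Simple, Expr.eval, h4, g0]
    refine ⟨by omega, by omega, ⟨by simp [h11], by constructor <;> simp [*], ?_, ?_, ?_, ?_⟩⟩
    · simp [hmk, hs]
      refine ⟨by simpa, by simp, by simp, le_rfl, ?_, ?_⟩
      · rintro u rfl v rfl
        exact .refl _
      -- An edge with both ends at the root would be a loop.
      · rintro i hi h0 h1
        exact (hne i hi (h0.trans h1.symm)).elim
    · intro v hv hd
      simp [hmk, hs]
      by_contra hvs
      have := T.dist_par v hv hvs
      omega
    · simp
    · intro x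
      simp [Function.update_apply, hty]
      split <;> omega
  · refine (Runs.forDown (x := 15) (fun k τ => IsStage n m E₀ E₁ s h t dist par pe Q k τ)
      (fun k τ hI => hI.phase.reg_fifteen)
      (fun k τ hτ hI => phase_runs T T.t_le hE hB hτ hI) hτ hI).mono le_rfl ?_
    rintro υ hυ ⟨hb, -, P, hk, -, -⟩
    -- With no phase left, the depth condition holds for every vertex.
    have hall : ∀ v < n, v ∈ {v | υ.mem 12 v = 1} := fun v hv => hk v hv (T.dist_le v hv)
    refine ⟨fun u hu v hv => ?_, fun i hi => ?_⟩
    · obtain ⟨L, hL, hn, -⟩ := P.rainbow u (hall u hu) v (hall v hv)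
      exact ⟨L, hL, hn⟩
    · obtain ⟨h1, h2⟩ := P.colour i hi (hall _ (hE i hi).1) (hall _ (hE i hi).2)
      exact ⟨by omega, fun h => (h2 h).2⟩
  · simp only [Prog.time, Expr.cost]
    ring_nf
    omega

theorem centre_runs {p : ℕ} (hE : ∀ i < m, E₀ i < n ∧ E₁ i < n) (hc : IsLinked n m E₀ E₁)
    (hn : 0 < n) (hB : 2 * n + m + p + 5 ≤ B) {σ : State} (hσ : σ.Bdd B)
    (hl : HasLists n m E₀ E₁ σ) (h5 : σ.reg 5 = p) :
    Runs B centre ((n + 2) * (200 * (2 * m + n) + 200)) (fun τ => HasLists n m E₀ E₁ τ ∧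
      (∃ s h, HasTree n m E₀ E₁ s h τ ∧ ∀ v < n, IsFar n m E₀ E₁ v h) ∧
      τ.mem 11 = σ.mem 11 ∧ τ.mem 12 = σ.mem 12) σ := by
  -- Register 12 bounds from above the distances from the remembered source, and from below the
  -- eccentricity of every source already tried.
  let I : ℕ → State → Prop := fun i τ => τ.reg 14 = i ∧ HasLists n m E₀ E₁ τ ∧
    τ.reg 5 = p + 1 + i ∧ τ.reg 13 < n ∧
    (∀ v < n, ∃ L, Trail m E₀ E₁ (τ.reg 13) v L ∧ L.length ≤ τ.reg 12) ∧
    (∀ v < i, IsFar n m E₀ E₁ v (τ.reg 12)) ∧ τ.mem 11 = σ.mem 11 ∧ τ.mem 12 = σ.mem 12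
  have htrail : ∀ {s h : ℕ} {τ : State}, HasTree n m E₀ E₁ s h τ →
      ∀ v < n, ∃ L, Trail m E₀ E₁ s v L ∧ L.length ≤ h := by
    intro s h τ hT v hv
    obtain ⟨L, hL, e⟩ := hT.tree.exists_trail v hv
    exact ⟨L, hL, e ▸ hT.tree.dist_le v hv⟩
  -- There are `n + 2` searches: the initial one, one per vertex, and the final one.
  refine Runs.mono (t := 2 + ((100 * (2 * m + n) + 100) + (6 + ((n * (3 + (2 +
    ((100 * (2 * m + n) + 100) + 20))) + 3) + (2 + (100 * (2 * m + n) + 100))))))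
    (Q := _) ?_ (by nlinarith) fun _ _ h => h
  refine (Runs.seq (Q := fun τ => HasLists n m E₀ E₁ τ ∧
      (∃ s h, HasTree n m E₀ E₁ s h τ ∧ ∀ v < n, IsFar n m E₀ E₁ v h) ∧
      τ.mem 11 = σ.mem 11 ∧ τ.mem 12 = σ.mem 12) (((Runs.of_wp hσ (Q := fun τ =>
    HasLists n m E₀ E₁ τ ∧ τ.reg 4 = 0 ∧ τ.reg 5 = p ∧ τ.mem 11 = σ.mem 11 ∧
      τ.mem 12 = σ.mem 12) ?_).mono le_rfl ?_)))
  · obtain ⟨⟨g0, g1, g2, g3⟩, hA, hs⟩ := hl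
    simp [Prog.wp, Expr.Simple, Expr.eval, h5]
    exact ⟨by constructor <;> simpa, by simpa, by simpa⟩
  rintro τ₁ hτ₁ ⟨hl₁, h4₁, h5₁, a₁, b₁⟩
  refine Runs.seq ((search_runs hE hc (by omega) hτ₁ hl₁ h5₁ (by omega) h4₁ hn).mono le_rfl ?_)
  rintro τ₂ hτ₂ ⟨hl₂, ⟨h₂, hT₂⟩, h5₂, ⟨-, c₂, d₂⟩⟩
  refine Runs.seq ((Runs.of_wp hτ₂ (Q := I 0) ?_).mono (by simp [Prog.time, Expr.cost]) ?_)
  · obtain ⟨⟨g0, g1, g2, g3⟩, hA, hs⟩ := hl₂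
    simp [Prog.wp, Expr.Simple, Expr.eval, I]
    refine ⟨⟨by constructor <;> simpa, by simpa, by simpa⟩, by omega, hn, ?_, c₂.trans a₁,
      d₂.trans b₁⟩
    rw [hT₂.reg_height]
    exact htrail hT₂
  intro τ₃ hτ₃ hI₃
  refine Runs.seq ((Runs.forUp (x := 14) (y := 0) I (fun i τ h => ⟨h.1, h.2.1.reg_zero⟩) ?_
    (Nat.zero_le n) hτ₃ hI₃).mono le_rfl ?_)
  · rintro i τ hτ ⟨h14, hl, h5, h13, htr, hfar, a, b⟩ hi
    refine Runs.seq ((Runs.of_wp hτ (Q := fun τ' => I i τ' ∧ τ'.reg 4 = i) ?_).mono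
      (by simp [Prog.time, Expr.cost]) ?_)
    · obtain ⟨⟨g0, g1, g2, g3⟩, hA, hs⟩ := hl
      simp [Prog.wp, Expr.Simple, Expr.eval, I, h14]
      exact ⟨⟨by constructor <;> simpa, by simpa, by simpa⟩, h5, h13, htr, hfar, a, b⟩
    rintro υ hυ ⟨⟨h14, hl, h5, h13, htr, hfar, a, b⟩, h4⟩
    refine Runs.seq ((search_runs hE hc (by omega) hυ hl h5 (by omega) h4 hi).mono le_rfl ?_)
    rintro ω hω ⟨hl', ⟨h', hT'⟩, h5', ⟨hr, c', d'⟩⟩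
    have h12 := hr 12 (by omega)
    have h13' := hr 13 (by omega)
    have h14' := hr 14 (by omega)
    have hfar' := hT'.tree.isFar hT'.shortest
    have h11 := hT'.reg_height
    refine (Runs.of_wp hω ?_).mono (by simp [Prog.time, Expr.cost, Test.cost]) fun _ _ h => h
    obtain ⟨⟨g0, g1, g2, g3⟩, hA, hs⟩ := hl'
    simp [Prog.wp, Expr.Simple, Expr.eval, Test.Holds, I, h12, h13', h14', h11, h14]
    refine ⟨fun hlt => ⟨by omega, ⟨by constructor <;> simpa, by simpa, by simpa⟩, by omega, hi,
      htrail hT', fun v hv => ?_, c'.trans a, d'.trans b⟩,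
      fun hge => ⟨by omega, ⟨by constructor <;> simpa, by simpa, by simpa⟩, by omega, h13,
      htr, fun v hv => ?_, c'.trans a, d'.trans b⟩⟩
    · by_cases e : v = i
      · exact e ▸ hfar'
      · exact (hfar v (by omega)).mono hlt.le
    · by_cases e : v = i
      · exact e ▸ hfar'.mono hge
      · exact hfar v (by omega)
  rintro τ₄ hτ₄ ⟨h14, hl, h5, h13, htr, hfar, a, b⟩
  refine Runs.seq ((Runs.of_wp hτ₄ (Q := fun τ' => I n τ' ∧ τ'.reg 4 = τ'.reg 13) ?_).mono
    (by simp [Prog.time, Expr.cost]) ?_)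
  · obtain ⟨⟨g0, g1, g2, g3⟩, hA, hs⟩ := hl
    simp [Prog.wp, Expr.Simple, Expr.eval, I, h14]
    exact ⟨⟨by constructor <;> simpa, by simpa, by simpa⟩, h5, h13, htr, hfar, a, b⟩
  rintro υ hυ ⟨⟨h14, hl, h5, h13, htr, hfar, a, b⟩, h4⟩
  refine (search_runs hE hc (by omega) hυ hl h5 (by omega) h4 h13).mono le_rfl ?_
  rintro ω hω ⟨hl', ⟨h', hT'⟩, h5', ⟨hr, c', d'⟩⟩
  refine ⟨hl', ⟨_, _, hT', fun v hv => (hfar v hv).mono ?_⟩, c'.trans a, d'.trans b⟩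
  -- The deepest vertex of the rebuilt tree is reached by a trail no longer than the recorded
  -- height, so the rebuilt tree is no higher.
  obtain ⟨w, hw, hL⟩ := hT'.tree.isFar hT'.shortest
  obtain ⟨L, hL', hle⟩ := htr w hw
  exact (hL L hL').trans hle

end

end Rainbow

/-! ### The complete programs and their running time -/

namespace Rainbow

theorem colourFromVertex_runs {n m B H : ℕ} {E₀ E₁ : ℕ → ℕ} (hE : ∀ i < m, E₀ i < n ∧ E₁ i < n)
    (hne : ∀ i < m, E₀ i ≠ E₁ i) (hc : IsLinked n m E₀ E₁) (hn : 0 < n)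
    (hH : ∀ h, IsFar n m E₀ E₁ 0 h → h ≤ H)
    (hB : 3 * (n + n * (n + 2)) + 2 * m + 10 ≤ B) {σ : State} (hσ : σ.Bdd B)
    (hg : HasGraph n m E₀ E₁ σ) (hr : ∀ x ≥ 2, σ.reg x = 0) (hm : ∀ a ≥ 2, σ.mem a = fun _ => 0) :
    Runs B colourFromVertex (300 + 300 * m + 100 * n + H * (300 * n + 200 * m + 103))
      (fun τ => ∃ h, IsFar n m E₀ E₁ 0 h ∧ IsResult n m E₀ E₁ h (τ.mem 2)) σ := by
  refine Runs.mono (t := (100 * m + 3) + (2 + ((100 * (2 * m + n) + 100) +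
    (100 + H * (300 * n + 200 * m + 103))))) (Runs.seq ((build_runs (by omega) hσ hg
      (hr 2 le_rfl) (hr 3 (by omega)) (hm 3 (by omega))).mono le_rfl ?_)) (by omega)
    fun _ _ h => h
  rintro τ₁ hτ₁ ⟨hg₁, hA₁, h5, hs, hty, hmk⟩
  rw [hr 5 (by omega)] at h5
  rw [hm 5 (by omega)] at hs
  rw [hm 11 (by omega)] at hty
  rw [hm 12 (by omega)] at hmk
  refine Runs.seq ((Runs.of_wp hτ₁ (Q := fun τ => HasLists n m E₀ E₁ τ ∧ τ.reg 4 = 0 ∧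
    τ.reg 5 = 0 ∧ (τ.mem 11 = fun _ => 0) ∧ τ.mem 12 = fun _ => 0) ?_).mono le_rfl ?_)
  · obtain ⟨g0, g1, g2, g3⟩ := hg₁
    simp [Prog.wp, Expr.Simple, Expr.eval, h5, hty, hmk]
    exact ⟨by constructor <;> simpa, by simpa, by simp [hs]⟩
  rintro τ₂ hτ₂ ⟨hl₂, h4₂, h5₂, hty₂, hmk₂⟩
  refine Runs.seq ((search_runs hE hc (by omega) hτ₂ hl₂ h5₂ (by omega) h4₂ hn).mono le_rfl ?_)
  rintro τ₃ hτ₃ ⟨hl₃, ⟨h, hT⟩, -, -, c, d⟩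
  have hfar := hT.tree.isFar hT.shortest
  have hlt : h * (h + 2) ≤ n * (n + 2) :=
    Nat.mul_le_mul hT.height_lt.le (Nat.add_le_add_right hT.height_lt.le 2)
  refine (phases_runs hE hne (by omega) hτ₃ hl₃ hT (c.trans hty₂) (d.trans hmk₂)).mono ?_
    fun τ _ h' => ⟨h, hfar, h'⟩
  have := Nat.mul_le_mul_right (300 * n + 200 * m + 103) (hH h hfar)
  omega

theorem colourFromCentre_runs {n m B : ℕ} {E₀ E₁ : ℕ → ℕ} (hE : ∀ i < m, E₀ i < n ∧ E₁ i < n)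
    (hne : ∀ i < m, E₀ i ≠ E₁ i) (hc : IsLinked n m E₀ E₁) (hn : 0 < n)
    (hB : 3 * (n + n * (n + 2)) + 2 * m + 10 ≤ B) {σ : State} (hσ : σ.Bdd B)
    (hg : HasGraph n m E₀ E₁ σ) (hr : ∀ x ≥ 2, σ.reg x = 0) (hm : ∀ a ≥ 2, σ.mem a = fun _ => 0) :
    Runs B colourFromCentre (300 + 100 * m + (n + 2) * (200 * (2 * m + n) + 200) +
        n * (300 * n + 200 * m + 103))
      (fun τ => ∃ h, (∀ v < n, IsFar n m E₀ E₁ v h) ∧ IsResult n m E₀ E₁ h (τ.mem 2)) σ := by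
  refine Runs.mono (t := (100 * m + 3) + ((n + 2) * (200 * (2 * m + n) + 200) +
    (100 + n * (300 * n + 200 * m + 103)))) (Runs.seq ((build_runs (by omega) hσ hg
      (hr 2 le_rfl) (hr 3 (by omega)) (hm 3 (by omega))).mono le_rfl ?_)) (by omega)
    fun _ _ h => h
  rintro τ₁ hτ₁ ⟨hg₁, hA₁, h5, hs, hty, hmk⟩
  rw [hr 5 (by omega)] at h5
  rw [hm 5 (by omega)] at hs
  rw [hm 11 (by omega)] at hty
  rw [hm 12 (by omega)] at hmk
  have hn2 : n ≤ n * (n + 2) := Nat.le_mul_of_pos_right n (by omega)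
  refine Runs.seq ((centre_runs (p := 0) hE hc hn (by omega) hτ₁ ⟨hg₁, hA₁, by simp [hs]⟩
    h5).mono le_rfl ?_)
  rintro τ₃ hτ₃ ⟨hl₃, ⟨s, h, hT, hfar⟩, c, d⟩
  have hlt : h * (h + 2) ≤ n * (n + 2) :=
    Nat.mul_le_mul hT.height_lt.le (Nat.add_le_add_right hT.height_lt.le 2)
  refine (phases_runs hE hne (by omega) hτ₃ hl₃ hT (c.trans hty) (d.trans hmk)).mono ?_
    fun τ _ h' => ⟨h, hfar, h'⟩
  have := Nat.mul_le_mul_right (300 * n + 200 * m + 103) hT.height_lt.le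
  omega

/-! ### From arrays to graphs -/

section Graph

variable {n m : ℕ} {G : SimpleGraph (Fin n)} {e : Fin m → Fin n × Fin n}

theorem inputState_mem_zero {i : ℕ} (hi : i < m) : (inputState e).mem 0 i = (e ⟨i, hi⟩).1 := by
  simp [inputState, hi]

theorem inputState_mem_one {i : ℕ} (hi : i < m) : (inputState e).mem 1 i = (e ⟨i, hi⟩).2 := by
  simp [inputState, hi]

theorem IsEdgeList.adj (he : IsEdgeList G e) (i : Fin m) : G.Adj (e i).1 (e i).2 := by
  rw [← SimpleGraph.mem_edgeSet, ← he.2]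
  exact ⟨i, rfl⟩

theorem IsEdgeList.adj_of_link (he : IsEdgeList G e) {i : ℕ} {u v : Fin n}
    (h : Link m ((inputState e).mem 0) ((inputState e).mem 1) i u v) :
    ∃ hi : i < m, s((e ⟨i, hi⟩).1, (e ⟨i, hi⟩).2) = s(u, v) ∧ G.Adj u v := by
  obtain ⟨hi, h⟩ := h
  have ha := he.adj ⟨i, hi⟩
  rw [inputState_mem_zero hi, inputState_mem_one hi] at h
  refine ⟨hi, ?_⟩
  rcases h with ⟨h1, h2⟩ | ⟨h1, h2⟩ <;> rw [Fin.val_inj] at h1 h2 <;> rw [← h1, ← h2]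
  exacts [⟨rfl, ha⟩, ⟨Sym2.eq_swap, ha.symm⟩]

theorem IsEdgeList.exists_link (he : IsEdgeList G e) {u v : Fin n} (h : G.Adj u v) :
    ∃ i, Link m ((inputState e).mem 0) ((inputState e).mem 1) i u v := by
  rw [← SimpleGraph.mem_edgeSet, ← he.2] at h
  obtain ⟨i, hi⟩ := h
  refine ⟨i, i.2, ?_⟩
  rw [inputState_mem_zero i.2, inputState_mem_one i.2]
  simp only [Sym2.eq_iff] at hi
  rcases hi with ⟨h1, h2⟩ | ⟨h1, h2⟩
  · exact .inl ⟨congrArg _ h1, congrArg _ h2⟩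
  · exact .inr ⟨congrArg _ h1, congrArg _ h2⟩

theorem inputState_lt (i : ℕ) (hi : i < m) :
    (inputState e).mem 0 i < n ∧ (inputState e).mem 1 i < n := by
  rw [inputState_mem_zero hi, inputState_mem_one hi]
  exact ⟨Fin.is_lt _, Fin.is_lt _⟩

theorem IsEdgeList.isLinked (he : IsEdgeList G e) (hG : G.Connected) :
    IsLinked n m ((inputState e).mem 0) ((inputState e).mem 1) := by
  rintro S ⟨v, hv, hvn⟩ hS w hw
  obtain ⟨p⟩ := hG.preconnected ⟨v, hvn⟩ ⟨w, hw⟩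
  have key : ∀ {a b : Fin n}, G.Walk a b → (a : ℕ) ∈ S → (b : ℕ) ∈ S := by
    intro a b p
    induction p with
    | nil => exact id
    | cons h _ ih =>
      obtain ⟨i, hi⟩ := he.exists_link h
      exact fun ha => ih (hS i _ _ hi ha)
  exact key p hv

theorem IsEdgeList.exists_trail (he : IsEdgeList G e) {a b : Fin n} (p : G.Walk a b) :
    ∃ L, Trail m ((inputState e).mem 0) ((inputState e).mem 1) a b L ∧ L.length = p.length := by
  induction p with
  | nil => exact ⟨[], .nil _, rfl⟩
  | cons h p ih =>
    obtain ⟨i, hi⟩ := he.exists_link h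
    obtain ⟨L, hL, hl⟩ := ih
    exact ⟨i :: L, .cons hi hL, by simp [hl]⟩

theorem IsEdgeList.exists_walk (he : IsEdgeList G e) {col : Sym2 (Fin n) → ℕ} {c : ℕ → ℕ}
    (hcol : ∀ i : Fin m, col s((e i).1, (e i).2) = c i) {u v : ℕ} {L : List ℕ}
    (hL : Trail m ((inputState e).mem 0) ((inputState e).mem 1) u v L) :
    ∀ a b : Fin n, (a : ℕ) = u → (b : ℕ) = v → ∃ p : G.Walk a b, p.edges.map col = L.map c := by
  induction hL with
  | nil u =>
    rintro a b rfl hb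
    obtain rfl := Fin.val_inj.1 hb
    exact ⟨.nil, rfl⟩
  | @cons i u v w L hl _ ih =>
    rintro a b rfl hb
    have hw : w < n := by
      have := inputState_lt (e := e) i hl.1
      rcases hl.2 with ⟨_, h⟩ | ⟨h, _⟩ <;> omega
    obtain ⟨p, hp⟩ := ih ⟨w, hw⟩ b rfl hb
    obtain ⟨hi, h1, h2⟩ := he.adj_of_link (u := a) (v := ⟨w, hw⟩) hl
    refine ⟨.cons h2 p, ?_⟩
    have := hcol ⟨i, hi⟩
    rw [h1] at this
    simp [hp, this]

/-- The trails found may repeat vertices. Cutting out the detours leaves a sublist of the edges, so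
the colours remain distinct. -/
theorem IsEdgeList.isRainbowColouring (he : IsEdgeList G e) {col : Sym2 (Fin n) → ℕ} {c : ℕ → ℕ}
    (hcol : ∀ i : Fin m, col s((e i).1, (e i).2) = c i)
    (h : ∀ u < n, ∀ v < n, ∃ L, Trail m ((inputState e).mem 0) ((inputState e).mem 1) u v L ∧
      (L.map c).Nodup) : IsRainbowColouring G col := by
  intro u v
  obtain ⟨L, hL, hn⟩ := h u u.2 v v.2
  obtain ⟨p, hp⟩ := he.exists_walk hcol hL u v rfl rfl
  exact ⟨p.bypass, p.bypass_isPath, (hp ▸ hn).sublist (p.edges_bypass_sublist_edges.map col)⟩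

theorem IsEdgeList.le_eccent (he : IsEdgeList G e) {v : Fin n} {k : ℕ}
    (h : IsFar n m ((inputState e).mem 0) ((inputState e).mem 1) v k) : (k : ℕ∞) ≤ G.eccent v := by
  obtain ⟨w, hw, hL⟩ := h
  refine le_trans ?_ (G.edist_le_eccent (u := v) (v := ⟨w, hw⟩))
  refine le_iInf fun p => ?_
  obtain ⟨L, hL', e⟩ := he.exists_trail p
  rw [← e]
  exact_mod_cast hL L hL'

/-- A walk that avoids the edge never changes sides of the cut. -/
theorem IsEdgeList.isBridge (he : IsEdgeList G e) (i : Fin m)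
    (h : IsCut m ((inputState e).mem 0) ((inputState e).mem 1) i) :
    G.IsBridge s((e i).1, (e i).2) := by
  obtain ⟨T, h1, h2⟩ := h
  rw [inputState_mem_zero i.2, inputState_mem_one i.2] at h1
  rw [SimpleGraph.isBridge_iff]
  rintro ⟨p⟩
  have key : ∀ {a b : Fin n}, (G.deleteEdges {s((e i).1, (e i).2)}).Walk a b →
      ((a : ℕ) ∈ T ↔ (b : ℕ) ∈ T) := by
    intro a b p
    induction p with
    | nil => exact Iff.rfl
    | @cons u v w h _ ih =>
      rw [← ih]
      obtain ⟨hadj, hne⟩ := SimpleGraph.deleteEdges_adj.1 h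
      obtain ⟨j, hj⟩ := he.exists_link hadj
      obtain ⟨hjm, hj1, -⟩ := he.adj_of_link hj
      have hji : j ≠ i := by
        rintro rfl
        exact hne hj1.symm
      have := h2 j hjm hji
      rcases hj.2 with ⟨e0, e1⟩ | ⟨e0, e1⟩
      · rwa [e0, e1] at this
      · rw [e0, e1] at this
        exact this.symm
  exact h1 (key p)

theorem IsEdgeList.ncard_edgeSet (he : IsEdgeList G e) : G.edgeSet.ncard = m := by
  rw [← he.2, ← Set.image_univ, Set.ncard_image_of_injective _ he.1, Set.ncard_univ, Nat.card_fin]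

theorem IsEdgeList.le (he : IsEdgeList G e) : m ≤ n * n := by
  have h : Function.Injective e := fun i j h => he.1 (by simp only [h])
  simpa using Fintype.card_le_of_injective e h

theorem IsEdgeList.le_add_one (he : IsEdgeList G e) (hG : G.Connected) : n ≤ m + 1 := by
  have := hG.card_vert_le_card_edgeSet_add_one
  rwa [Nat.card_fin, Nat.card_coe_set_eq, he.ncard_edgeSet] at this

/-- The outcome of a program that colours every connected graph. -/
theorem IsEdgeList.rainbowColours (he : IsEdgeList G e) (hG : G.Connected) {p : Prog} {T K w : ℕ}
    (hp : p.weight ≤ 2000) (hK : K = 3 * (n + n * (n + 2)) + 2 * m + 10) (hw : 17 ≤ w)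
    {P : ℕ → Prop}
    (h : Runs K p T (fun τ => ∃ h, P h ∧
      IsResult n m ((inputState e).mem 0) ((inputState e).mem 1) h (τ.mem 2)) (inputState e)) :
    ∃ k h, RainbowColours p ((n + 2) ^ w) T G e k ∧ P h ∧ k ≤ h * (h + 2) + numBridges G := by
  have hn : 0 < n := Fin.pos_iff_nonempty.2 hG.nonempty
  have hm := he.le
  -- The exponent 17 is `14 + 3`: the stored numbers are cubic in `n + 2`, and the constant `20000`
  -- is below `3 ^ 14`, where `3 ≤ n + 2`.
  have hW : p.weight * (K + 1) ≤ (n + 2) ^ w := by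
    have h1 : K + 1 ≤ 10 * (n + 2) ^ 3 := by rw [hK]; nlinarith [Nat.zero_le (n ^ 3)]
    calc p.weight * (K + 1) ≤ 2000 * (10 * (n + 2) ^ 3) := Nat.mul_le_mul hp h1
      _ = 20000 * (n + 2) ^ 3 := by ring
      _ ≤ (n + 2) ^ 14 * (n + 2) ^ 3 := by
        refine Nat.mul_le_mul_right _ ?_
        calc 20000 ≤ 3 ^ 14 := by norm_num
          _ ≤ (n + 2) ^ 14 := Nat.pow_le_pow_left (by omega) 14
      _ = (n + 2) ^ 17 := by ring
      _ ≤ (n + 2) ^ w := Nat.pow_le_pow_right (by omega) hw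
  obtain ⟨t, ht, τ, hx, -, h, hP, hR⟩ := h _ hW
  let col : Sym2 (Fin n) → ℕ := Function.extend (fun i : Fin m => s((e i).1, (e i).2))
    (fun i => τ.mem 2 i) 0
  have hcol : ∀ i : Fin m, col s((e i).1, (e i).2) = τ.mem 2 i := fun i =>
    he.1.extend_apply _ _ i
  refine ⟨_, h, ⟨t, ht, τ, hx, col, hcol, he.isRainbowColouring hcol hR.rainbow, rfl⟩, hP, ?_⟩
  -- Colours from `n` on lie in an interval of `h * (h + 2)` numbers; the smaller ones occur on
  -- bridges only and are counted by these.
  have hsub : col '' G.edgeSet ⊆ Set.Ico n (n + h * (h + 2)) ∪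
      col '' {e | e ∈ G.edgeSet ∧ G.IsBridge e} := by
    rintro _ ⟨x, hx, rfl⟩
    have hx' := hx
    rw [← he.2] at hx
    obtain ⟨i, rfl⟩ := hx
    obtain ⟨h1, h2⟩ := hR.colour i i.2
    by_cases hlt : τ.mem 2 i < n
    · exact .inr ⟨_, ⟨hx', he.isBridge i (h2 hlt)⟩, rfl⟩
    · left
      simp only [hcol]
      exact ⟨by omega, h1⟩
  refine (Set.ncard_le_ncard hsub (Set.toFinite _)).trans ((Set.ncard_union_le _ _).trans ?_)
  refine Nat.add_le_add ?_ (Set.ncard_image_le (Set.toFinite _))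
  rw [Set.ncard_eq_toFinset_card']
  simp

theorem inputState_bdd {B : ℕ} (hB : n + m ≤ B) : (inputState e).Bdd B := by
  refine ⟨fun x => ?_, fun a i => ?_⟩
  · simp only [inputState]
    split_ifs <;> omega
  · simp only [inputState]
    split_ifs with hi
    · have := (e ⟨i, hi⟩).1.2
      omega
    · have := (e ⟨i, hi⟩).2.2
      omega
    · omega
    · omega

theorem inputState_hasGraph :
    HasGraph n m ((inputState e).mem 0) ((inputState e).mem 1) (inputState e) :=
  ⟨by simp [inputState], by simp [inputState], rfl, rfl⟩

theorem inputState_reg {x : ℕ} (hx : x ≥ 2) : (inputState e).reg x = 0 := by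
  simp only [inputState]
  split_ifs <;> omega

theorem inputState_mem {a : ℕ} (ha : a ≥ 2) : (inputState e).mem a = fun _ => 0 := by
  funext i
  simp only [inputState]
  split_ifs <;> omega

theorem IsEdgeList.ne (he : IsEdgeList G e) (i : ℕ) (hi : i < m) :
    (inputState e).mem 0 i ≠ (inputState e).mem 1 i := by
  rw [inputState_mem_zero hi, inputState_mem_one hi, Ne, Fin.val_inj]
  exact (he.adj ⟨i, hi⟩).ne

/-- Colouring from a vertex. -/
theorem IsEdgeList.colourFromVertex (he : IsEdgeList G e) (hG : G.Connected) :
    ∃ k h, RainbowColours colourFromVertex ((n + 2) ^ 17) (2000 * (G.diam * m + 1)) G e k ∧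
      h ≤ G.diam ∧ k ≤ h * (h + 2) + numBridges G := by
  have hn : 0 < n := Fin.pos_iff_nonempty.2 hG.nonempty
  have := hG.nonempty
  have htop : G.ediam ≠ ⊤ := SimpleGraph.connected_iff_ediam_ne_top.1 hG
  have hH : ∀ h, IsFar n m ((inputState e).mem 0) ((inputState e).mem 1) 0 h → h ≤ G.diam := by
    intro h hfar
    have h1 := (he.le_eccent (v := ⟨0, hn⟩) hfar).trans SimpleGraph.eccent_le_ediam
    simpa [SimpleGraph.diam] using ENat.toNat_le_toNat h1 htop
  refine he.rainbowColours hG (by decide) rfl le_rfl ((colourFromVertex_runs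
    (H := G.diam) inputState_lt he.ne (he.isLinked hG) hn hH le_rfl (inputState_bdd (by omega))
    inputState_hasGraph (fun x => inputState_reg) (fun a => inputState_mem)).mono ?_
      fun τ _ ⟨h, h1, h2⟩ => ⟨h, hH h h1, h2⟩)
  have h1 := he.le_add_one hG
  -- Without edges the graph is a single vertex, and the constant summand of the time bound is
  -- needed. Otherwise the diameter is positive and `n ≤ m + 1`, so all terms are absorbed by
  -- `G.diam * m`.
  by_cases hm : m = 0
  · subst hm
    obtain rfl : n = 1 := by omega
    have : G.diam = 0 := by
      rw [SimpleGraph.diam, SimpleGraph.ediam_eq_zero_of_subsingleton, ENat.toNat_zero]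
    rw [this]
    omega
  · have hn2 : 2 ≤ n := by
      by_contra hlt
      have := (e ⟨0, by omega⟩).1.2
      have := (e ⟨0, by omega⟩).2.2
      exact (he.adj ⟨0, by omega⟩).ne (Fin.ext (by omega))
    have hd : 0 < G.diam := by
      have : Nontrivial (Fin n) := Fin.nontrivial_iff_two_le.2 hn2
      have h0 := G.ediam_ne_zero
      rw [Nat.pos_iff_ne_zero, SimpleGraph.diam, Ne, ENat.toNat_eq_zero]
      tauto
    nlinarith

/-- Colouring from a central vertex. -/
theorem IsEdgeList.colourFromCentre (he : IsEdgeList G e) (hG : G.Connected) :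
    ∃ k h, RainbowColours colourFromCentre ((n + 2) ^ 17) (5000 * (n * m + 1)) G e k ∧
      h ≤ G.radius.toNat ∧ k ≤ h * (h + 2) + numBridges G := by
  have hn : 0 < n := Fin.pos_iff_nonempty.2 hG.nonempty
  have := hG.nonempty
  have htop : G.radius ≠ ⊤ := by
    intro h
    have h1 := G.radius_le_ediam
    rw [h, top_le_iff] at h1
    exact SimpleGraph.connected_iff_ediam_ne_top.1 hG h1
  have hH : ∀ h, (∀ v < n, IsFar n m ((inputState e).mem 0) ((inputState e).mem 1) v h) →
      h ≤ G.radius.toNat := by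
    intro h hfar
    -- The height bounds every eccentricity from below, hence also their infimum.
    have h1 : (h : ℕ∞) ≤ G.radius := le_iInf fun v => he.le_eccent (hfar v v.2)
    simpa using ENat.toNat_le_toNat h1 htop
  refine he.rainbowColours hG (by decide) rfl le_rfl ((colourFromCentre_runs
    inputState_lt he.ne (he.isLinked hG) hn le_rfl (inputState_bdd (by omega))
    inputState_hasGraph (fun x => inputState_reg) (fun a => inputState_mem)).mono ?_
      fun τ _ ⟨h, h1, h2⟩ => ⟨h, hH h h1, h2⟩)
  have h1 := he.le_add_one hG
  by_cases hm : m = 0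
  · subst hm
    obtain rfl : n = 1 := by omega
    omega
  · nlinarith [Nat.mul_le_mul_left n h1, Nat.mul_le_mul_left n (show 1 ≤ m by omega)]

end Graph

end Rainbow

namespace Rainbow

/-! ### Lower bounds for the rainbow connection number -/

section Lower

variable {V : Type*} [Finite V] {G : SimpleGraph V}

theorem rc_le_ncard {col : Sym2 V → ℕ} (h : IsRainbowColouring G col) :
    rc G ≤ (col '' G.edgeSet).ncard := by
  let f : col '' G.edgeSet ≃ Fin (col '' G.edgeSet).ncard :=
    Finite.equivFinOfCardEq (Nat.card_coe_set_eq _)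
  classical
  refine Nat.sInf_le ⟨fun e => if he : e ∈ G.edgeSet then f ⟨col e, e, he, rfl⟩ else 0, ?_, ?_⟩
  · intro e he
    simp [he]
  · intro u v
    obtain ⟨p, hp, hn⟩ := h u v
    refine ⟨p, hp, List.Nodup.map_on ?_ hp.edges_nodup⟩
    intro x hx y hy e
    have hx' := p.edges_subset_edgeSet hx
    have hy' := p.edges_subset_edgeSet hy
    simp only [hx', hy', dif_pos, Fin.val_inj, f.apply_eq_iff_eq] at e
    exact List.inj_on_of_nodup_map hn hx hy (congrArg Subtype.val e)

/-- Giving all edges different colours is a rainbow colouring of a connected graph, so the infimum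
is over a nonempty set and is attained. -/
theorem exists_colouring_rc (hG : G.Connected) :
    ∃ col : Sym2 V → ℕ, (∀ e ∈ G.edgeSet, col e < rc G) ∧ IsRainbowColouring G col := by
  have hne : {k | ∃ col : Sym2 V → ℕ, (∀ e ∈ G.edgeSet, col e < k) ∧
      IsRainbowColouring G col}.Nonempty := by
    let f := Finite.equivFin (Sym2 V)
    refine ⟨_, fun e => f e, fun e _ => (f e).2, fun u v => ?_⟩
    obtain ⟨p, hp⟩ := hG.exists_isPath u v
    exact ⟨p, hp, List.Nodup.map (Fin.val_injective.comp f.injective) hp.edges_nodup⟩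
  exact Nat.sInf_mem hne

/-- A rainbow path has at most as many edges as there are colours. -/
theorem ediam_le_rc (hG : G.Connected) : G.ediam ≤ rc G := by
  obtain ⟨col, hc, hr⟩ := exists_colouring_rc hG
  refine SimpleGraph.ediam_le_of_edist_le fun u v => ?_
  obtain ⟨p, hp, hn⟩ := hr u v
  refine (G.edist_le p).trans ?_
  have h := Finset.card_le_card (s := (p.edges.map col).toFinset) (t := Finset.range (rc G)) (by
    intro x hx
    simp only [List.mem_toFinset, List.mem_map] at hx
    obtain ⟨e, he, rfl⟩ := hx
    simpa using hc e (p.edges_subset_edgeSet he))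
  rw [List.toFinset_card_of_nodup hn, List.length_map, SimpleGraph.Walk.length_edges,
    Finset.card_range] at h
  exact_mod_cast h

theorem diam_le_rc (hG : G.Connected) : G.diam ≤ rc G := by
  simpa [SimpleGraph.diam] using ENat.toNat_le_toNat (ediam_le_rc hG) (ENat.natCast_ne_top _)

theorem radius_le_rc (hG : G.Connected) : G.radius.toNat ≤ rc G := by
  have := hG.nonempty
  simpa using ENat.toNat_le_toNat (G.radius_le_ediam.trans (ediam_le_rc hG)) (ENat.natCast_ne_top _)

-- The edge `xy` survives the deletion of the bridge `ab`, so it lies on one side; the end of `ab`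
-- on the other side is the vertex wanted.
omit [Finite V] in
theorem exists_end_of_isBridge {a b x y : V} (h : G.IsBridge s(a, b)) (hxy : G.Adj x y)
    (hne : s(x, y) ≠ s(a, b)) : ∃ u, ∀ v ∈ s(x, y),
      ¬ (G.deleteEdges {s(a, b)}).Reachable u v ∧ u ∈ s(a, b) := by
  have hxy' : (G.deleteEdges {s(a, b)}).Reachable x y :=
    (SimpleGraph.deleteEdges_adj.2 ⟨hxy, hne⟩ : (G.deleteEdges {s(a, b)}).Adj x y).reachable
  rw [SimpleGraph.isBridge_iff] at h
  by_cases hax : (G.deleteEdges {s(a, b)}).Reachable a x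
  · have hbx : ¬ (G.deleteEdges {s(a, b)}).Reachable b x := fun hb => h (hax.trans hb.symm)
    refine ⟨b, fun v hv => ⟨?_, by simp⟩⟩
    rcases Sym2.mem_iff.1 hv with rfl | rfl
    exacts [hbx, fun hb => hbx (hb.trans hxy'.symm)]
  · refine ⟨a, fun v hv => ⟨?_, by simp⟩⟩
    rcases Sym2.mem_iff.1 hv with rfl | rfl
    exacts [hax, fun hb => hax (hb.trans hxy'.symm)]

-- For two bridges take the end of each that is cut off from the other bridge. Every path between
-- these two ends crosses both bridges, so a rainbow path forces different colours.
omit [Finite V] in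
theorem IsRainbowColouring.injOn {col : Sym2 V → ℕ} (h : IsRainbowColouring G col) :
    Set.InjOn col {e | e ∈ G.edgeSet ∧ G.IsBridge e} := by
  rintro e ⟨he, hbe⟩ f ⟨hf, hbf⟩ hef
  by_contra hne
  induction e with | h a b
  induction f with | h x y
  obtain ⟨u, hu⟩ := exists_end_of_isBridge hbe hf (Ne.symm hne)
  obtain ⟨v, hv⟩ := exists_end_of_isBridge hbf he hne
  have hum : u ∈ s(a, b) := (hu x (by simp)).2
  have hvm : v ∈ s(x, y) := (hv a (by simp)).2
  obtain ⟨p, hp, hn⟩ := h u v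
  have h1 : s(a, b) ∈ p.edges := by
    by_contra hp
    exact (hu v hvm).1 ⟨p.toDeleteEdge _ hp⟩
  have h2 : s(x, y) ∈ p.edges := by
    by_contra hp
    exact (hv u hum).1 ⟨(p.toDeleteEdge _ hp).reverse⟩
  exact hne (List.inj_on_of_nodup_map hn h1 h2 hef)

theorem numBridges_le_rc (hG : G.Connected) : numBridges G ≤ rc G := by
  obtain ⟨col, hc, hr⟩ := exists_colouring_rc hG
  have := Set.ncard_le_ncard_of_injOn (t := Set.Iio (rc G)) col
    (fun e he => hc e he.1) hr.injOn (Set.toFinite _)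
  have hcard : (Set.Iio (rc G)).ncard = rc G := by
    rw [Set.ncard_eq_toFinset_card']
    simp
  rwa [hcard] at this

end Lower

/-! ### Maps that do not increase distances -/

section Maps

variable {V W : Type*} {G : SimpleGraph V} {H : SimpleGraph W} {f : V → W}

theorem eccent_le_of_surjective (hf : Function.Surjective f)
    (h : ∀ u v, H.edist (f u) (f v) ≤ G.edist u v) (u : V) : H.eccent (f u) ≤ G.eccent u := by
  refine iSup_le fun w => ?_
  obtain ⟨v, rfl⟩ := hf w
  exact (h u v).trans G.edist_le_eccent

theorem radius_le_of_surjective (hf : Function.Surjective f)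
    (h : ∀ u v, H.edist (f u) (f v) ≤ G.edist u v) : H.radius ≤ G.radius :=
  le_iInf fun u => (iInf_le _ (f u)).trans (eccent_le_of_surjective hf h u)

theorem ediam_le_of_surjective (hf : Function.Surjective f)
    (h : ∀ u v, H.edist (f u) (f v) ≤ G.edist u v) : H.ediam ≤ G.ediam :=
  iSup_le fun w => by
    obtain ⟨u, rfl⟩ := hf w
    exact (eccent_le_of_surjective hf h u).trans G.eccent_le_ediam

end Maps

/-! ### Contraction of the bridges -/

section Contract

variable {V : Type*} {G : SimpleGraph V}

/-- The class of a vertex. -/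
local notation "cls" => SimpleGraph.connectedComponentMk (bridgeGraph G)

theorem bridgeGraph_adj {u v : V} : (bridgeGraph G).Adj u v ↔ G.Adj u v ∧ G.IsBridge s(u, v) := by
  simp only [bridgeGraph, SimpleGraph.fromEdgeSet_adj, Set.mem_ofPred_eq, SimpleGraph.mem_edgeSet]
  exact ⟨fun h => h.1, fun h => ⟨h, h.1.ne⟩⟩

theorem bridgeGraph_le : bridgeGraph G ≤ G := fun _ _ h => (bridgeGraph_adj.1 h).1

theorem cls_eq_iff {u v : V} : cls u = cls v ↔ (bridgeGraph G).Reachable u v :=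
  SimpleGraph.ConnectedComponent.eq

/-- Two vertices of a class are joined by bridges, all but the first one of which avoid the first. -/
theorem exists_first_bridge {u v : V} (h : cls u = cls v) (hne : u ≠ v) :
    ∃ y, (bridgeGraph G).Adj u y ∧ (G.deleteEdges {s(u, y)}).Reachable y v := by
  obtain ⟨p, hp⟩ := (cls_eq_iff.1 h).exists_isPath
  cases p with
  | nil => exact (hne rfl).elim
  | @cons _ y _ h q =>
    refine ⟨y, h, ⟨q.transfer _ fun e he => ?_⟩⟩
    rw [SimpleGraph.Walk.cons_isPath_iff] at hp
    rw [SimpleGraph.edgeSet_deleteEdges]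
    refine ⟨SimpleGraph.edgeSet_mono bridgeGraph_le (q.edges_subset_edgeSet he), ?_⟩
    rintro rfl
    exact hp.2 (q.fst_mem_support_of_mem_edges he)

/-- Bridges that join `u` to `v` stay inside their class and so never touch the vertex `a`. -/
theorem reachable_of_cls {u v a b : V} (h : cls u = cls v) (hne : cls a ≠ cls u) :
    (G.deleteEdges {s(a, b)}).Reachable u v := by
  obtain ⟨q⟩ := cls_eq_iff.1 h
  refine ⟨q.transfer _ fun e he => ?_⟩
  rw [SimpleGraph.edgeSet_deleteEdges]
  refine ⟨SimpleGraph.edgeSet_mono bridgeGraph_le (q.edges_subset_edgeSet he), ?_⟩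
  rintro rfl
  have := q.fst_mem_support_of_mem_edges he
  classical
  exact hne (cls_eq_iff.2 ⟨(q.takeUntil a this).reverse⟩)

/-- An edge inside a class is a bridge. -/
theorem bridgeGraph_adj_of_cls {u v : V} (h : G.Adj u v) (hc : cls u = cls v) :
    (bridgeGraph G).Adj u v := by
  by_contra hb
  -- Otherwise the edge `uv` would bypass the first bridge on the way from `u` to `v`.
  obtain ⟨y, h1, h2⟩ := exists_first_bridge hc h.ne
  have h3 := (bridgeGraph_adj.1 h1).2
  rw [SimpleGraph.isBridge_iff] at h3
  refine h3 (SimpleGraph.Reachable.trans (SimpleGraph.Adj.reachable ?_) h2.symm)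
  refine SimpleGraph.deleteEdges_adj.2 ⟨h, fun e => hb ?_⟩
  rw [Set.mem_singleton_iff, Sym2.congr_right] at e
  exact e ▸ h1

/-- If `u` and `u'` differed, the edge `uv`, bridges from `v` to `v'`, the edge `v'u'` and the rest
of the way back to `y` would bypass the first bridge `uy` from `u` towards `u'`. -/
theorem eq_of_cls_left {u v u' v' : V} (h : G.Adj u v) (h' : G.Adj u' v') (hne : cls u ≠ cls v)
    (hu : cls u = cls u') (hv : cls v = cls v') : u = u' := by
  by_contra hne'
  obtain ⟨y, h1, h2⟩ := exists_first_bridge hu hne'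
  have h3 := (bridgeGraph_adj.1 h1).2
  rw [SimpleGraph.isBridge_iff] at h3
  have hy : cls u = cls y := cls_eq_iff.2 h1.reachable
  have huv : (G.deleteEdges {s(u, y)}).Adj u v := by
    refine SimpleGraph.deleteEdges_adj.2 ⟨h, fun e => hne ?_⟩
    rw [Set.mem_singleton_iff, Sym2.congr_right] at e
    rw [hy, e]
  have huv' : (G.deleteEdges {s(u, y)}).Adj v' u' := by
    refine SimpleGraph.deleteEdges_adj.2 ⟨h'.symm, fun e => hne ?_⟩
    rw [Set.mem_singleton_iff, Sym2.eq_iff] at e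
    rcases e with ⟨rfl, -⟩ | ⟨rfl, -⟩
    exacts [hv.symm, hy.trans hv.symm]
  exact h3 (huv.reachable.trans ((reachable_of_cls hv hne).trans
    (huv'.reachable.trans h2.symm)))

/-- No two edges are parallel after the contraction. -/
theorem eq_of_map_cls {u v : V} {e : Sym2 V} (h : G.Adj u v) (he : e ∈ G.edgeSet)
    (hne : cls u ≠ cls v) (hm : e.map cls = s(cls u, cls v)) : e = s(u, v) := by
  induction e with | h x y
  rw [Sym2.map_mk, Sym2.eq_iff] at hm
  rw [SimpleGraph.mem_edgeSet] at he
  rcases hm with ⟨h1, h2⟩ | ⟨h1, h2⟩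
  · rw [eq_of_cls_left h he hne h1.symm h2.symm,
      eq_of_cls_left h.symm he.symm hne.symm h2.symm h1.symm]
  · rw [eq_of_cls_left h he.symm hne h2.symm h1.symm,
      eq_of_cls_left h.symm he hne.symm h1.symm h2.symm, Sym2.eq_swap]

theorem contractBridges_adj {u v : V} (h : G.Adj u v) (hne : cls u ≠ cls v) :
    (contractBridges G).Adj (cls u) (cls v) := ⟨hne, u, v, rfl, rfl, h⟩

theorem exists_contracted_walk {u v : V} (p : G.Walk u v) :
    ∃ q : (contractBridges G).Walk (cls u) (cls v), q.length ≤ p.length := by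
  induction p with
  | nil => exact ⟨.nil, le_rfl⟩
  | @cons a b c h p ih =>
    obtain ⟨q, hq⟩ := ih
    by_cases hne : cls a = cls b
    · exact ⟨q.copy hne.symm rfl, by simp; omega⟩
    · exact ⟨.cons (contractBridges_adj h hne) q, by simpa using hq⟩

theorem edist_contractBridges_le (u v : V) :
    (contractBridges G).edist (cls u) (cls v) ≤ G.edist u v := by
  refine le_iInf fun p => ?_
  obtain ⟨q, hq⟩ := exists_contracted_walk p
  exact (SimpleGraph.edist_le q).trans (by exact_mod_cast hq)

theorem cls_surjective : Function.Surjective cls := fun c => c.exists_rep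

theorem contractBridges_connected (hG : G.Connected) : (contractBridges G).Connected := by
  have := hG.nonempty
  refine ⟨fun a b => ?_⟩
  obtain ⟨u, rfl⟩ := cls_surjective a
  obtain ⟨v, rfl⟩ := cls_surjective b
  obtain ⟨p⟩ := hG.preconnected u v
  exact ⟨(exists_contracted_walk p).choose⟩

/-- An edge of the contraction comes from an edge that is not a bridge. A detour around that edge
projects to a detour around its image, because no other edge has the same image. -/
theorem contractBridges_bridgeless (hG : G.Connected) : Bridgeless (contractBridges G) := by
  refine ⟨contractBridges_connected hG, fun e he hb => ?_⟩
  induction e with | h a b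
  obtain ⟨hne, u, v, rfl, rfl, huv⟩ := he
  have hnb : ¬ G.IsBridge s(u, v) := fun h =>
    hne (cls_eq_iff.2 (bridgeGraph_adj.2 ⟨huv, h⟩ : (bridgeGraph G).Adj u v).reachable)
  rw [SimpleGraph.isBridge_iff, not_not] at hnb
  obtain ⟨p⟩ := hnb
  rw [SimpleGraph.isBridge_iff] at hb
  have key : ∀ {x y : V}, (G.deleteEdges {s(u, v)}).Walk x y →
      ((contractBridges G).deleteEdges {s(cls u, cls v)}).Reachable (cls x) (cls y) := by
    intro x y p
    induction p with
    | nil => exact .refl _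
    | @cons x z y h _ ih =>
      obtain ⟨hxz, hxz'⟩ := SimpleGraph.deleteEdges_adj.1 h
      by_cases hc : cls x = cls z
      · rw [hc]
        exact ih
      · refine SimpleGraph.Reachable.trans (SimpleGraph.Adj.reachable ?_) ih
        refine SimpleGraph.deleteEdges_adj.2 ⟨contractBridges_adj hxz hc, fun e => hxz' ?_⟩
        exact eq_of_map_cls huv hxz hne e
  exact hb (key p)

/-- A walk in the contracted graph lifts to the graph. -/
theorem exists_lifted_walk {a b : (bridgeGraph G).ConnectedComponent}
    (q : (contractBridges G).Walk a b) : ∀ u v : V, cls u = a → cls v = b →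
      ∃ p : G.Walk u v, ∀ e ∈ p.edges, e ∈ (bridgeGraph G).edgeSet ∨ e.map cls ∈ q.edges := by
  have hin : ∀ u v : V, cls u = cls v →
      ∃ p : G.Walk u v, ∀ e ∈ p.edges, e ∈ (bridgeGraph G).edgeSet := by
    intro u v h
    obtain ⟨p⟩ := cls_eq_iff.1 h
    refine ⟨p.mapLe bridgeGraph_le, fun e he => ?_⟩
    rw [SimpleGraph.Walk.edges_mapLe_eq_edges] at he
    exact p.edges_subset_edgeSet he
  induction q with
  | nil =>
    intro u v hu hv
    obtain ⟨p, hp⟩ := hin u v (hu.trans hv.symm)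
    exact ⟨p, fun e he => .inl (hp e he)⟩
  | @cons a b c h q ih =>
    intro u v hu hv
    have h' := h
    obtain ⟨hne, x, y, hx, hy, hxy⟩ := h'
    obtain ⟨p, hp⟩ := hin u x (hu.trans hx.symm)
    obtain ⟨p', hp'⟩ := ih y v hy hv
    refine ⟨p.append (.cons hxy p'), fun e he => ?_⟩
    rw [SimpleGraph.Walk.edges_append, List.mem_append, SimpleGraph.Walk.edges_cons,
      List.mem_cons] at he
    rw [SimpleGraph.Walk.edges_cons, List.mem_cons]
    rcases he with he | rfl | he
    · exact .inl (hp e he)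
    · exact .inr (.inl (by rw [Sym2.map_mk, hx, hy]))
    · exact (hp' e he).imp_right .inr

/-- Colour each non-bridge like its image and give the bridges private colours from `rc
(contractBridges G)` on. A rainbow path of the contraction lifts through the classes by bridges. -/
theorem rc_le_contractBridges [Finite V] (hG : G.Connected) :
    rc G ≤ rc (contractBridges G) + numBridges G := by
  have hfin : Finite (bridgeGraph G).ConnectedComponent := Finite.of_surjective _ cls_surjective
  obtain ⟨col, hc, hr⟩ := exists_colouring_rc (contractBridges_connected hG)
  have hmem : ∀ e, e ∈ (bridgeGraph G).edgeSet ↔ e ∈ {e | e ∈ G.edgeSet ∧ G.IsBridge e} := by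
    intro e
    induction e with | h x y
    exact bridgeGraph_adj
  let f : {e | e ∈ G.edgeSet ∧ G.IsBridge e} ≃ Fin (numBridges G) :=
    Finite.equivFinOfCardEq (Nat.card_coe_set_eq _)
  classical
  have hedge : ∀ e ∈ G.edgeSet, e ∉ {e | e ∈ G.edgeSet ∧ G.IsBridge e} →
      e.map cls ∈ (contractBridges G).edgeSet := by
    intro e he hb
    induction e with | h x y
    exact contractBridges_adj he fun h => hb (bridgeGraph_adj.1 (bridgeGraph_adj_of_cls he h))
  let col' : Sym2 V → ℕ := fun e => if he : e ∈ {e | e ∈ G.edgeSet ∧ G.IsBridge e} then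
    rc (contractBridges G) + f ⟨e, he⟩ else col (e.map cls)
  refine Nat.sInf_le ⟨col', fun e he => ?_, fun u v => ?_⟩
  · by_cases hb : e ∈ {e | e ∈ G.edgeSet ∧ G.IsBridge e}
    · have := (f ⟨e, hb⟩).2
      simp only [col', dif_pos hb]
      omega
    · have := hc _ (hedge e he hb)
      simp only [col', dif_neg hb]
      omega
  · obtain ⟨q, hq, hn⟩ := hr (cls u) (cls v)
    obtain ⟨p, hp⟩ := exists_lifted_walk q u v rfl rfl
    -- A path repeats no edge, so it remains to see that edges of equal colour coincide: for bridges
    -- by their private colours, for other edges because their images are the same edge of the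
    -- rainbow path `q`, and the two ranges of colours do not meet.
    refine ⟨p.bypass, p.bypass_isPath, List.Nodup.map_on ?_ p.bypass_isPath.edges_nodup⟩
    intro x hx y hy hxy
    have hx1 := p.edges_bypass_subset_edges hx
    have hy1 := p.edges_bypass_subset_edges hy
    have hx2 := p.edges_subset_edgeSet hx1
    have hy2 := p.edges_subset_edgeSet hy1
    by_cases hbx : x ∈ {e | e ∈ G.edgeSet ∧ G.IsBridge e} <;>
      by_cases hby : y ∈ {e | e ∈ G.edgeSet ∧ G.IsBridge e}
    · simp only [col', dif_pos hbx, dif_pos hby] at hxy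
      have := f.injective (a₁ := ⟨x, hbx⟩) (a₂ := ⟨y, hby⟩) (Fin.ext (by omega))
      exact congrArg Subtype.val this
    · have := hc _ (hedge y hy2 hby)
      simp only [col', dif_pos hbx, dif_neg hby] at hxy
      omega
    · have := hc _ (hedge x hx2 hbx)
      simp only [col', dif_neg hbx, dif_pos hby] at hxy
      omega
    · simp only [col', dif_neg hbx, dif_neg hby] at hxy
      have hx3 := (hp x hx1).resolve_left fun h => hbx ((hmem x).1 h)
      have hy3 := (hp y hy1).resolve_left fun h => hby ((hmem y).1 h)
      have heq := List.inj_on_of_nodup_map hn hx3 hy3 hxy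
      have hne := hedge y hy2 hby
      induction y with | h a b
      exact eq_of_map_cls hy2 hx2 hne.1 heq

end Contract

end Rainbow

/-! ### Isomorphic copies and the bound by the radius -/

namespace Rainbow

section Transport

variable {V W : Type*}

theorem edist_le_of_hom {G : SimpleGraph V} {H : SimpleGraph W} (f : G →g H) (u v : V) :
    H.edist (f u) (f v) ≤ G.edist u v :=
  le_iInf fun p => (SimpleGraph.edist_le (p.map f)).trans (by simp)

theorem isBridge_of_hom {G : SimpleGraph V} {H : SimpleGraph W} (f : G →g H)
    (hf : Function.Injective f) {e : Sym2 V} (h : H.IsBridge (e.map f)) : G.IsBridge e := by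
  induction e with | h a b
  rw [Sym2.map_mk, SimpleGraph.isBridge_iff] at h
  rw [SimpleGraph.isBridge_iff]
  refine fun hr => h (hr.map ⟨f, fun {x y} hxy => ?_⟩)
  rw [SimpleGraph.deleteEdges_adj] at hxy ⊢
  refine ⟨f.map_adj hxy.1, fun e => hxy.2 (Sym2.map.injective hf ?_)⟩
  simpa using e

theorem numBridges_le_of_iso [Finite V] {G : SimpleGraph V} {H : SimpleGraph W} (f : G ≃g H) :
    numBridges H ≤ numBridges G := by
  refine (Set.ncard_le_ncard (t := Sym2.map f '' {e | e ∈ G.edgeSet ∧ G.IsBridge e}) ?_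
    (Set.toFinite _)).trans (Set.ncard_image_le (Set.toFinite _))
  rintro e ⟨he, hb⟩
  have hfe : (e.map f.symm).map f = e := by
    simp [Sym2.map_map]
  refine ⟨e.map f.symm, ⟨?_, isBridge_of_hom f.toHom f.injective (by simpa [hfe] using hb)⟩, hfe⟩
  induction e with | h x y
  exact f.symm.map_adj_iff.2 he

theorem rc_le_of_iso [Finite V] [Finite W] {G : SimpleGraph V} {H : SimpleGraph W} (f : G ≃g H)
    (hH : H.Connected) : rc G ≤ rc H := by
  obtain ⟨col, hc, hr⟩ := exists_colouring_rc hH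
  refine Nat.sInf_le ⟨fun e => col (e.map f), fun e he => hc _ ?_, fun u v => ?_⟩
  · induction e with | h x y
    exact f.map_adj_iff.2 he
  · obtain ⟨p, hp, hn⟩ := hr (f u) (f v)
    refine ⟨(p.map f.symm.toHom).copy (by simp) (by simp), ?_, ?_⟩
    · simpa using hp.map f.symm.injective
    · have hcol : (fun e : Sym2 V => col (e.map f)) ∘ Sym2.map f.symm = col := by
        funext e
        simp [Sym2.map_map]
      simpa [SimpleGraph.Walk.edges_map, List.map_map, hcol] using hn

theorem exists_isEdgeList {n : ℕ} (G : SimpleGraph (Fin n)) :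
    ∃ (m : ℕ) (e : Fin m → Fin n × Fin n), IsEdgeList G e := by
  obtain ⟨m, ⟨g⟩⟩ := Finite.exists_equiv_fin G.edgeSet
  have h : (fun i => s((Quot.out (g.symm i).1).1, (Quot.out (g.symm i).1).2)) =
      fun i => (g.symm i : Sym2 (Fin n)) := funext fun i => Quot.out_eq _
  refine ⟨m, fun i => Quot.out (g.symm i).1, ?_, ?_⟩
  · rw [h]
    exact Subtype.val_injective.comp g.symm.injective
  · rw [h]
    exact (g.symm.surjective.range_comp _).trans Subtype.range_val

/-- The existence statement is read off from the algorithm, run on a copy of the graph with vertices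
`Fin n`. -/
theorem rc_le_radius [Finite V] {G : SimpleGraph V} (hG : G.Connected) :
    rc G ≤ G.radius.toNat * (G.radius.toNat + 2) + numBridges G := by
  have := hG.nonempty
  obtain ⟨n, ⟨φ⟩⟩ := Finite.exists_equiv_fin V
  let f : G ≃g G.map φ.toEmbedding := SimpleGraph.Iso.map φ G
  have hH : (G.map φ.toEmbedding).Connected := f.connected_iff.1 hG
  obtain ⟨m, e, he⟩ := exists_isEdgeList (G.map φ.toEmbedding)
  obtain ⟨k, h, ⟨-, -, -, -, col, -, hcol, hk⟩, hh, hkh⟩ := he.colourFromCentre hH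
  have hrad : (G.map φ.toEmbedding).radius.toNat ≤ G.radius.toNat :=
    ENat.toNat_le_toNat (radius_le_of_surjective f.surjective (edist_le_of_hom f.toHom))
      (ne_top_of_le_ne_top (ENat.natCast_ne_top _) (G.radius_le_ediam.trans (ediam_le_rc hG)))
  have hb := numBridges_le_of_iso f
  have hr := (rc_le_of_iso f hH).trans (rc_le_ncard hcol)
  have hm : h * (h + 2) ≤ G.radius.toNat * (G.radius.toNat + 2) := by gcongr <;> omega
  omega

end Transport

theorem numBridges_of_bridgeless {V : Type*} {G : SimpleGraph V} (hG : Bridgeless G) :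
    numBridges G = 0 := by
  have h : {e | e ∈ G.edgeSet ∧ G.IsBridge e} = ∅ :=
    Set.eq_empty_of_forall_notMem fun e he => hG.2 e he.1 he.2
  rw [numBridges, h, Set.ncard_empty]

/-- With `c = rc G` the second bound comes from `r * (r + 2) ≤ (r + 2) * c`, a consequence of `r ≤
c`. -/
theorem colours_le {k h r b c : ℕ} (hk : k ≤ h * (h + 2) + b) (hr : h ≤ r) (hrc : r ≤ c) :
    k ≤ r * (r + 2) + b ∧ k ≤ (r + 2) * c + b := by
  have h1 : h * (h + 2) ≤ r * (r + 2) := by gcongr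
  have h2 : r * (r + 2) ≤ (r + 2) * c := by rw [mul_comm]; gcongr
  omega

end Rainbow

/-! ### The main theorem -/

theorem mainTheorem5 :
    -- bridgeless graphs, time `O(nm)`, factor `r + 2`
    (∃ (p : Rainbow.Prog) (w C : ℕ), ∀ (n m : ℕ) (G : SimpleGraph (Fin n))
      (e : Fin m → Fin n × Fin n), Rainbow.IsEdgeList G e → Rainbow.Bridgeless G →
        ∃ k : ℕ, Rainbow.RainbowColours p ((n + 2) ^ w) (C * (n * m + 1)) G e k ∧
          k ≤ G.radius.toNat * (G.radius.toNat + 2) ∧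
          k ≤ (G.radius.toNat + 2) * Rainbow.rc G) ∧
    -- bridgeless graphs, time `O(dm)`, factor `d + 2`
    (∃ (p : Rainbow.Prog) (w C : ℕ), ∀ (n m : ℕ) (G : SimpleGraph (Fin n))
      (e : Fin m → Fin n × Fin n), Rainbow.IsEdgeList G e → Rainbow.Bridgeless G →
        ∃ k : ℕ, Rainbow.RainbowColours p ((n + 2) ^ w) (C * (G.diam * m + 1)) G e k ∧
          k ≤ G.diam * (G.diam + 2) ∧
          k ≤ (G.diam + 2) * Rainbow.rc G) ∧
    -- contraction of the bridges of a connected graph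
    (∀ (V : Type*) [Finite V] (G : SimpleGraph V), G.Connected →
      Rainbow.Bridgeless (Rainbow.contractBridges G) ∧
      (Rainbow.contractBridges G).radius ≤ G.radius ∧
      (Rainbow.contractBridges G).diam ≤ G.diam ∧
      Rainbow.rc G ≤ Rainbow.rc (Rainbow.contractBridges G) + Rainbow.numBridges G ∧
      Rainbow.rc G ≤ G.radius.toNat * (G.radius.toNat + 2) + Rainbow.numBridges G) ∧
    -- connected graphs, time `O(nm)`, factor `r + 3`
    (∃ (p : Rainbow.Prog) (w C : ℕ), ∀ (n m : ℕ) (G : SimpleGraph (Fin n))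
      (e : Fin m → Fin n × Fin n), Rainbow.IsEdgeList G e → G.Connected →
        ∃ k : ℕ, Rainbow.RainbowColours p ((n + 2) ^ w) (C * (n * m + 1)) G e k ∧
          k ≤ G.radius.toNat * (G.radius.toNat + 2) + Rainbow.numBridges G ∧
          k ≤ (G.radius.toNat + 3) * Rainbow.rc G) ∧
    -- connected graphs, time `O(dm)`, factor `d + 3`
    (∃ (p : Rainbow.Prog) (w C : ℕ), ∀ (n m : ℕ) (G : SimpleGraph (Fin n))
      (e : Fin m → Fin n × Fin n), Rainbow.IsEdgeList G e → G.Connected →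
        ∃ k : ℕ, Rainbow.RainbowColours p ((n + 2) ^ w) (C * (G.diam * m + 1)) G e k ∧
          k ≤ G.diam * (G.diam + 2) + Rainbow.numBridges G ∧
          k ≤ (G.diam + 3) * Rainbow.rc G) := by
  refine ⟨⟨Rainbow.colourFromCentre, 17, 5000, fun n m G e he hG => ?_⟩,
    ⟨Rainbow.colourFromVertex, 17, 2000, fun n m G e he hG => ?_⟩, fun V _ G hG => ?_,
    ⟨Rainbow.colourFromCentre, 17, 5000, fun n m G e he hG => ?_⟩,
    ⟨Rainbow.colourFromVertex, 17, 2000, fun n m G e he hG => ?_⟩⟩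
  · obtain ⟨k, h, hcol, hh, hk⟩ := he.colourFromCentre hG.1
    have := Rainbow.colours_le hk hh (Rainbow.radius_le_rc hG.1)
    rw [Rainbow.numBridges_of_bridgeless hG] at this
    exact ⟨k, hcol, this⟩
  · obtain ⟨k, h, hcol, hh, hk⟩ := he.colourFromVertex hG.1
    have := Rainbow.colours_le hk hh (Rainbow.diam_le_rc hG.1)
    rw [Rainbow.numBridges_of_bridgeless hG] at this
    exact ⟨k, hcol, this⟩
  · have := hG.nonempty
    exact ⟨Rainbow.contractBridges_bridgeless hG,
      Rainbow.radius_le_of_surjective Rainbow.cls_surjective Rainbow.edist_contractBridges_le,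
      ENat.toNat_le_toNat (Rainbow.ediam_le_of_surjective Rainbow.cls_surjective
        Rainbow.edist_contractBridges_le)
        (ne_top_of_le_ne_top (ENat.natCast_ne_top _) (Rainbow.ediam_le_rc hG)),
      Rainbow.rc_le_contractBridges hG, Rainbow.rc_le_radius hG⟩
  · obtain ⟨k, h, hcol, hh, hk⟩ := he.colourFromCentre hG
    have h1 := Rainbow.colours_le hk hh (Rainbow.radius_le_rc hG)
    -- The bridges cost at most one more `rc G`, which raises the factor from `r + 2` to `r + 3`.
    have h2 := Rainbow.numBridges_le_rc hG
    exact ⟨k, hcol, h1.1, by linarith [h1.2]⟩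
  · obtain ⟨k, h, hcol, hh, hk⟩ := he.colourFromVertex hG
    have h1 := Rainbow.colours_le hk hh (Rainbow.diam_le_rc hG)
    have h2 := Rainbow.numBridges_le_rc hG
    exact ⟨k, hcol, h1.1, by linarith [h1.2]⟩
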